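/- Let $\overline M$ be a smooth or real-analytic manifold with boundary, of dimension $n\ge 2$, with a projective structure $[\nabla]$ (a projective equivalence class of torsion-free affine connections) of the same regularity. Let $G=PGL(n+1,\mathbb R)$ act on $\mathbb{RP}^n$ with homogeneous coordinates $X_0,\dots,X_n$, let $H\subset G$ be the isotropy group of $o=[0:\dots:0:1]$, let $\tilde G\subset G$ be the stabiliser of the hyperplane $\mathcal H=\{X_0=0\}$ and $\tilde H=\tilde G\cap H$ the isotropy group of $o\in\mathcal H$ in $\tilde G$. Let $P\to\overline M$ be the principal $H$-bundle of $[\nabla]$ (the reduction to $H$ of the bundle of second-order frames whose points are, in any chart, the frames $(u^i_j,u^i_{jk})$ with $u^i_j=A^i_j$, $u^i_{jk}=-\Pi^i_{lm}A^l_jA^m_k-A^i_j\Upsilon_k-A^i_k\Upsilon_j$, where $A\in GL(n,\mathbb R)$, $\Upsilon\in(\mathbb R^n)^*$ and $\Pi^i_{jk}$ is the trace-free part of the Christoffel symbols). Let $\omega$ be the normal projective Cartan connection on $P$, i.e. the Cartan connection of type $G/H$ on $P$ whose pullback along the section $(\delta^i_j,-\alpha^i_{jk})$ given by a chart $(x^i)$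 and a connection in the class, with connection forms $\alpha^i_j=\alpha^i_{jk}dx^k$, is $$\begin{pmatrix}\alpha^i_j-\frac1{n+1}\alpha^l_l\,\delta^i_j & dx^i\\ -P_{lj}\,dx^l & -\frac1{n+1}\alpha^l_l\end{pmatrix},\qquad (n-1)P_{ab}=R_{ab}-\tfrac{2}{n+1}R_{[ab]},$$ $R_{ab}$ being the Ricci tensor. (The Lie algebra of $G$ is identified with the trace-free matrices.) Suppose that at every boundary point there are a boundary chart $(x^0=r,\,x^\mu=y^\mu)$ and a connection in $[\nabla]$ such that $\alpha^0_\mu\in\operatorname{span}(dr)$ at that point for all $1\le\mu\le n-1$. Let $Q\subset P|_{\partial M}$ be the set of points over $\partial M$ whose linear frame $\mathbb R^n\to T_x\overline M$ maps $\{v^0=0\}$ onto $T_x\partial M$. Then: 1. at boundary points, the sections $(\delta^i_j,-\alpha^i_{jk})$ of $P$ given by boundary charts and connections in the class take values in $Q$; 2. $Q$ is an embedded submanifold of $P$ and, with the restriction of the action, a principal $\tilde H$-bundle over $\partial M$; the pullback of $\omega$ to $Q$ takes values in the Lie algebra $\tilde{\mathfrak g}$ of $\tilde G$ and is a Cartan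 connection: it is $\mathrm{Ad}$-equivariant under $\tilde H$, reproduces the generators of the fundamental vector fields of $Q$, and is a linear isomorphism $T_qQ\to\tilde{\mathfrak g}$ at every $q\in Q$. So $(Q,\omega|_Q)$ is a Cartan geometry on $\partial M$ modelled on $\tilde G/\tilde H$; 3. the Klein geometry $\tilde G/\tilde H$ is not effective: $\tilde G$ does not act faithfully on $\tilde G/\tilde H$. -/

import Mathlib

open scoped Manifold ContDiff

noncomputable section

namespace ProjBoundary

open Set Filter Topology

/-- The coordinate space `ℝⁿ`, `n = d + 1`, with coordinates `x⁰ = r`, `x^μ = y^μ`. -/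
abbrev Coord (d : ℕ) : Type := EuclideanSpace ℝ (Fin (d + 1))

section Boundary

/-- The inclusion `y ↦ (0, y)` of `ℝ^{n-1}` in `ℝⁿ`. -/
def insertZero (d : ℕ) : EuclideanSpace ℝ (Fin d) →L[ℝ] Coord d :=
  LinearMap.toContinuousLinearMap
    { toFun := fun y => WithLp.toLp 2 (Fin.cons 0 y.ofLp)
      map_add' := fun y z => by
        ext i; refine Fin.cases ?_ (fun j => ?_) i <;> simp
      map_smul' := fun a y => by
        ext i; refine Fin.cases ?_ (fun j => ?_) i <;> simp }

/-- The projection `(r, y) ↦ y` from `ℝⁿ` to `ℝ^{n-1}`. -/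
def dropZero (d : ℕ) : Coord d →L[ℝ] EuclideanSpace ℝ (Fin d) :=
  LinearMap.toContinuousLinearMap
    { toFun := fun y => WithLp.toLp 2 (fun i => y i.succ)
      map_add' := fun y z => by ext i; simp
      map_smul' := fun a y => by ext i; simp }

theorem insertZero_zero {d : ℕ} (y : EuclideanSpace ℝ (Fin d)) : insertZero d y 0 = 0 := rfl

theorem dropZero_insertZero {d : ℕ} (y : EuclideanSpace ℝ (Fin d)) :
    dropZero d (insertZero d y) = y := by
  ext i; rfl

theorem insertZero_dropZero {d : ℕ} {z : Coord d} (hz : z 0 = 0) :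
    insertZero d (dropZero d z) = z := by
  ext i
  refine Fin.cases ?_ (fun j => ?_) i
  · rw [hz]; rfl
  · rfl

/-- The point `(0, y)` of the half-space. -/
def boundaryPoint {d : ℕ} (y : EuclideanSpace ℝ (Fin d)) : EuclideanHalfSpace (d + 1) :=
  ⟨insertZero d y, (insertZero_zero y).ge⟩

variable {d : ℕ} {M : Type*} [TopologicalSpace M] [ChartedSpace (EuclideanHalfSpace (d + 1)) M]

theorem mem_boundary_iff [IsManifold (𝓡∂ (d + 1)) 1 M]
    {e : OpenPartialHomeomorph M (EuclideanHalfSpace (d + 1))}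
    (he : e ∈ atlas (EuclideanHalfSpace (d + 1)) M) {x : M} (hx : x ∈ e.source) :
    x ∈ (𝓡∂ (d + 1)).boundary M ↔ (e x).1 0 = 0 := by
  have h1 : x ∈ (𝓡∂ (d + 1)).boundary M ↔ ¬ (𝓡∂ (d + 1)).IsInteriorPoint x :=
    ModelWithCorners.isBoundaryPoint_iff_not_isInteriorPoint x
  rw [h1, (𝓡∂ (d + 1)).isInteriorPoint_iff_of_mem_atlas (n := 1) one_ne_zero he hx]
  have h2 : e.extend (𝓡∂ (d + 1)) x ∈ interior (e.extend (𝓡∂ (d + 1))).target ↔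
      (𝓡∂ (d + 1)) (e x) ∈ interior (range (𝓡∂ (d + 1))) :=
    ⟨fun h => e.interior_extend_target_subset_interior_range h,
      fun h => e.mem_interior_extend_target (e.map_source hx) h⟩
  rw [h2, interior_range_modelWithCornersEuclideanHalfSpace]
  have h3 : 0 ≤ (e x).1 0 := (e x).2
  change ¬ (0 < (e x).1 0) ↔ _
  constructor
  · intro h; exact le_antisymm (not_lt.1 h) h3
  · intro h; rw [h]; exact lt_irrefl _

theorem continuous_boundaryPoint : Continuous (boundaryPoint (d := d)) :=
  (insertZero d).continuous.subtype_mk _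

theorem boundaryPoint_dropZero {z : EuclideanHalfSpace (d + 1)} (hz : z.1 0 = 0) :
    boundaryPoint (dropZero d z.1) = z :=
  Subtype.ext (insertZero_dropZero hz)

open Classical in
/-- The chart `y` of `∂M` obtained from a boundary chart `(r, y)` of `M` (the point `x₀` is only used
outside the target of the chart). -/
def boundaryChart [IsManifold (𝓡∂ (d + 1)) 1 M]
    (e : OpenPartialHomeomorph M (EuclideanHalfSpace (d + 1)))
    (he : e ∈ atlas (EuclideanHalfSpace (d + 1)) M)
    (x₀ : (𝓡∂ (d + 1)).boundary M) :
    OpenPartialHomeomorph ((𝓡∂ (d + 1)).boundary M) (EuclideanSpace ℝ (Fin d)) where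
  toFun x := dropZero d (e x.1).1
  invFun y := if h : boundaryPoint y ∈ e.target then
      ⟨e.symm (boundaryPoint y), (mem_boundary_iff he (e.map_target h)).2 (by
        rw [e.right_inv h]; exact insertZero_zero y)⟩
    else x₀
  source := {x | x.1 ∈ e.source}
  target := {y | boundaryPoint y ∈ e.target}
  map_source' x hx := by
    change boundaryPoint _ ∈ e.target
    rw [boundaryPoint_dropZero ((mem_boundary_iff he hx).1 x.2)]
    exact e.map_source hx
  map_target' y hy := by
    change (dite _ _ _ : (𝓡∂ (d + 1)).boundary M).1 ∈ e.source
    rw [dif_pos (show boundaryPoint y ∈ e.target from hy)]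
    exact e.map_target hy
  left_inv' x hx := by
    have h : boundaryPoint (dropZero d (e x.1).1) = e x.1 :=
      boundaryPoint_dropZero ((mem_boundary_iff he hx).1 x.2)
    have h' : boundaryPoint (dropZero d (e x.1).1) ∈ e.target := by
      rw [h]; exact e.map_source hx
    rw [dif_pos h']
    apply Subtype.ext
    change e.symm _ = x.1
    rw [h, e.left_inv hx]
  right_inv' y hy := by
    rw [dif_pos (show boundaryPoint y ∈ e.target from hy)]
    change dropZero d (e (e.symm (boundaryPoint y))).1 = y
    rw [e.right_inv hy]
    exact dropZero_insertZero y
  open_source := e.open_source.preimage continuous_subtype_val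
  open_target := e.open_target.preimage continuous_boundaryPoint
  continuousOn_toFun := by
    refine (dropZero d).continuous.comp_continuousOn (continuous_subtype_val.comp_continuousOn ?_)
    exact e.continuousOn.comp continuous_subtype_val.continuousOn fun x hx => hx
  continuousOn_invFun := by
    rw [Topology.IsInducing.subtypeVal.continuousOn_iff]
    refine (e.continuousOn_symm.comp continuous_boundaryPoint.continuousOn
      fun y hy => hy).congr fun y hy => ?_
    change (dite _ _ _ : (𝓡∂ (d + 1)).boundary M).1 = _
    rw [dif_pos (show boundaryPoint y ∈ e.target from hy)]
    rfl

/-- The boundary `∂M` is a manifold of dimension `n - 1`, with the charts `y` given by the charts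
`(r, y)` of `M`. -/
instance boundaryChartedSpace [IsManifold (𝓡∂ (d + 1)) 1 M] :
    ChartedSpace (EuclideanSpace ℝ (Fin d)) ((𝓡∂ (d + 1)).boundary M) where
  atlas := {φ | ∃ (e : OpenPartialHomeomorph M (EuclideanHalfSpace (d + 1)))
    (he : e ∈ atlas (EuclideanHalfSpace (d + 1)) M) (x₀ : _), φ = boundaryChart e he x₀}
  chartAt x := boundaryChart (chartAt (EuclideanHalfSpace (d + 1)) x.1) (chart_mem_atlas _ _) x
  mem_chart_source x := mem_chart_source (EuclideanHalfSpace (d + 1)) x.1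
  chart_mem_atlas x := ⟨_, chart_mem_atlas _ _, x, rfl⟩

open Classical in
instance boundaryIsManifold {k : WithTop ℕ∞} [IsManifold (𝓡∂ (d + 1)) 1 M]
    [IsManifold (𝓡∂ (d + 1)) k M] : IsManifold (𝓡 d) k ((𝓡∂ (d + 1)).boundary M) := by
  apply isManifold_of_contDiffOn
  rintro _ _ ⟨e, he, x₀, rfl⟩ ⟨e', he', x₀', rfl⟩
  have h1 : ContDiffOn ℝ k (fun y => dropZero d (((𝓡∂ (d + 1)).extendCoordChange e e') (insertZero d y)))
      {y | insertZero d y ∈ ((𝓡∂ (d + 1)).extendCoordChange e e').source} :=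
    (dropZero d).contDiff.comp_contDiffOn
      (((𝓡∂ (d + 1)).contDiffOn_extendCoordChange (n := k) (IsManifold.subset_maximalAtlas he)
        (IsManifold.subset_maximalAtlas he')).comp (insertZero d).contDiff.contDiffOn fun y hy => hy)
  have h0 : ∀ y : EuclideanSpace ℝ (Fin d), (𝓡∂ (d + 1)).symm (insertZero d y) = boundaryPoint y :=
    fun y => (𝓡∂ (d + 1)).left_inv (boundaryPoint y)
  have hv : ∀ y, boundaryPoint y ∈ e.target →
      ((boundaryChart e he x₀).symm y).1 = e.symm (boundaryPoint y) := by
    intro y hy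
    change (dite _ _ _ : (𝓡∂ (d + 1)).boundary M).1 = _
    rw [dif_pos hy]
  refine (h1.mono ?_).congr ?_
  · rintro y ⟨⟨hy1, hy2⟩, -⟩
    have hy1' : boundaryPoint y ∈ e.target := hy1
    have hy2' : e.symm (boundaryPoint y) ∈ e'.source := by
      rw [← hv y hy1']; exact hy2
    rw [mem_ofPred_eq, ModelWithCorners.extendCoordChange_source]
    exact ⟨boundaryPoint y, ⟨hy1', hy2'⟩, rfl⟩
  · rintro y ⟨⟨hy1, hy2⟩, -⟩
    have hy1' : boundaryPoint y ∈ e.target := hy1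
    change dropZero d (e' ((boundaryChart e he x₀).symm y).1).1 =
      dropZero d (e' (e.symm ((𝓡∂ (d + 1)).symm (insertZero d y)))).1
    rw [h0, hv y hy1']

end Boundary

section Frames

theorem contDiff_clm_det {d : ℕ} {n : WithTop ℕ∞} :
    ContDiff ℝ n (fun A : Coord d →L[ℝ] Coord d => A.det) := by
  have h : (fun A : Coord d →L[ℝ] Coord d => A.det) = fun A =>
      ∑ σ : Equiv.Perm (Fin (d + 1)), ((Equiv.Perm.sign σ : ℤ) : ℝ) *
        ∏ i, (A (EuclideanSpace.basisFun (Fin (d + 1)) ℝ i)) (σ i) := by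
    funext A
    rw [ContinuousLinearMap.det,
      ← LinearMap.det_toMatrix (EuclideanSpace.basisFun (Fin (d + 1)) ℝ).toBasis, Matrix.det_apply']
    simp [LinearMap.toMatrix_apply]
  rw [h]
  refine ContDiff.sum fun σ _ => contDiff_const.mul (contDiff_prod fun i _ => ?_)
  have : (fun A : Coord d →L[ℝ] Coord d =>
      (A (EuclideanSpace.basisFun (Fin (d + 1)) ℝ i)) (σ i)) = fun A =>
      ((EuclideanSpace.proj (σ i) : Coord d →L[ℝ] ℝ).comp
        (ContinuousLinearMap.apply ℝ (Coord d) (EuclideanSpace.basisFun (Fin (d + 1)) ℝ i))) A := rfl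
  rw [this]
  exact ContinuousLinearMap.contDiff _

section Core

variable {d : ℕ} {M : Type*} [TopologicalSpace M] [ChartedSpace (EuclideanHalfSpace (d + 1)) M]

/-- The change of coordinates from the chart `e` to the chart `e'`. -/
def chartChange (e e' : OpenPartialHomeomorph M (EuclideanHalfSpace (d + 1))) : Coord d → Coord d :=
  e'.extend (𝓡∂ (d + 1)) ∘ (e.extend (𝓡∂ (d + 1))).symm

/-- The derivative `g` of the change of coordinates from `e` to `e'`. -/
def jacobian (e e' : OpenPartialHomeomorph M (EuclideanHalfSpace (d + 1))) (z : Coord d) :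
    Coord d →L[ℝ] Coord d :=
  fderivWithin ℝ (chartChange e e') (range (𝓡∂ (d + 1))) z

/-- The function `log |det g|`. -/
def logJacobian (e e' : OpenPartialHomeomorph M (EuclideanHalfSpace (d + 1))) (z : Coord d) : ℝ :=
  Real.log |(jacobian e e' z).det|

/-- The one-form `- (1 / (n + 1)) d log |det g|`. -/
def logJacobianForm (e e' : OpenPartialHomeomorph M (EuclideanHalfSpace (d + 1))) (z : Coord d) :
    Coord d →L[ℝ] ℝ :=
  -((1 / ((d : ℝ) + 2)) • fderivWithin ℝ (logJacobian e e') (range (𝓡∂ (d + 1))) z)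

/-- Pairs `(A, Υ)`; with `A` invertible, `(A, Υ)` stands for the class of the matrix
`(A, 0; Υ, 1)` in the isotropy group `H ⊆ PGL(n+1, ℝ)` of a point. -/
abbrev ProjFiber (d : ℕ) : Type := (Coord d →L[ℝ] Coord d) × (Coord d →L[ℝ] ℝ)

/-- The product `(g, 0; u, 1) (A, 0; Υ, 1) = (g A, 0; u A + Υ, 1)`, as a function of `(A, Υ)`. -/
def leftTranslate {d : ℕ} (g : Coord d →L[ℝ] Coord d) (u : Coord d →L[ℝ] ℝ) :
    ProjFiber d →L[ℝ] ProjFiber d :=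
  ((ContinuousLinearMap.compL ℝ (Coord d) (Coord d) (Coord d) g).comp
      (ContinuousLinearMap.fst ℝ _ _)).prod
    ((ContinuousLinearMap.compL ℝ (Coord d) (Coord d) ℝ u).comp (ContinuousLinearMap.fst ℝ _ _) +
      ContinuousLinearMap.snd ℝ _ _)

theorem leftTranslate_apply (g : Coord d →L[ℝ] Coord d) (u : Coord d →L[ℝ] ℝ)
    (q : ProjFiber d) : leftTranslate g u q = (g.comp q.1, u.comp q.1 + q.2) := rfl

variable {e e' e'' : OpenPartialHomeomorph M (EuclideanHalfSpace (d + 1))} {x : M}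

theorem chartChange_contDiffWithinAt {n : WithTop ℕ∞} [IsManifold (𝓡∂ (d + 1)) n M]
    (he : e ∈ atlas (EuclideanHalfSpace (d + 1)) M) (he' : e' ∈ atlas (EuclideanHalfSpace (d + 1)) M)
    (hx : x ∈ e.source) (hx' : x ∈ e'.source) :
    ContDiffWithinAt ℝ n (chartChange e e') (range (𝓡∂ (d + 1))) (e.extend (𝓡∂ (d + 1)) x) :=
  (𝓡∂ (d + 1)).contDiffWithinAt_extendCoordChange' (IsManifold.subset_maximalAtlas he)
    (IsManifold.subset_maximalAtlas he') hx hx'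

theorem jacobian_contDiffWithinAt {m n : WithTop ℕ∞} [IsManifold (𝓡∂ (d + 1)) n M] (hmn : m + 1 ≤ n)
    (he : e ∈ atlas (EuclideanHalfSpace (d + 1)) M) (he' : e' ∈ atlas (EuclideanHalfSpace (d + 1)) M)
    (hx : x ∈ e.source) (hx' : x ∈ e'.source) :
    ContDiffWithinAt ℝ m (jacobian e e') (range (𝓡∂ (d + 1))) (e.extend (𝓡∂ (d + 1)) x) :=
  (chartChange_contDiffWithinAt (n := n) he he' hx hx').fderivWithin_right
    (𝓡∂ (d + 1)).uniqueDiffOn hmn (mem_range_self _)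

theorem jacobian_self [IsManifold (𝓡∂ (d + 1)) 1 M]
    (he : e ∈ atlas (EuclideanHalfSpace (d + 1)) M) (hx : x ∈ e.source) :
    jacobian e e (e.extend (𝓡∂ (d + 1)) x) = ContinuousLinearMap.id ℝ (Coord d) := by
  ext1 v
  exact (tangentBundleCore (𝓡∂ (d + 1)) M).coordChange_self ⟨e, he⟩ x hx v

theorem jacobian_comp [IsManifold (𝓡∂ (d + 1)) 1 M]
    (he : e ∈ atlas (EuclideanHalfSpace (d + 1)) M) (he' : e' ∈ atlas (EuclideanHalfSpace (d + 1)) M)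
    (he'' : e'' ∈ atlas (EuclideanHalfSpace (d + 1)) M)
    (hx : x ∈ e.source) (hx' : x ∈ e'.source) (hx'' : x ∈ e''.source) :
    (jacobian e' e'' (e'.extend (𝓡∂ (d + 1)) x)).comp (jacobian e e' (e.extend (𝓡∂ (d + 1)) x)) =
      jacobian e e'' (e.extend (𝓡∂ (d + 1)) x) := by
  ext1 v
  exact (tangentBundleCore (𝓡∂ (d + 1)) M).coordChange_comp ⟨e, he⟩ ⟨e', he'⟩ ⟨e'', he''⟩ x
    ⟨⟨hx, hx'⟩, hx''⟩ v

theorem jacobian_isUnit [IsManifold (𝓡∂ (d + 1)) 1 M]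
    (he : e ∈ atlas (EuclideanHalfSpace (d + 1)) M) (he' : e' ∈ atlas (EuclideanHalfSpace (d + 1)) M)
    (hx : x ∈ e.source) (hx' : x ∈ e'.source) :
    IsUnit (jacobian e e' (e.extend (𝓡∂ (d + 1)) x)) := by
  refine ⟨⟨jacobian e e' (e.extend (𝓡∂ (d + 1)) x), jacobian e' e (e'.extend (𝓡∂ (d + 1)) x),
    ?_, ?_⟩, rfl⟩
  · rw [ContinuousLinearMap.mul_def, jacobian_comp he' he he' hx' hx hx', jacobian_self he' hx']
    rfl
  · rw [ContinuousLinearMap.mul_def, jacobian_comp he he' he hx hx' hx, jacobian_self he hx]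
    rfl

theorem clm_det_ne_zero {A : Coord d →L[ℝ] Coord d} (hA : IsUnit A) : A.det ≠ 0 := by
  obtain ⟨B, hB⟩ := hA.exists_right_inv
  intro h
  have h1 : (A * B).det = A.det * B.det := by
    simp [ContinuousLinearMap.det, ContinuousLinearMap.mul_def]
  rw [hB, h, zero_mul] at h1
  simp [ContinuousLinearMap.det, ContinuousLinearMap.one_def] at h1

theorem logJacobian_contDiffWithinAt {m n : WithTop ℕ∞} [IsManifold (𝓡∂ (d + 1)) n M]
    [IsManifold (𝓡∂ (d + 1)) 1 M] (hmn : m + 1 ≤ n)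
    (he : e ∈ atlas (EuclideanHalfSpace (d + 1)) M) (he' : e' ∈ atlas (EuclideanHalfSpace (d + 1)) M)
    (hx : x ∈ e.source) (hx' : x ∈ e'.source) :
    ContDiffWithinAt ℝ m (logJacobian e e') (range (𝓡∂ (d + 1))) (e.extend (𝓡∂ (d + 1)) x) := by
  have h : logJacobian e e' = fun z => Real.log (jacobian e e' z).det := by
    funext z; simp [logJacobian, Real.log_abs]
  rw [h]
  exact ((contDiff_clm_det.contDiffAt).comp_contDiffWithinAt _
    (jacobian_contDiffWithinAt hmn he he' hx hx')).log (clm_det_ne_zero (jacobian_isUnit he he' hx hx'))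

theorem eventually_chart [IsManifold (𝓡∂ (d + 1)) 1 M] (s : Set M) (hs : s ∈ 𝓝 x)
    (hx : x ∈ e.source)  :
    ∀ᶠ z in 𝓝[range (𝓡∂ (d + 1))] (e.extend (𝓡∂ (d + 1)) x), ∃ y ∈ s ∩ e.source,
      z = e.extend (𝓡∂ (d + 1)) y := by
  filter_upwards [e.extend_target_mem_nhdsWithin (I := 𝓡∂ (d + 1)) hx,
    nhdsWithin_le_nhds (e.extend_preimage_mem_nhds (I := 𝓡∂ (d + 1)) hx hs)] with z hz hz'
  refine ⟨(e.extend (𝓡∂ (d + 1))).symm z, ⟨hz', ?_⟩, ((e.extend (𝓡∂ (d + 1))).right_inv hz).symm⟩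
  have := (e.extend (𝓡∂ (d + 1))).map_target hz
  rwa [e.extend_source] at this

theorem logJacobianForm_self [IsManifold (𝓡∂ (d + 1)) 1 M]
    (he : e ∈ atlas (EuclideanHalfSpace (d + 1)) M) (hx : x ∈ e.source) :
    logJacobianForm e e (e.extend (𝓡∂ (d + 1)) x) = 0 := by
  have h : logJacobian e e =ᶠ[𝓝[range (𝓡∂ (d + 1))] (e.extend (𝓡∂ (d + 1)) x)] fun _ => 0 := by
    filter_upwards [eventually_chart (d := d) univ univ_mem hx] with z ⟨y, hy, hz⟩
    rw [hz, logJacobian, jacobian_self he hy.2]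
    simp [ContinuousLinearMap.det]
  rw [logJacobianForm, h.fderivWithin_eq (h.eq_of_nhdsWithin (mem_range_self _))]
  simp

theorem logJacobianForm_comp [IsManifold (𝓡∂ (d + 1)) 2 M] [IsManifold (𝓡∂ (d + 1)) 1 M]
    (he : e ∈ atlas (EuclideanHalfSpace (d + 1)) M) (he' : e' ∈ atlas (EuclideanHalfSpace (d + 1)) M)
    (he'' : e'' ∈ atlas (EuclideanHalfSpace (d + 1)) M)
    (hx : x ∈ e.source) (hx' : x ∈ e'.source) (hx'' : x ∈ e''.source) :
    (logJacobianForm e' e'' (e'.extend (𝓡∂ (d + 1)) x)).comp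
        (jacobian e e' (e.extend (𝓡∂ (d + 1)) x)) +
      logJacobianForm e e' (e.extend (𝓡∂ (d + 1)) x) =
      logJacobianForm e e'' (e.extend (𝓡∂ (d + 1)) x) := by
  have hev : logJacobian e e'' =ᶠ[𝓝[range (𝓡∂ (d + 1))] (e.extend (𝓡∂ (d + 1)) x)]
      logJacobian e' e'' ∘ chartChange e e' + logJacobian e e' := by
    filter_upwards [eventually_chart (d := d) (e'.source ∩ e''.source)
      (inter_mem (e'.open_source.mem_nhds hx') (e''.open_source.mem_nhds hx'')) hx]
      with z ⟨y, hy, hz⟩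
    subst hz
    have hc : chartChange e e' (e.extend (𝓡∂ (d + 1)) y) = e'.extend (𝓡∂ (d + 1)) y := by
      simp only [chartChange, Function.comp_apply, e.extend_left_inv hy.2]
    simp only [Pi.add_apply, Function.comp_apply, hc, logJacobian]
    rw [← jacobian_comp he he' he'' hy.2 hy.1.1 hy.1.2]
    have h1 := clm_det_ne_zero (jacobian_isUnit he he' hy.2 hy.1.1)
    have h2 := clm_det_ne_zero (jacobian_isUnit he' he'' hy.1.1 hy.1.2)
    rw [← Real.log_mul (abs_ne_zero.2 h2) (abs_ne_zero.2 h1), ← abs_mul]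
    simp [ContinuousLinearMap.det]
  have hc : chartChange e e' (e.extend (𝓡∂ (d + 1)) x) = e'.extend (𝓡∂ (d + 1)) x := by
    simp only [chartChange, Function.comp_apply, e.extend_left_inv hx]
  have hu : UniqueDiffWithinAt ℝ (range (𝓡∂ (d + 1))) (e.extend (𝓡∂ (d + 1)) x) :=
    (𝓡∂ (d + 1)).uniqueDiffOn _ (mem_range_self _)
  have d1 : DifferentiableWithinAt ℝ (logJacobian e e') (range (𝓡∂ (d + 1)))
      (e.extend (𝓡∂ (d + 1)) x) :=
    (logJacobian_contDiffWithinAt (m := 1) (n := 2) (by norm_num) he he' hx hx').differentiableWithinAt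
      one_ne_zero
  have d2 : DifferentiableWithinAt ℝ (logJacobian e' e'') (range (𝓡∂ (d + 1)))
      (chartChange e e' (e.extend (𝓡∂ (d + 1)) x)) := by
    rw [hc]
    exact (logJacobian_contDiffWithinAt (m := 1) (n := 2) (by norm_num)
      he' he'' hx' hx'').differentiableWithinAt one_ne_zero
  have d3 : DifferentiableWithinAt ℝ (chartChange e e') (range (𝓡∂ (d + 1)))
      (e.extend (𝓡∂ (d + 1)) x) :=
    (chartChange_contDiffWithinAt (n := 1) he he' hx hx').differentiableWithinAt one_ne_zero
  have hm : MapsTo (chartChange e e') (range (𝓡∂ (d + 1))) (range (𝓡∂ (d + 1))) :=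
    fun z _ => mem_range_self _
  have key : fderivWithin ℝ (logJacobian e e'') (range (𝓡∂ (d + 1))) (e.extend (𝓡∂ (d + 1)) x) =
      (fderivWithin ℝ (logJacobian e' e'') (range (𝓡∂ (d + 1))) (e'.extend (𝓡∂ (d + 1)) x)).comp
        (jacobian e e' (e.extend (𝓡∂ (d + 1)) x)) +
      fderivWithin ℝ (logJacobian e e') (range (𝓡∂ (d + 1))) (e.extend (𝓡∂ (d + 1)) x) := by
    rw [hev.fderivWithin_eq (hev.eq_of_nhdsWithin (mem_range_self _)),
      fderivWithin_add hu (d2.comp _ d3 hm) d1, fderivWithin_comp _ d2 d3 hm hu, hc]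
    rfl
  ext v
  simp only [logJacobianForm, key]
  simp
  ring

theorem contDiff_leftTranslate {n : WithTop ℕ∞} :
    ContDiff ℝ n (fun q : ProjFiber d => leftTranslate q.1 q.2) := by
  rw [contDiff_clm_apply_iff]
  intro y
  simp only [leftTranslate_apply]
  exact (contDiff_fst.clm_comp contDiff_const).prodMk
    ((contDiff_snd.clm_comp contDiff_const).add contDiff_const)

theorem contMDiffOn_leftTranslate {m n : WithTop ℕ∞} [IsManifold (𝓡∂ (d + 1)) n M]
    [IsManifold (𝓡∂ (d + 1)) 1 M] (hmn : m + 1 + 1 ≤ n)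
    (he : e ∈ atlas (EuclideanHalfSpace (d + 1)) M)
    (he' : e' ∈ atlas (EuclideanHalfSpace (d + 1)) M) :
    ContMDiffOn (𝓡∂ (d + 1)) 𝓘(ℝ, ProjFiber d →L[ℝ] ProjFiber d) m
      (fun x => leftTranslate (jacobian e e' (e.extend (𝓡∂ (d + 1)) x))
        (logJacobianForm e e' (e.extend (𝓡∂ (d + 1)) x))) (e.source ∩ e'.source) := by
  intro x hx
  have hle : m + 1 ≤ n := le_trans le_self_add hmn
  have hle' : m ≤ n := le_trans le_self_add hle
  have h1 : ContDiffWithinAt ℝ m (jacobian e e') (range (𝓡∂ (d + 1))) (e.extend (𝓡∂ (d + 1)) x) :=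
    jacobian_contDiffWithinAt hle he he' hx.1 hx.2
  have h2 : ContDiffWithinAt ℝ m (logJacobianForm e e') (range (𝓡∂ (d + 1)))
      (e.extend (𝓡∂ (d + 1)) x) :=
    (((logJacobian_contDiffWithinAt (m := m + 1) hmn he he' hx.1 hx.2).fderivWithin_right
      (𝓡∂ (d + 1)).uniqueDiffOn le_rfl (mem_range_self _)).const_smul (1 / ((d : ℝ) + 2))).neg
  have h3 := (contDiff_leftTranslate (n := m)).contDiffAt.comp_contDiffWithinAt _ (h1.prodMk h2)
  have h4 : ContMDiffWithinAt (𝓡∂ (d + 1)) 𝓘(ℝ, Coord d) m (e.extend (𝓡∂ (d + 1)))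
      (e.source ∩ e'.source) x :=
    ((OpenPartialHomeomorph.contMDiffOn_extend (IsManifold.subset_maximalAtlas (n := n) he) x hx.1).mono
      inter_subset_left).of_le hle'
  exact h3.contMDiffWithinAt.comp x h4 fun z _ => mem_range_self _

variable (d M) in
/-- The vector bundle over `M` with fibre the pairs `(A, Υ)`, in which `(A, Υ)` in the chart `e` is
`(g A, u A + Υ)` in the chart `e'`, with `g` the derivative of the change of coordinates and
`u = - (1 / (n + 1)) d log |det g|`. -/
def projCore [IsManifold (𝓡∂ (d + 1)) ∞ M] :
    VectorBundleCore ℝ M (ProjFiber d) (atlas (EuclideanHalfSpace (d + 1)) M) where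
  baseSet i := i.1.source
  isOpen_baseSet i := i.1.open_source
  indexAt := achart (EuclideanHalfSpace (d + 1))
  mem_baseSet_at := mem_chart_source (EuclideanHalfSpace (d + 1))
  coordChange i j x := leftTranslate
    (jacobian i.1 j.1 (i.1.extend (𝓡∂ (d + 1)) x)) (logJacobianForm i.1 j.1 (i.1.extend (𝓡∂ (d + 1)) x))
  coordChange_self i x hx v := by
    rw [leftTranslate_apply, jacobian_self i.2 hx, logJacobianForm_self i.2 hx]
    ext <;> simp
  continuousOn_coordChange i j :=
    (contMDiffOn_leftTranslate (m := 0) (n := 2) (by norm_num) i.2 j.2).continuousOn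
  coordChange_comp := by
    rintro i j k x ⟨⟨hxi, hxj⟩, hxk⟩ v
    simp only [leftTranslate_apply]
    rw [← jacobian_comp i.2 j.2 k.2 hxi hxj hxk, ← logJacobianForm_comp i.2 j.2 k.2 hxi hxj hxk]
    ext w
    · simp
    · simp
      ring

instance projCore_isContMDiff [IsManifold (𝓡∂ (d + 1)) ∞ M] :
    (projCore d M).IsContMDiff (𝓡∂ (d + 1)) ∞ where
  contMDiffOn_coordChange i j :=
    contMDiffOn_leftTranslate (m := ∞) (n := ∞) (by simp) i.2 j.2



/-- The total space of the vector bundle of pairs `(A, Υ)`. -/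
abbrev ProjTotal (d : ℕ) (M : Type*) [TopologicalSpace M]
    [ChartedSpace (EuclideanHalfSpace (d + 1)) M] [IsManifold (𝓡∂ (d + 1)) ∞ M] : Type _ :=
  Bundle.TotalSpace (ProjFiber d) (projCore d M).Fiber

theorem isOpen_isUnit_frame [IsManifold (𝓡∂ (d + 1)) ∞ M] :
    IsOpen {z : ProjTotal d M | IsUnit (show ProjFiber d from z.2).1} := by
  rw [isOpen_iff_mem_nhds]
  intro z hz
  let i := achart (EuclideanHalfSpace (d + 1)) z.1
  let T := (projCore d M).localTriv i
  have key : ∀ y : ProjTotal d M, y.1 ∈ i.1.source →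
      (IsUnit (T y).2.1 ↔ IsUnit (show ProjFiber d from y.2).1) := by
    intro y hy
    have h1 : (T y).2.1 = jacobian (chartAt (EuclideanHalfSpace (d + 1)) y.1) i.1
        ((chartAt (EuclideanHalfSpace (d + 1)) y.1).extend (𝓡∂ (d + 1)) y.1) *
        (show ProjFiber d from y.2).1 := rfl
    have h2 := jacobian_isUnit (chart_mem_atlas (EuclideanHalfSpace (d + 1)) y.1) i.2
      (mem_chart_source (EuclideanHalfSpace (d + 1)) y.1) hy
    rw [h1]
    exact h2.mul_left_iff
  have hzs : z ∈ T.source := by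
    rw [T.mem_source]; exact mem_chart_source (EuclideanHalfSpace (d + 1)) z.1
  have hzu : IsUnit (T z).2.1 := (key z (mem_chart_source (EuclideanHalfSpace (d + 1)) z.1)).2 hz
  have hcont : ContinuousAt (fun y => (T y).2.1) z :=
    continuous_fst.continuousAt.comp (continuous_snd.continuousAt.comp (T.continuousAt hzs))
  filter_upwards [hcont.preimage_mem_nhds (Units.isOpen.mem_nhds hzu),
    T.open_source.mem_nhds hzs] with y hy hy'
  exact (key y ((T.mem_source).1 hy')).1 hy

variable (d M) in
/-- The principal `H`-bundle `P` of a projective structure on `M`, `H ⊆ PGL(n+1, ℝ)` being the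
isotropy group of a point: the pairs `(A, Υ)` with `A` invertible.

The reduction of the bundle of second-order frames to `H` determined by a projective structure with
Thomas symbols `Π^i_{jk}` (trace-free) consists of the frames `(u^i_j, u^i_{jk})` with
`u^i_j = A^i_j` and `u^i_{jk} = - Π^i_{lm} A^l_j A^m_k - A^i_j Υ_k - A^i_k Υ_j`
for some `(A, Υ)`, which is unique and serves as coordinate on the fibre in a given chart. A change of
chart, with derivatives `g^i_j`, `g^i_{jk}`, maps a frame to
`(g^i_l u^l_j, g^i_{lm} u^l_j u^m_k + g^i_l u^l_{jk})`; taking traces, the new coordinates are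
`(g A, u A + Υ)` with `u_k = - (1 / (n + 1)) (g⁻¹)^j_i g^i_{jk} = - (1 / (n + 1)) ∂_k log |det g|`,
which are the transition functions used here. -/
def projBundle [IsManifold (𝓡∂ (d + 1)) ∞ M] : TopologicalSpace.Opens (ProjTotal d M) :=
  ⟨{z | IsUnit (show ProjFiber d from z.2).1}, isOpen_isUnit_frame⟩

end Core

section Groups

open scoped MatrixGroups Pointwise LinearAlgebra.Projectivization

/-- Indices of the homogeneous coordinates on `ℝPⁿ`: those of `ℝⁿ` and a last one. -/
abbrev HomogIndex (d : ℕ) : Type := Fin (d + 1) ⊕ Unit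

/-- The projective linear group `PGL(n+1, ℝ)` acting on `ℝPⁿ`. -/
abbrev PGLn (d : ℕ) : Type := Matrix.ProjGenLinGroup (HomogIndex d) ℝ

/-- The point `[0 : … : 0 : 1]`. -/
def basePoint (d : ℕ) : ℙ ℝ (HomogIndex d → ℝ) :=
  Projectivization.mk ℝ (Pi.single (Sum.inr ()) 1) (by simp)

/-- The projective hyperplane `X_0 = 0`. -/
def hyperplane (d : ℕ) : Set (ℙ ℝ (HomogIndex d → ℝ)) := {p | p.rep (Sum.inl 0) = 0}

/-- The isotropy group `H` of the point `[0 : … : 0 : 1]`: the classes of the matrices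
`(A, 0; Υ, a)`. -/
def isotropyPoint (d : ℕ) : Subgroup (PGLn d) := MulAction.stabilizer (PGLn d) (basePoint d)

/-- The stabiliser `G̃` of the hyperplane `X_0 = 0` in `PGL(n+1, ℝ)`. -/
def stabHyperplane (d : ℕ) : Subgroup (PGLn d) := MulAction.stabilizer (PGLn d) (hyperplane d)

/-- The isotropy group `H̃` of the point `[0 : … : 0 : 1]` of the hyperplane, for the action of
`G̃` on the hyperplane. -/
def isotropyFlag (d : ℕ) : Subgroup (PGLn d) := stabHyperplane d ⊓ isotropyPoint d

theorem mk_mem_hyperplane {d : ℕ} {v : HomogIndex d → ℝ} (hv : v ≠ 0) :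
    Projectivization.mk ℝ v hv ∈ hyperplane d ↔ v (Sum.inl 0) = 0 := by
  obtain ⟨a, ha⟩ := Projectivization.exists_smul_eq_mk_rep ℝ v hv
  rw [hyperplane, Set.mem_ofPred_eq, ← ha]
  simp [Units.smul_def]

theorem gl_smul_single {d : ℕ} (b : GL (HomogIndex d) ℝ) (i j : HomogIndex d) :
    (b • (Pi.single j 1 : HomogIndex d → ℝ)) i = b i j := by
  simp [Units.smul_def]

theorem entries_of_mem_isotropyPoint {d : ℕ} {b : GL (HomogIndex d) ℝ}
    (hb : Matrix.ProjGenLinGroup.mk b ∈ isotropyPoint d) (i : Fin (d + 1)) :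
    b (Sum.inl i) (Sum.inr ()) = 0 := by
  rw [isotropyPoint, MulAction.mem_stabilizer_iff, basePoint, Projectivization.PGL.mk_smul_mk,
    Projectivization.mk_eq_mk_iff'] at hb
  obtain ⟨a, ha⟩ := hb
  have := congrFun ha (Sum.inl i)
  rw [gl_smul_single] at this
  simpa using this.symm

theorem entries_of_mem_stabHyperplane {d : ℕ} {b : GL (HomogIndex d) ℝ}
    (hb : Matrix.ProjGenLinGroup.mk b ∈ stabHyperplane d) {j : HomogIndex d} (hj : j ≠ Sum.inl 0) :
    b (Sum.inl 0) j = 0 := by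
  have h1 : Projectivization.mk ℝ (Pi.single j 1 : HomogIndex d → ℝ) (by simp) ∈ hyperplane d := by
    rw [mk_mem_hyperplane]; simp [hj.symm]
  have h2 := Set.smul_mem_smul_set (a := Matrix.ProjGenLinGroup.mk b) h1
  rw [MulAction.mem_stabilizer_iff.1 hb, Projectivization.PGL.mk_smul_mk, mk_mem_hyperplane,
    gl_smul_single] at h2
  exact h2

theorem isUnit_of_mem_isotropyPoint {d : ℕ} {b : GL (HomogIndex d) ℝ}
    (hb : Matrix.ProjGenLinGroup.mk b ∈ isotropyPoint d) :
    b (Sum.inr ()) (Sum.inr ()) ≠ 0 ∧ IsUnit (b : Matrix (HomogIndex d) (HomogIndex d) ℝ).toBlocks₁₁ := by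
  have h : (b : Matrix (HomogIndex d) (HomogIndex d) ℝ).det ≠ 0 :=
    ((Matrix.isUnit_iff_isUnit_det _).1 b.isUnit).ne_zero
  rw [← Matrix.fromBlocks_toBlocks (b : Matrix (HomogIndex d) (HomogIndex d) ℝ),
    show (b : Matrix (HomogIndex d) (HomogIndex d) ℝ).toBlocks₁₂ = 0 by
      ext i j; exact entries_of_mem_isotropyPoint hb i,
    Matrix.det_fromBlocks_zero₁₂] at h
  refine ⟨?_, (Matrix.isUnit_iff_isUnit_det _).2 (isUnit_iff_ne_zero.2 (left_ne_zero_of_mul h))⟩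
  have h3 := right_ne_zero_of_mul h
  rwa [Matrix.det_unique] at h3

/-- A matrix representing an element of `PGL(n+1, ℝ)`. It is only used in expressions that do not
depend on the representative. -/
def liftGL {d : ℕ} (h : PGLn d) : GL (HomogIndex d) ℝ :=
  Function.surjInv Matrix.ProjGenLinGroup.mk_surjective h

theorem mk_liftGL {d : ℕ} (h : PGLn d) : Matrix.ProjGenLinGroup.mk (liftGL h) = h :=
  Function.surjInv_eq Matrix.ProjGenLinGroup.mk_surjective h

/-- The block `A / a` of the matrix `(A, 0; Υ, a)`. -/
def linPart {d : ℕ} (b : GL (HomogIndex d) ℝ) : Coord d →L[ℝ] Coord d :=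
  Matrix.toEuclideanCLM (n := Fin (d + 1)) (𝕜 := ℝ)
    ((b (Sum.inr ()) (Sum.inr ()))⁻¹ • (b : Matrix (HomogIndex d) (HomogIndex d) ℝ).toBlocks₁₁)

/-- The block `Υ / a` of the matrix `(A, 0; Υ, a)`. -/
def covPart {d : ℕ} (b : GL (HomogIndex d) ℝ) : Coord d →L[ℝ] ℝ :=
  ∑ j, ((b (Sum.inr ()) (Sum.inr ()))⁻¹ * b (Sum.inr ()) (Sum.inl j)) •
    (EuclideanSpace.proj j : Coord d →L[ℝ] ℝ)

theorem isUnit_linPart {d : ℕ} {b : GL (HomogIndex d) ℝ}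
    (hb : Matrix.ProjGenLinGroup.mk b ∈ isotropyPoint d) : IsUnit (linPart b) := by
  obtain ⟨h1, h2⟩ := isUnit_of_mem_isotropyPoint hb
  refine IsUnit.map (Matrix.toEuclideanCLM (n := Fin (d + 1)) (𝕜 := ℝ)) ?_
  exact (isUnit_smul_iff (Units.mk0 _ (inv_ne_zero h1)) _).2 h2

variable {d : ℕ} {M : Type*} [TopologicalSpace M] [ChartedSpace (EuclideanHalfSpace (d + 1)) M]
  [IsManifold (𝓡∂ (d + 1)) ∞ M]

/-- The projection `P → M`. -/
def baseOf (p : projBundle d M) : M := p.1.1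

/-- The linear frame `A : ℝⁿ → T_x M` underlying a point of `P` (its components in the preferred
chart at `x`, with respect to which the tangent space is identified with `ℝⁿ`). -/
def frameOf (p : projBundle d M) : Coord d →L[ℝ] Coord d := (show ProjFiber d from p.1.2).1

/-- The right action of `H` on `P`: `(A, 0; Υ, 1)` is multiplied on the right by `h`. -/
def projAct (p : projBundle d M) (h : isotropyPoint d) : projBundle d M :=
  ⟨⟨p.1.1, show ProjFiber d from ((frameOf p).comp (linPart (liftGL h.1)),
      (show ProjFiber d from p.1.2).2.comp (linPart (liftGL h.1)) + covPart (liftGL h.1))⟩,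
    p.2.mul (isUnit_linPart (by rw [mk_liftGL]; exact h.2))⟩

/-- The natural reduction `Q` of the restriction of `P` to `∂M`: the points over `∂M` whose linear
frame maps the hyperplane `x⁰ = 0` of `ℝⁿ` into (hence onto) the tangent space of `∂M`. The preferred
chart at a boundary point is a boundary chart `(r, y)`, so that `T ∂M` is given by `dr = 0`. -/
def boundaryReduction (d : ℕ) (M : Type*) [TopologicalSpace M]
    [ChartedSpace (EuclideanHalfSpace (d + 1)) M] [IsManifold (𝓡∂ (d + 1)) ∞ M] : Set (projBundle d M) :=
  {p | baseOf p ∈ (𝓡∂ (d + 1)).boundary M ∧ ∀ v : Coord d, v 0 = 0 → frameOf p v 0 = 0}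

theorem projAct_mem_boundaryReduction {p : projBundle d M} (hp : p ∈ boundaryReduction d M)
    (h : isotropyPoint d) (hh : h.1 ∈ stabHyperplane d) : projAct p h ∈ boundaryReduction d M := by
  refine ⟨hp.1, fun v hv => hp.2 _ ?_⟩
  have h0 : ∀ j : Fin (d + 1), j ≠ 0 → (liftGL h.1) (Sum.inl 0) (Sum.inl j) = 0 := fun j hj =>
    entries_of_mem_stabHyperplane (by rw [mk_liftGL]; exact hh) (by simpa using hj)
  have h1 : linPart (liftGL h.1) v 0 = ∑ j, ((liftGL h.1) (Sum.inr ()) (Sum.inr ()))⁻¹ *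
      (liftGL h.1) (Sum.inl 0) (Sum.inl j) * v j := rfl
  refine h1.trans ?_
  refine Finset.sum_eq_zero fun j _ => ?_
  by_cases hj : j = 0
  · subst hj; rw [hv, mul_zero]
  · rw [h0 j hj]; ring

end Groups

end Frames

section Connections

variable {d : ℕ} {M : Type*} [TopologicalSpace M] [ChartedSpace (EuclideanHalfSpace (d + 1)) M]
  [IsManifold (𝓡∂ (d + 1)) ∞ M]

/-- Affine connections on `M` (covariant derivatives on `TM`); `∇ X x v` is `(∇_v X)(x)`. -/
abbrev AffineConnection (d : ℕ) (M : Type*) [TopologicalSpace M]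
    [ChartedSpace (EuclideanHalfSpace (d + 1)) M] [IsManifold (𝓡∂ (d + 1)) ∞ M] : Type _ :=
  CovariantDerivative (𝓡∂ (d + 1)) (Coord d) (TangentSpace (𝓡∂ (d + 1)) : M → Type _)

/-- The standard basis vector `e_i` of `ℝⁿ`; in a chart it represents `∂/∂x^i`. -/
def basisVec {d : ℕ} (i : Fin (d + 1)) : Coord d := EuclideanSpace.single i 1

/-- The vector field on the domain of the chart `e` with constant components `w`. -/
def chartField (e : atlas (EuclideanHalfSpace (d + 1)) M) (w : Coord d) (x : M) :
    TangentSpace (𝓡∂ (d + 1)) x :=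
  (tangentBundleCore (𝓡∂ (d + 1)) M).coordChange e (achart (EuclideanHalfSpace (d + 1)) x) x w

/-- The components `(dx⁰(v), …, dx^{n-1}(v))` of a tangent vector in the chart `e`. -/
def chartComponents (e : atlas (EuclideanHalfSpace (d + 1)) M) (x : M) :
    TangentSpace (𝓡∂ (d + 1)) x →L[ℝ] Coord d :=
  (tangentBundleCore (𝓡∂ (d + 1)) M).coordChange (achart (EuclideanHalfSpace (d + 1)) x) e x

/-- The local connection form of `∇` in the chart `e`: the components in the chart of `∇_v W`, where
`v` and `W` have constant components `v`, `w`. -/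
def connForm (nabla : AffineConnection d M) (e : atlas (EuclideanHalfSpace (d + 1)) M) (x : M)
    (w v : Coord d) : Coord d :=
  chartComponents e x (nabla (chartField e w) x (chartField e v x))

/-- The entry `α^i_j` of the local connection form, as a function of the components of a vector:
`∇_v ∂_j = α^i_j(v) ∂_i`. -/
def connEntry (nabla : AffineConnection d M) (e : atlas (EuclideanHalfSpace (d + 1)) M) (x : M)
    (i j : Fin (d + 1)) (v : Coord d) : ℝ :=
  connForm nabla e x (basisVec j) v i

/-- The trace `α^l_l(v)` divided by `n + 1`. -/
def connTrace (nabla : AffineConnection d M) (e : atlas (EuclideanHalfSpace (d + 1)) M) (x : M)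
    (v : Coord d) : ℝ :=
  (1 / ((d : ℝ) + 2)) * ∑ l, connEntry nabla e x l l v

/-- A torsion-free affine connection whose Christoffel symbols in charts are of class `C^k`. -/
structure IsRegularTorsionFree (k : WithTop ℕ∞) (nabla : AffineConnection d M) : Prop where
  torsion_eq_zero : nabla.torsion = 0
  contMDiffOn : ∀ (e : atlas (EuclideanHalfSpace (d + 1)) M) (w v : Coord d),
    ContMDiffOn (𝓡∂ (d + 1)) 𝓘(ℝ, Coord d) k (fun x => connForm nabla e x w v) e.1.source

/-- Projective equivalence: `∇'_v X = ∇_v X + Υ(v) X + Υ(X) v` for some `1`-form `Υ` (which is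
automatically as regular as the two connections). -/
def IsProjectivelyEquivalent (nabla nabla' : AffineConnection d M) : Prop :=
  ∃ Y : ∀ x : M, TangentSpace (𝓡∂ (d + 1)) x →ₗ[ℝ] ℝ,
    ∀ (X : ∀ x : M, TangentSpace (𝓡∂ (d + 1)) x) (x : M),
      MDifferentiableAt (𝓡∂ (d + 1)) (𝓡∂ (d + 1)).tangent
        (fun y => (⟨y, X y⟩ : TangentBundle (𝓡∂ (d + 1)) M)) x →
      ∀ v : TangentSpace (𝓡∂ (d + 1)) x, nabla' X x v = nabla X x v + Y x v • X x + Y x (X x) • v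

/-- A projective structure of class `C^k` on `M`: a full projective equivalence class of
torsion-free affine connections. -/
structure ProjectiveStructure (d : ℕ) (k : WithTop ℕ∞) (M : Type*) [TopologicalSpace M]
    [ChartedSpace (EuclideanHalfSpace (d + 1)) M] [IsManifold (𝓡∂ (d + 1)) ∞ M] where
  connections : Set (AffineConnection d M)
  nonempty : connections.Nonempty
  regular : ∀ nabla ∈ connections, IsRegularTorsionFree k nabla
  mem_iff : ∀ nabla ∈ connections, ∀ nabla', IsRegularTorsionFree k nabla' →
    (nabla' ∈ connections ↔ IsProjectivelyEquivalent nabla nabla')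

/-- The partial derivative `∂f/∂x^l` at `x` in the chart `e`. -/
def chartDeriv (e : atlas (EuclideanHalfSpace (d + 1)) M) (l : Fin (d + 1)) (f : M → ℝ) (x : M) :
    ℝ :=
  fderivWithin ℝ (f ∘ (e.1.extend (𝓡∂ (d + 1))).symm) (range (𝓡∂ (d + 1)))
    (e.1.extend (𝓡∂ (d + 1)) x) (basisVec l)

/-- The Christoffel symbol `α^i_{jk} = α^i_j(∂_k)`. -/
def christoffel (nabla : AffineConnection d M) (e : atlas (EuclideanHalfSpace (d + 1)) M)
    (i j k : Fin (d + 1)) (x : M) : ℝ :=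
  connEntry nabla e x i j (basisVec k)

/-- The Ricci tensor `R_{ab} = R_{ca}{}^c{}_b` in the chart `e`, where `R_{ab}{}^c{}_d` are the
components of the curvature form `dα^c_d + α^c_m ∧ α^m_d`. -/
def ricci (nabla : AffineConnection d M) (e : atlas (EuclideanHalfSpace (d + 1)) M)
    (a b : Fin (d + 1)) (x : M) : ℝ :=
  ∑ c, (chartDeriv e c (christoffel nabla e c b a) x - chartDeriv e a (christoffel nabla e c b c) x
    + ∑ m, (christoffel nabla e c m c x * christoffel nabla e m b a x
      - christoffel nabla e c m a x * christoffel nabla e m b c x))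

/-- The projective Schouten tensor: `(n - 1) P_{ab} = R_{ab} - (2 / (n + 1)) R_{[ab]}`. -/
def schouten (nabla : AffineConnection d M) (e : atlas (EuclideanHalfSpace (d + 1)) M)
    (a b : Fin (d + 1)) (x : M) : ℝ :=
  (1 / (d : ℝ)) * (ricci nabla e a b x
    - (1 / ((d : ℝ) + 2)) * (ricci nabla e a b x - ricci nabla e b a x))

/-- The matrix of one-forms
`(α^i_j - (1/(n+1)) α^l_l δ^i_j, dx^i; - P_{lj} dx^l, - (1/(n+1)) α^l_l)`,
evaluated on the tangent vector at `x` whose components in the chart `e` are `v`. -/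
def normalGauge (nabla : AffineConnection d M) (e : atlas (EuclideanHalfSpace (d + 1)) M) (x : M)
    (v : Coord d) : Matrix (HomogIndex d) (HomogIndex d) ℝ :=
  Matrix.fromBlocks
    (Matrix.of fun i j => connEntry nabla e x i j v - if i = j then connTrace nabla e x v else 0)
    (Matrix.of fun i _ => v i)
    (Matrix.of fun _ j => - ∑ l, schouten nabla e l j x * v l)
    (Matrix.of fun _ _ => - connTrace nabla e x v)

/-- The coordinates `(A, Υ)` of a point of `P` in the chart `e`. -/
def coordsIn (e : atlas (EuclideanHalfSpace (d + 1)) M) (p : projBundle d M) : ProjFiber d :=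
  (projCore d M).coordChange (achart (EuclideanHalfSpace (d + 1)) (baseOf p)) e (baseOf p) p.1.2

/-- The trace-free part (Thomas' projective invariant) `Π^i_{jk}` of the Christoffel symbols, as a
bilinear map; it only depends on the projective class of `∇`. -/
def thomas (nabla : AffineConnection d M) (e : atlas (EuclideanHalfSpace (d + 1)) M) (x : M)
    (w v : Coord d) : Coord d :=
  connForm nabla e x w v - connTrace nabla e x v • w - connTrace nabla e x w • v

/-- The second-order part `u^i_{jk}`, in the chart `e`, of the second-order frame
`(u^i_j, u^i_{jk})` of the projective structure `[∇]` that the point `p` of `P` stands for: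
`u^i_{jk} = - Π^i_{lm} A^l_j A^m_k - 2 A^i_{(j} Υ_{k)}`. The first-order part is `A`. -/
def secondOrderPart (nabla : AffineConnection d M) (e : atlas (EuclideanHalfSpace (d + 1)) M)
    (p : projBundle d M) (w v : Coord d) : Coord d :=
  - thomas nabla e (baseOf p) ((coordsIn e p).1 w) ((coordsIn e p).1 v)
    - (coordsIn e p).2 v • (coordsIn e p).1 w - (coordsIn e p).2 w • (coordsIn e p).1 v

/-- `σ` restricts to the canonical section of `P` over the domain of the chart `e` determined by
`∇`: its second-order frames have components `(δ^i_j, - α^i_{jk})` in the chart. -/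
def IsCanonicalSection (nabla : AffineConnection d M) (e : atlas (EuclideanHalfSpace (d + 1)) M)
    (sigma : M → projBundle d M) : Prop :=
  ∀ x ∈ e.1.source, baseOf (sigma x) = x ∧
    (coordsIn e (sigma x)).1 = ContinuousLinearMap.id ℝ (Coord d) ∧
    ∀ w v, secondOrderPart nabla e (sigma x) w v = - connForm nabla e x w v

end Connections

section Cartan

variable {ι : Type*} [Fintype ι] [DecidableEq ι]

/-- The exponential of a matrix, as an element of the general linear group. -/
def expGL (X : Matrix ι ι ℝ) : GL ι ℝ := (Matrix.isUnit_exp X).unit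

/-- The Lie algebra of a closed subgroup `G` of `PGL`, where the Lie algebra `gl / ℝ·1` of `PGL` is
identified with the Lie algebra of trace-free matrices. -/
def projLieAlgebra (G : Subgroup (Matrix.ProjGenLinGroup ι ℝ)) : Set (Matrix ι ι ℝ) :=
  {X | X.trace = 0 ∧ ∀ t : ℝ, Matrix.ProjGenLinGroup.mk (expGL (t • X)) ∈ G}

variable {EN : Type*} [NormedAddCommGroup EN] [NormedSpace ℝ EN] {HN : Type*} [TopologicalSpace HN]
  {N : Type*} [TopologicalSpace N] [ChartedSpace HN N]
  {EP : Type*} [NormedAddCommGroup EP] [NormedSpace ℝ EP] {HP : Type*} [TopologicalSpace HP]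
  {P : Type*} [TopologicalSpace P] [ChartedSpace HP P]

/-- `π : P → N`, with the right action `act` of the closed subgroup `H` of `PGL` on `P`, is a
principal `H`-bundle of class `C^k`. In `locally_trivial`, `(x, h) ↦ s(x)·h` is a `C^k`
diffeomorphism from `U × H` to `π⁻¹(U)`, both directions being expressed by matrices that represent
elements of `H`. -/
structure IsPrincipalBundle (I : ModelWithCorners ℝ EN HN) (J : ModelWithCorners ℝ EP HP)
    (k : WithTop ℕ∞) (H : Subgroup (Matrix.ProjGenLinGroup ι ℝ)) (proj : P → N)
    (act : P → H → P) : Prop where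
  contMDiff_proj : ContMDiff J I k proj
  act_one : ∀ p, act p 1 = p
  act_mul : ∀ p h h', act p (h * h') = act (act p h) h'
  proj_act : ∀ p h, proj (act p h) = proj p
  simply_transitive : ∀ p q, proj p = proj q → ∃! h, act p h = q
  locally_trivial : ∀ x₀ : N, ∃ U : Set N, IsOpen U ∧ x₀ ∈ U ∧ ∃ s : N → P,
    ContMDiffOn I J k s U ∧ (∀ x ∈ U, proj (s x) = x) ∧
    (∃ F : N × (ι → ι → ℝ) → P,
      ContMDiffOn (I.prod 𝓘(ℝ, ι → ι → ℝ)) J k F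
        {z | z.1 ∈ U ∧ ∃ b : GL ι ℝ, Matrix.ProjGenLinGroup.mk b ∈ H ∧ ∀ i j, b i j = z.2 i j} ∧
      ∀ x ∈ U, ∀ (b : GL ι ℝ) (hb : Matrix.ProjGenLinGroup.mk b ∈ H),
        F (x, fun i j => b i j) = act (s x) ⟨Matrix.ProjGenLinGroup.mk b, hb⟩) ∧
    ∀ p₀, proj p₀ ∈ U → ∃ τ : P → ι → ι → ℝ, ContMDiffAt J 𝓘(ℝ, ι → ι → ℝ) k τ p₀ ∧
      ∀ᶠ p in 𝓝 p₀, ∃ (b : GL ι ℝ) (hb : Matrix.ProjGenLinGroup.mk b ∈ H),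
        (∀ i j, b i j = τ p i j) ∧ p = act (s (proj p)) ⟨Matrix.ProjGenLinGroup.mk b, hb⟩

/-- `η` is a Cartan connection of class `C^k` for the pair `(G, H)` of subgroups of `PGL` on the
principal `H`-bundle `P`: a one-form with values in the Lie algebra of `G` such that
`R_h^* η = Ad(h⁻¹) η`, `η(X^*) = X` for the fundamental vector fields `X^*`, and each
`η_p` is a linear isomorphism from `T_p P` onto the Lie algebra of `G`. -/
structure IsCartanConnection (J : ModelWithCorners ℝ EP HP) [IsManifold J 1 P] (k : WithTop ℕ∞)
    (G H : Subgroup (Matrix.ProjGenLinGroup ι ℝ)) (act : P → H → P)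
    (eta : ∀ p : P, TangentSpace J p →ₗ[ℝ] Matrix ι ι ℝ) : Prop where
  contMDiff : ∀ i j, ContMDiff J.tangent 𝓘(ℝ, ℝ) k (fun v : TangentBundle J P => eta v.1 v.2 i j)
  equivariant : ∀ (b : GL ι ℝ) (hb : Matrix.ProjGenLinGroup.mk b ∈ H) (p : P) (v : TangentSpace J p),
    eta (act p ⟨Matrix.ProjGenLinGroup.mk b, hb⟩)
        (mfderiv J J (fun q => act q ⟨Matrix.ProjGenLinGroup.mk b, hb⟩) p v) =
      ((b⁻¹ : GL ι ℝ) : Matrix ι ι ℝ) * eta p v * (b : Matrix ι ι ℝ)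
  fundamental : ∀ (X : Matrix ι ι ℝ) (hX : X ∈ projLieAlgebra H) (p : P),
    eta (act p ⟨Matrix.ProjGenLinGroup.mk (expGL ((0 : ℝ) • X)), hX.2 0⟩)
      (mfderiv 𝓘(ℝ, ℝ) J
        (fun t : ℝ => act p ⟨Matrix.ProjGenLinGroup.mk (expGL (t • X)), hX.2 t⟩) 0 (1 : ℝ)) = X
  bijOn : ∀ p, Set.BijOn (eta p) Set.univ (projLieAlgebra G)

/-- A Cartan geometry of class `C^k` on `N` modelled on the Klein geometry `G / H`. -/
structure IsCartanGeometry (I : ModelWithCorners ℝ EN HN) (J : ModelWithCorners ℝ EP HP)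
    [IsManifold J 1 P] (k : WithTop ℕ∞) (G H : Subgroup (Matrix.ProjGenLinGroup ι ℝ))
    (proj : P → N) (act : P → H → P) (eta : ∀ p : P, TangentSpace J p →ₗ[ℝ] Matrix ι ι ℝ) :
    Prop where
  le : H ≤ G
  principal : IsPrincipalBundle I J k H proj act
  connection : IsCartanConnection J k G H act eta

/-- The Klein geometry `G / H` is effective: `G` acts faithfully on `G / H`. -/
def IsEffectiveKlein {Γ : Type*} [Group Γ] (G H : Subgroup Γ) : Prop :=
  FaithfulSMul G (G ⧸ H.subgroupOf G)

end Cartan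

section Main

variable {d : ℕ} {M : Type*} [TopologicalSpace M] [ChartedSpace (EuclideanHalfSpace (d + 1)) M]
  [IsManifold (𝓡∂ (d + 1)) ∞ M]

/-- The model with corners of the total space of `P`. -/
abbrev projModel (d : ℕ) :=
  (𝓡∂ (d + 1)).prod 𝓘(ℝ, ProjFiber d)

/-- One-forms on `P` with values in the matrices of size `n + 1`. -/
abbrev MatrixForm (d : ℕ) (M : Type*) [TopologicalSpace M]
    [ChartedSpace (EuclideanHalfSpace (d + 1)) M] [IsManifold (𝓡∂ (d + 1)) ∞ M] : Type _ :=
  ∀ p : projBundle d M,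
    TangentSpace (projModel d) p →ₗ[ℝ] Matrix (HomogIndex d) (HomogIndex d) ℝ

/-- `ω` is the normal projective Cartan connection of the projective structure: a Cartan connection
on `P` for `PGL(n+1, ℝ) / H` whose local gauges `σ^* ω` along the canonical sections are the matrices
`normalGauge`, for all charts and all connections of the projective class. -/
structure IsNormalCartanConnection {k : WithTop ℕ∞} (S : ProjectiveStructure d k M)
    (omega : MatrixForm d M) : Prop where
  connection : IsCartanConnection (projModel d) k ⊤ (isotropyPoint d) projAct omega
  gauge : ∀ nabla ∈ S.connections, ∀ (e : atlas (EuclideanHalfSpace (d + 1)) M)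
    (sigma : M → projBundle d M), IsCanonicalSection nabla e sigma →
    ∀ x ∈ e.1.source, ∀ v : TangentSpace (𝓡∂ (d + 1)) x,
      omega (sigma x) (mfderiv (𝓡∂ (d + 1)) (projModel d) sigma x v) =
        normalGauge nabla e x (chartComponents e x v)

/-- The one-form `α^0_μ` at `x` lies in the span of `dr`, for every `1 ≤ μ ≤ n - 1`, where `α` is
the connection form of `∇` in the boundary chart `e = (r, y)`. -/
def SpanCondition (nabla : AffineConnection d M) (e : atlas (EuclideanHalfSpace (d + 1)) M)
    (x : M) : Prop :=
  ∀ mu : Fin d, connEntry nabla e x 0 mu.succ ∈ Submodule.span ℝ {fun v : Coord d => v 0}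

/-- The projection of the reduction `Q` to `∂M`. -/
def boundaryProj (q : boundaryReduction d M) : (𝓡∂ (d + 1)).boundary M :=
  ⟨baseOf q.1, q.2.1⟩

/-- The right action of the group `H̃` on `Q`: the restriction of the action of `H` on `P`. -/
def boundaryAct (q : boundaryReduction d M) (h : isotropyFlag d) : boundaryReduction d M :=
  ⟨projAct q.1 ⟨h.1, h.2.2⟩, projAct_mem_boundaryReduction q.2 _ h.2.1⟩

end Main

end ProjBoundary

end

open ProjBoundary

/-! In a boundary chart `(r, y)` the bundle `P` has coordinates `(x, A, Υ)`, where `(A, Υ)` stands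
for the element `(A, 0; Υ, 1)` of `H`. Changes of chart multiply it on the left, and `H` acts by
multiplication on the right. In these coordinates `Q` is cut out by the linear equations `x⁰ = 0`,
`A⁰_μ = 0`. They do not depend on the chart, because at boundary points the derivative of a change
of boundary charts preserves `{v⁰ = 0}` (`jacobian_preserves`, `mem_boundaryReduction_iff`). Hence
`Q` is an embedded submanifold of dimension `n(n+1)`. The pairs with `A` preserving `{v⁰ = 0}` are
exactly those of `H̃`, so `Q` is a principal `H̃`-bundle. Canonical sections have `A = 1` and so lie
in `Q` over the boundary.

The essential point is that `ω` restricted to `Q` takes values in `g̃`, the trace-free matrices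
whose row `0` vanishes off the diagonal. At `q ∈ Q` over `x`, take the connection and chart supplied
by the hypothesis at `x`, and translate the canonical section `σ` by the constant `b ∈ H̃` with
`σ(x)·b = q`. A vector tangent to `Q` at `q` is the derivative of `σ·b` along some `v` with `v⁰ =
0`, plus a vertical vector generated by the Lie algebra of `H̃`. On the first summand `ω` is
`Ad(b⁻¹)` of the normal gauge at `v`. Off the diagonal, row `0` of that gauge consists of `α⁰_μ(v)`
and `dx⁰(v)`, all zero by the span condition, and `Ad(b⁻¹)` preserves `g̃`. On the second summand
`ω` returns the generator. This is done in `isFlagRow_normalGauge`, `exists_isFlagRow_horizontal`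
and `isFlagRow_pointDeriv`. The argument is pointwise in `x`, so the connection and the chart may
change with `x`.

Equivariance and the reproduction of generators are inherited through the inclusion of `Q`. Since
`ω` is injective on each `T_pP` and `Q` is immersed, `ω` is injective on `T_qQ`; as `dim g̃ = (n+1)²
- 1 - n = n(n+1) = dim Q`, it is an isomorphism (`restrictForm_bijOn`). Finally `diag(2, 1, …, 1)`
fixes every point of the hyperplane, so the Klein geometry is not effective. -/

noncomputable section

namespace ProjBoundary

open Set Filter Topology

/-! ### Coordinates `(A, Υ)` on `P` in an arbitrary chart, and smoothness tested in them -/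

section Coordinates

variable {d : ℕ} {M : Type*} [TopologicalSpace M] [ChartedSpace (EuclideanHalfSpace (d + 1)) M]
  [IsManifold (𝓡∂ (d + 1)) ∞ M]

/-- The transition functions contain `d log |det g|`, with `g` itself a first derivative, so two
orders of differentiability are lost. The hypothesis `k + 1 + 1 ≤ k` says that `k` absorbs this
loss, as `∞` and `ω` do. -/
theorem projCore_isContMDiff_of_le {k : WithTop ℕ∞} [IsManifold (𝓡∂ (d + 1)) k M]
    (hk : k + 1 + 1 ≤ k) : (projCore d M).IsContMDiff (𝓡∂ (d + 1)) k where
  contMDiffOn_coordChange i j := contMDiffOn_leftTranslate (m := k) (n := k) hk i.2 j.2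

theorem baseOf_continuous : Continuous (baseOf : projBundle d M → M) :=
  (FiberBundle.continuous_proj (ProjFiber d) (projCore d M).Fiber).comp continuous_subtype_val

theorem coordsIn_ext {e : atlas (EuclideanHalfSpace (d + 1)) M} {p q : projBundle d M}
    (hp : baseOf p ∈ e.1.source) (hb : baseOf p = baseOf q) (hc : coordsIn e p = coordsIn e q) :
    p = q := by
  have hp' : p.1 ∈ ((projCore d M).localTriv e).source :=
    ((projCore d M).localTriv e).mem_source.2 hp
  have hq' : q.1 ∈ ((projCore d M).localTriv e).source :=
    ((projCore d M).localTriv e).mem_source.2 (by rw [hb] at hp; exact hp)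
  apply Subtype.ext
  refine ((projCore d M).localTriv e).injOn hp' hq' (Prod.ext ?_ hc)
  exact hb

theorem isUnit_coordsIn {e : atlas (EuclideanHalfSpace (d + 1)) M} {p : projBundle d M}
    (hp : baseOf p ∈ e.1.source) : IsUnit (coordsIn e p).1 := by
  have h2 := jacobian_isUnit (chart_mem_atlas (EuclideanHalfSpace (d + 1)) (baseOf p)) e.2
    (mem_chart_source (EuclideanHalfSpace (d + 1)) (baseOf p)) hp
  exact h2.mul p.2

/-- The point of the total space over `x` with coordinates `a` in the chart `e`. -/
def totalPoint (e : atlas (EuclideanHalfSpace (d + 1)) M) (x : M) (a : ProjFiber d) :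
    ProjTotal d M :=
  ⟨x, (projCore d M).coordChange e (achart (EuclideanHalfSpace (d + 1)) x) x a⟩

theorem totalPoint_mem {e : atlas (EuclideanHalfSpace (d + 1)) M} {x : M} {a : ProjFiber d}
    (hx : x ∈ e.1.source) (ha : IsUnit a.1) : totalPoint e x a ∈ projBundle d M := by
  have h2 := jacobian_isUnit e.2 (chart_mem_atlas (EuclideanHalfSpace (d + 1)) x) hx
    (mem_chart_source (EuclideanHalfSpace (d + 1)) x)
  exact h2.mul ha

open Classical in
/-- The point of `P` over `x` with coordinates `a` in the chart `e`; the value `p₀` is taken when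
there is no such point. -/
def pointOf (e : atlas (EuclideanHalfSpace (d + 1)) M) (p₀ : projBundle d M) (x : M)
    (a : ProjFiber d) : projBundle d M :=
  if h : x ∈ e.1.source ∧ IsUnit a.1 then ⟨totalPoint e x a, totalPoint_mem h.1 h.2⟩ else p₀

variable {e : atlas (EuclideanHalfSpace (d + 1)) M} {p₀ : projBundle d M} {x : M} {a : ProjFiber d}

theorem baseOf_pointOf (hx : x ∈ e.1.source) (ha : IsUnit a.1) : baseOf (pointOf e p₀ x a) = x := by
  rw [pointOf, dif_pos ⟨hx, ha⟩]; rfl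

theorem coordsIn_pointOf (hx : x ∈ e.1.source) (ha : IsUnit a.1) :
    coordsIn e (pointOf e p₀ x a) = a := by
  rw [pointOf, dif_pos ⟨hx, ha⟩]
  have hx' := mem_chart_source (EuclideanHalfSpace (d + 1)) x
  exact ((projCore d M).coordChange_comp e (achart (EuclideanHalfSpace (d + 1)) x) e x
    ⟨⟨hx, hx'⟩, hx⟩ a).trans ((projCore d M).coordChange_self e x hx a)

theorem pointOf_coordsIn {p : projBundle d M} (hp : baseOf p ∈ e.1.source) :
    pointOf e p₀ (baseOf p) (coordsIn e p) = p := by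
  have hu := isUnit_coordsIn hp
  refine coordsIn_ext (e := e) ?_ (baseOf_pointOf hp hu) (coordsIn_pointOf hp hu)
  rwa [baseOf_pointOf hp hu]

variable {k : WithTop ℕ∞} [(projCore d M).IsContMDiff (𝓡∂ (d + 1)) k]
  {EN : Type*} [NormedAddCommGroup EN] [NormedSpace ℝ EN] {HN : Type*} [TopologicalSpace HN]
  {I : ModelWithCorners ℝ EN HN} {N : Type*} [TopologicalSpace N] [ChartedSpace HN N]

/-- `P` is open in the total space of a vector bundle, so this is the smoothness criterion of the
local trivialization over `e`. Any chart around the base point serves, not only the preferred one.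
-/
theorem contMDiffWithinAt_projBundle_iff {f : N → projBundle d M} {s : Set N} {y : N}
    (hy : baseOf (f y) ∈ e.1.source) :
    ContMDiffWithinAt I ((𝓡∂ (d + 1)).prod 𝓘(ℝ, ProjFiber d)) k f s y ↔
      ContMDiffWithinAt I (𝓡∂ (d + 1)) k (fun z => baseOf (f z)) s y ∧
        ContMDiffWithinAt I 𝓘(ℝ, ProjFiber d) k (fun z => coordsIn e (f z)) s y := by
  have : MemTrivializationAtlas ((projCore d M).localTriv e) := ⟨⟨e, rfl⟩⟩
  refine Iff.trans (ChartedSpace.liftPropWithinAt_subtypeVal_comp_iff f s y).symm ?_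
  exact ((projCore d M).localTriv e).contMDiffWithinAt_iff
    (((projCore d M).localTriv e).mem_source.2 hy)

theorem contMDiffAt_projBundle_iff {f : N → projBundle d M} {y : N}
    (hy : baseOf (f y) ∈ e.1.source) :
    ContMDiffAt I ((𝓡∂ (d + 1)).prod 𝓘(ℝ, ProjFiber d)) k f y ↔
      ContMDiffAt I (𝓡∂ (d + 1)) k (fun z => baseOf (f z)) y ∧
        ContMDiffAt I 𝓘(ℝ, ProjFiber d) k (fun z => coordsIn e (f z)) y :=
  contMDiffWithinAt_projBundle_iff hy

theorem contMDiff_baseOf :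
    ContMDiff ((𝓡∂ (d + 1)).prod 𝓘(ℝ, ProjFiber d)) (𝓡∂ (d + 1)) k (baseOf : projBundle d M → M) :=
  fun p => ((contMDiffAt_projBundle_iff (e := achart (EuclideanHalfSpace (d + 1)) (baseOf p))
    (mem_chart_source _ _)).1 contMDiffAt_id).1

theorem contMDiffAt_coordsIn {p : projBundle d M} (hp : baseOf p ∈ e.1.source) :
    ContMDiffAt ((𝓡∂ (d + 1)).prod 𝓘(ℝ, ProjFiber d)) 𝓘(ℝ, ProjFiber d) k (coordsIn e) p :=
  ((contMDiffAt_projBundle_iff (e := e) hp).1 contMDiffAt_id).2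

theorem contMDiffWithinAt_pointOf {f : N → M} {a : N → ProjFiber d} {s : Set N} {y : N}
    (hf : ContMDiffWithinAt I (𝓡∂ (d + 1)) k f s y)
    (ha : ContMDiffWithinAt I 𝓘(ℝ, ProjFiber d) k a s y)
    (hy : f y ∈ e.1.source) (hu : IsUnit (a y).1) :
    ContMDiffWithinAt I ((𝓡∂ (d + 1)).prod 𝓘(ℝ, ProjFiber d)) k
      (fun z => pointOf e p₀ (f z) (a z)) s y := by
  rw [contMDiffWithinAt_projBundle_iff (e := e) (by rwa [baseOf_pointOf hy hu])]
  have h1 : ∀ᶠ z in 𝓝[s] y, f z ∈ e.1.source :=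
    hf.continuousWithinAt.eventually (e.1.open_source.mem_nhds hy)
  have h2 : ∀ᶠ z in 𝓝[s] y, IsUnit (a z).1 :=
    (continuous_fst.continuousAt.comp_continuousWithinAt ha.continuousWithinAt).eventually
      (Units.isOpen.mem_nhds hu)
  constructor
  · refine hf.congr_of_eventuallyEq ?_ (baseOf_pointOf hy hu)
    filter_upwards [h1, h2] with z h h' using baseOf_pointOf h h'
  · refine ha.congr_of_eventuallyEq ?_ (coordsIn_pointOf hy hu)
    filter_upwards [h1, h2] with z h h' using coordsIn_pointOf h h'

/-- The change of coordinates of `P` from `e` to `e'`. -/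
theorem coordsIn_change {e e' : atlas (EuclideanHalfSpace (d + 1)) M} {p : projBundle d M}
    (hp : baseOf p ∈ e.1.source) (hp' : baseOf p ∈ e'.1.source) :
    coordsIn e' p = leftTranslate (jacobian e.1 e'.1 (e.1.extend (𝓡∂ (d + 1)) (baseOf p)))
      (logJacobianForm e.1 e'.1 (e.1.extend (𝓡∂ (d + 1)) (baseOf p))) (coordsIn e p) :=
  ((projCore d M).coordChange_comp (achart (EuclideanHalfSpace (d + 1)) (baseOf p)) e e' (baseOf p)
    ⟨⟨mem_chart_source _ _, hp⟩, hp'⟩ p.1.2).symm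

end Coordinates

/-! ### The groups `H`, `G̃`, `H̃` by matrix entries, and non-effectiveness -/

section MatrixGroups

open scoped Pointwise

variable {d : ℕ}

theorem mem_isotropyPoint_iff {b : GL (HomogIndex d) ℝ} :
    Matrix.ProjGenLinGroup.mk b ∈ isotropyPoint d ↔ ∀ i, b (Sum.inl i) (Sum.inr ()) = 0 := by
  refine ⟨fun h i => entries_of_mem_isotropyPoint h i, fun h => ?_⟩
  rw [isotropyPoint, MulAction.mem_stabilizer_iff, basePoint, Projectivization.PGL.mk_smul_mk,
    Projectivization.mk_eq_mk_iff']
  refine ⟨b (Sum.inr ()) (Sum.inr ()), ?_⟩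
  ext i
  rw [gl_smul_single]
  rcases i with i | i
  · simp [h i]
  · simp

theorem gl_smul_apply (b : GL (HomogIndex d) ℝ) (v : HomogIndex d → ℝ) (i : HomogIndex d) :
    (b • v) i = ∑ j, b i j * v j := by
  simp [Units.smul_def, Matrix.mulVec, dotProduct]

/-- If row `0` of `b` vanishes off the diagonal, then `X_0 ∘ b = b_00 X_0`. Invertibility makes
`b_00` nonzero, so `b` preserves the hyperplane in both directions, which is needed for equality of
sets. -/
theorem mem_stabHyperplane_iff {b : GL (HomogIndex d) ℝ} :
    Matrix.ProjGenLinGroup.mk b ∈ stabHyperplane d ↔ ∀ j, j ≠ Sum.inl 0 → b (Sum.inl 0) j = 0 := by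
  refine ⟨fun h j hj => entries_of_mem_stabHyperplane h hj, fun h => ?_⟩
  have h0 : b (Sum.inl 0) (Sum.inl 0) ≠ 0 := by
    intro h0
    have hdet : (b : Matrix (HomogIndex d) (HomogIndex d) ℝ).det ≠ 0 :=
      ((Matrix.isUnit_iff_isUnit_det _).1 b.isUnit).ne_zero
    refine hdet (Matrix.det_eq_zero_of_row_eq_zero (Sum.inl 0) fun j => ?_)
    by_cases hj : j = Sum.inl 0
    · rw [hj]; exact h0
    · exact h j hj
  have key : ∀ p, Matrix.ProjGenLinGroup.mk b • p ∈ hyperplane d ↔ p ∈ hyperplane d := by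
    intro p
    induction p using Projectivization.ind with
    | h v hv =>
      rw [Projectivization.PGL.mk_smul_mk, mk_mem_hyperplane, mk_mem_hyperplane, gl_smul_apply,
        Finset.sum_eq_single (Sum.inl 0) (fun j _ hj => by rw [h j hj, zero_mul]) (by simp)]
      simp [h0]
  rw [stabHyperplane, MulAction.mem_stabilizer_iff]
  ext p
  rw [Set.mem_smul_set_iff_inv_smul_mem, ← key, smul_inv_smul]

theorem mem_isotropyFlag_iff {b : GL (HomogIndex d) ℝ} :
    Matrix.ProjGenLinGroup.mk b ∈ isotropyFlag d ↔
      (∀ j, j ≠ Sum.inl 0 → b (Sum.inl 0) j = 0) ∧ ∀ i, b (Sum.inl i) (Sum.inr ()) = 0 := by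
  rw [isotropyFlag, Subgroup.mem_inf, mem_stabHyperplane_iff, mem_isotropyPoint_iff]

/-- The block of linear maps of a matrix, as a linear map. -/
def linBlock (d : ℕ) :
    (HomogIndex d → HomogIndex d → ℝ) →L[ℝ] (Coord d →L[ℝ] Coord d) :=
  LinearMap.toContinuousLinearMap
    { toFun := fun m => Matrix.toEuclideanCLM (n := Fin (d + 1)) (𝕜 := ℝ) (Matrix.of m).toBlocks₁₁
      map_add' := fun m m' => by
        rw [← map_add]; rfl
      map_smul' := fun c m => by
        rw [RingHom.id_apply, ← map_smul]; rfl }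

/-- The block of covectors of a matrix, as a linear map. -/
def covBlock (d : ℕ) : (HomogIndex d → HomogIndex d → ℝ) →L[ℝ] (Coord d →L[ℝ] ℝ) :=
  LinearMap.toContinuousLinearMap
    { toFun := fun m => ∑ j, m (Sum.inr ()) (Sum.inl j) • (EuclideanSpace.proj j : Coord d →L[ℝ] ℝ)
      map_add' := fun m m' => by
        rw [← Finset.sum_add_distrib]
        exact Finset.sum_congr rfl fun j _ => add_smul _ _ _
      map_smul' := fun c m => by
        rw [RingHom.id_apply, Finset.smul_sum]
        exact Finset.sum_congr rfl fun j _ => mul_smul _ _ _ }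

theorem linBlock_apply (m : HomogIndex d → HomogIndex d → ℝ) (v : Coord d) (i : Fin (d + 1)) :
    linBlock d m v i = ∑ j, m (Sum.inl i) (Sum.inl j) * v j := rfl

theorem covBlock_apply (m : HomogIndex d → HomogIndex d → ℝ) (v : Coord d) :
    covBlock d m v = ∑ j, m (Sum.inr ()) (Sum.inl j) * v j := by
  simp [covBlock]

/-- The pair `(A / a, Υ / a)` of a matrix `(A, *; Υ, a)`. -/
def normalizedBlocks (m : HomogIndex d → HomogIndex d → ℝ) : ProjFiber d :=
  (m (Sum.inr ()) (Sum.inr ()))⁻¹ • (linBlock d m, covBlock d m)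

theorem normalizedBlocks_fst (b : GL (HomogIndex d) ℝ) :
    (normalizedBlocks fun i j => b i j).1 = linPart b := by
  ext v i
  change (b (Sum.inr ()) (Sum.inr ()))⁻¹ * ∑ j, b (Sum.inl i) (Sum.inl j) * v j =
    ∑ j, ((b (Sum.inr ()) (Sum.inr ()))⁻¹ * b (Sum.inl i) (Sum.inl j)) * v j
  rw [Finset.mul_sum]
  exact Finset.sum_congr rfl fun j _ => (mul_assoc _ _ _).symm

theorem normalizedBlocks_snd (b : GL (HomogIndex d) ℝ) :
    (normalizedBlocks fun i j => b i j).2 = covPart b := by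
  ext v
  change (b (Sum.inr ()) (Sum.inr ()))⁻¹ * covBlock d _ v = _
  simp [covPart, covBlock_apply, Finset.mul_sum, mul_assoc]

theorem normalizedBlocks_eq (b : GL (HomogIndex d) ℝ) :
    (normalizedBlocks fun i j => b i j) = (linPart b, covPart b) :=
  Prod.ext (normalizedBlocks_fst b) (normalizedBlocks_snd b)

/-- `normalizedBlocks` extends `linPart` and `covPart` from the group to all arrays of entries, so
that differentiability in the matrix makes sense. -/
theorem contDiffAt_normalizedBlocks {k : WithTop ℕ∞} {m : HomogIndex d → HomogIndex d → ℝ}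
    (hm : m (Sum.inr ()) (Sum.inr ()) ≠ 0) :
    ContDiffAt ℝ k (normalizedBlocks : _ → ProjFiber d) m := by
  have h1 : ContDiff ℝ k fun m : HomogIndex d → HomogIndex d → ℝ =>
      m (Sum.inr ()) (Sum.inr ()) :=
    (contDiff_apply ℝ ℝ (Sum.inr ())).comp (contDiff_apply ℝ (HomogIndex d → ℝ) (Sum.inr ()))
  exact (h1.contDiffAt.inv hm).smul
    ((linBlock d).contDiff.prodMk (covBlock d).contDiff).contDiffAt

/-- The product of pairs `(A, Υ)`, as elements of the group `H`. -/
def fiberMul (a a' : ProjFiber d) : ProjFiber d := leftTranslate a.1 a.2 a'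

theorem fiberMul_eq (a a' : ProjFiber d) :
    fiberMul a a' = (a.1.comp a'.1, a.2.comp a'.1 + a'.2) := rfl

/-- The last column of an element of `H` is zero except for its last entry. So the last diagonal
entry is multiplicative, and dividing by it is compatible with block multiplication. -/
theorem normalizedBlocks_mul {b b' : GL (HomogIndex d) ℝ}
    (hb : Matrix.ProjGenLinGroup.mk b ∈ isotropyPoint d)
    (hb' : Matrix.ProjGenLinGroup.mk b' ∈ isotropyPoint d) :
    (linPart (b * b'), covPart (b * b')) =
      fiberMul (linPart b, covPart b) (linPart b', covPart b') := by
  have h1 := mem_isotropyPoint_iff.1 hb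
  have h2 := mem_isotropyPoint_iff.1 hb'
  have e1 : ∀ i j, (b * b') i j = ∑ l, b i (Sum.inl l) * b' (Sum.inl l) j +
      b i (Sum.inr ()) * b' (Sum.inr ()) j := by
    intro i j
    change (b.1 * b'.1) i j = _
    rw [Matrix.mul_apply, Fintype.sum_sum_type]
    simp
  have e2 : (b * b') (Sum.inr ()) (Sum.inr ()) = b (Sum.inr ()) (Sum.inr ()) *
      b' (Sum.inr ()) (Sum.inr ()) := by
    rw [e1]; simp [h2]
  have hl : ∀ (c : GL (HomogIndex d) ℝ) (v : Coord d) i, linPart c v i =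
      ∑ j, (c (Sum.inr ()) (Sum.inr ()))⁻¹ * c (Sum.inl i) (Sum.inl j) * v j := fun _ _ _ => rfl
  have hc : ∀ (c : GL (HomogIndex d) ℝ) (v : Coord d), covPart c v =
      ∑ j, (c (Sum.inr ()) (Sum.inr ()))⁻¹ * c (Sum.inr ()) (Sum.inl j) * v j := by
    intro c v; simp [covPart]
  refine Prod.ext ?_ ?_
  · ext v i
    change linPart (b * b') v i = linPart b (linPart b' v) i
    simp only [hl, e2]
    simp only [e1, h1, Finset.mul_sum, Finset.sum_mul, zero_mul, add_zero, mul_inv]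
    rw [Finset.sum_comm]
    exact Finset.sum_congr rfl fun l _ => Finset.sum_congr rfl fun j _ => by ring
  · ext v
    change covPart (b * b') v = covPart b (linPart b' v) + covPart b' v
    simp only [hc, hl, e2]
    simp only [e1, Finset.mul_sum, Finset.sum_mul, mul_inv, add_mul, mul_add,
      Finset.sum_add_distrib]
    congr 1
    · rw [Finset.sum_comm]
      exact Finset.sum_congr rfl fun l _ => Finset.sum_congr rfl fun j _ => by ring
    -- These terms carry the product of the last diagonal entry of `b` with its inverse.
    · refine Finset.sum_congr rfl fun j _ => ?_
      have := (isUnit_of_mem_isotropyPoint hb).1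
      field_simp

/-- Division by the last diagonal entry removes the scalar ambiguity. Hence `projAct`, defined by an
arbitrary lift `liftGL`, can be computed with any representative. -/
theorem blocks_congr {b b' : GL (HomogIndex d) ℝ}
    (h : Matrix.ProjGenLinGroup.mk b = Matrix.ProjGenLinGroup.mk b') :
    linPart b = linPart b' ∧ covPart b = covPart b' := by
  obtain ⟨u, rfl⟩ := Matrix.ProjGenLinGroup.mk_eq_mk_iff.1 h
  have hu : (u : ℝ) ≠ 0 := u.ne_zero
  have e1 : ∀ i j, (b * Matrix.GeneralLinearGroup.scalar (HomogIndex d) u) i j = b i j * u := by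
    intro i j
    change (b.1 * Matrix.scalar (HomogIndex d) (u : ℝ)) i j = _
    simp
  rw [← normalizedBlocks_fst, ← normalizedBlocks_fst, ← normalizedBlocks_snd,
    ← normalizedBlocks_snd]
  have : (normalizedBlocks fun i j => (b * Matrix.GeneralLinearGroup.scalar (HomogIndex d) u) i j) =
      normalizedBlocks fun i j => b i j := by
    have e2 : (fun i j => (b * Matrix.GeneralLinearGroup.scalar (HomogIndex d) u) i j) =
        (u : ℝ) • fun i j => b i j := by
      funext i j; rw [e1, mul_comm]; rfl
    rw [e2, normalizedBlocks, normalizedBlocks, map_smul, map_smul, ← Prod.smul_mk, smul_smul]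
    congr 1
    change ((u : ℝ) * _)⁻¹ * _ = _
    rw [mul_inv, mul_comm, mul_inv_cancel_left₀ hu]
  rw [this]
  exact ⟨rfl, rfl⟩

/-- The matrix `(A, 0; Υ, 1)` of a pair `(A, Υ)`. -/
def fiberMatrix (a : ProjFiber d) : Matrix (HomogIndex d) (HomogIndex d) ℝ :=
  Matrix.fromBlocks (Matrix.of fun i j => a.1 (basisVec j) i) 0
    (Matrix.of fun _ j => a.2 (basisVec j)) 1

theorem of_basisVec (A : Coord d →L[ℝ] Coord d) :
    (Matrix.of fun i j => A (basisVec j) i) =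
      (Matrix.toEuclideanCLM (n := Fin (d + 1)) (𝕜 := ℝ)).symm A := by
  obtain ⟨m, rfl⟩ : ∃ m, Matrix.toEuclideanCLM (n := Fin (d + 1)) (𝕜 := ℝ) m = A :=
    ⟨_, StarAlgEquiv.apply_symm_apply _ A⟩
  rw [StarAlgEquiv.symm_apply_apply]
  ext i j
  simp [basisVec, EuclideanSpace.single]

theorem isUnit_fiberMatrix {a : ProjFiber d} (ha : IsUnit a.1) : IsUnit (fiberMatrix a) := by
  rw [Matrix.isUnit_iff_isUnit_det, fiberMatrix, Matrix.det_fromBlocks_zero₁₂, Matrix.det_one,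
    mul_one, ← Matrix.isUnit_iff_isUnit_det, of_basisVec]
  exact ha.map (Matrix.toEuclideanCLM (n := Fin (d + 1)) (𝕜 := ℝ)).symm

/-- The matrix `(A, 0; Υ, 1)`, as an element of the general linear group. -/
def fiberGL (a : ProjFiber d) (ha : IsUnit a.1) : GL (HomogIndex d) ℝ := (isUnit_fiberMatrix ha).unit

theorem clm_apply_eq_sum {F : Type*} [AddCommMonoid F] [Module ℝ F] [TopologicalSpace F]
    (A : Coord d →L[ℝ] F) (v : Coord d) : A v = ∑ j, v j • A (basisVec j) := by
  conv_lhs => rw [← (EuclideanSpace.basisFun (Fin (d + 1)) ℝ).sum_repr v, map_sum]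
  exact Finset.sum_congr rfl fun j _ => by rw [map_smul]; simp [basisVec]

theorem normalizedBlocks_fiberMatrix (a : ProjFiber d) :
    normalizedBlocks (fun i j => fiberMatrix a i j) = a := by
  have h1 : linBlock d (fun i j => fiberMatrix a i j) = a.1 := by
    ext v i
    rw [linBlock_apply, clm_apply_eq_sum a.1 v]
    simp [fiberMatrix, mul_comm]
  have h2 : covBlock d (fun i j => fiberMatrix a i j) = a.2 := by
    ext v
    rw [covBlock_apply, clm_apply_eq_sum a.2 v]
    simp [fiberMatrix, mul_comm]
  rw [normalizedBlocks, h1, h2]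
  simp [fiberMatrix]

theorem linPart_fiberGL (a : ProjFiber d) (ha : IsUnit a.1) : linPart (fiberGL a ha) = a.1 := by
  rw [← normalizedBlocks_fst]
  exact congrArg Prod.fst (normalizedBlocks_fiberMatrix a)

theorem covPart_fiberGL (a : ProjFiber d) (ha : IsUnit a.1) : covPart (fiberGL a ha) = a.2 := by
  rw [← normalizedBlocks_snd]
  exact congrArg Prod.snd (normalizedBlocks_fiberMatrix a)

theorem fiberGL_mem_isotropyPoint (a : ProjFiber d) (ha : IsUnit a.1) :
    Matrix.ProjGenLinGroup.mk (fiberGL a ha) ∈ isotropyPoint d := by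
  rw [mem_isotropyPoint_iff]
  intro i
  rfl

theorem fiberGL_mem_isotropyFlag (a : ProjFiber d) (ha : IsUnit a.1)
    (h : ∀ v : Coord d, v 0 = 0 → a.1 v 0 = 0) :
    Matrix.ProjGenLinGroup.mk (fiberGL a ha) ∈ isotropyFlag d := by
  rw [mem_isotropyFlag_iff]
  refine ⟨fun j hj => ?_, fun i => rfl⟩
  rcases j with j | j
  · have hj' : (0 : Fin (d + 1)) ≠ j := fun h => hj (by rw [h])
    exact h (basisVec j) (by simp [basisVec, hj'])
  · rfl

theorem linPart_preserves {b : GL (HomogIndex d) ℝ}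
    (hb : Matrix.ProjGenLinGroup.mk b ∈ stabHyperplane d) {v : Coord d} (hv : v 0 = 0) :
    linPart b v 0 = 0 := by
  have h1 : linPart b v 0 = ∑ j, (b (Sum.inr ()) (Sum.inr ()))⁻¹ * b (Sum.inl 0) (Sum.inl j) * v j :=
    rfl
  rw [h1]
  refine Finset.sum_eq_zero fun j _ => ?_
  by_cases hj : j = 0
  · rw [hj, hv, mul_zero]
  · rw [mem_stabHyperplane_iff.1 hb _ (by simpa using hj)]; ring

/-- An element of `H` is determined by its pair `(A, Υ)`. -/
theorem eq_of_blocks {b b' : GL (HomogIndex d) ℝ}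
    (hb : Matrix.ProjGenLinGroup.mk b ∈ isotropyPoint d)
    (hb' : Matrix.ProjGenLinGroup.mk b' ∈ isotropyPoint d)
    (h1 : linPart b = linPart b') (h2 : covPart b = covPart b') :
    Matrix.ProjGenLinGroup.mk b = Matrix.ProjGenLinGroup.mk b' := by
  have key : ∀ c : GL (HomogIndex d) ℝ, (hc : Matrix.ProjGenLinGroup.mk c ∈ isotropyPoint d) →
      Matrix.ProjGenLinGroup.mk c =
        Matrix.ProjGenLinGroup.mk (fiberGL (linPart c, covPart c) (isUnit_linPart hc)) := by
    intro c hc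
    have hu := (isUnit_of_mem_isotropyPoint hc).1
    rw [Matrix.ProjGenLinGroup.mk_eq_mk_iff]
    -- Scaling by the inverse of the last diagonal entry brings `c` to the normal form `(A, 0; Υ,
    -- 1)`.
    refine ⟨Units.mk0 _ (inv_ne_zero hu), ?_⟩
    apply Units.ext
    ext i j
    change (c.1 * Matrix.scalar (HomogIndex d) (c (Sum.inr ()) (Sum.inr ()))⁻¹) i j = fiberMatrix _ i j
    rcases i with i | i <;> rcases j with j | j
    · have : linPart c (basisVec j) i =
          ∑ l, (c (Sum.inr ()) (Sum.inr ()))⁻¹ * c (Sum.inl i) (Sum.inl l) * (basisVec j : Coord d) l :=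
        rfl
      have h2 : fiberMatrix (linPart c, covPart c) (Sum.inl i) (Sum.inl j) =
          linPart c (basisVec j) i := rfl
      rw [h2, this]
      simp [basisVec, mul_comm]
    · simp [fiberMatrix, mem_isotropyPoint_iff.1 hc]
    · simp [fiberMatrix, covPart, basisVec, mul_comm]
    · simp [fiberMatrix, hu]
  rw [key b hb, key b' hb']
  simp only [h1, h2]

theorem blocks_one : (linPart (1 : GL (HomogIndex d) ℝ), covPart (1 : GL (HomogIndex d) ℝ)) =
    (ContinuousLinearMap.id ℝ (Coord d), (0 : Coord d →L[ℝ] ℝ)) := by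
  rw [← normalizedBlocks_eq]
  have h : (fun i j => (1 : GL (HomogIndex d) ℝ) i j) =
      fun i j => fiberMatrix (ContinuousLinearMap.id ℝ (Coord d), (0 : Coord d →L[ℝ] ℝ)) i j := by
    funext i j
    change (1 : Matrix (HomogIndex d) (HomogIndex d) ℝ) i j = _
    rcases i with i | i <;> rcases j with j | j <;>
      simp [fiberMatrix, basisVec, Matrix.one_apply]
    
  rw [h, normalizedBlocks_fiberMatrix]

theorem isotropyFlag_le_stabHyperplane : isotropyFlag d ≤ stabHyperplane d := inf_le_left

/-- `G̃` contains homologies with axis the hyperplane, which act trivially on `G̃ / H̃`. -/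
theorem not_isEffectiveKlein (d : ℕ) :
    ¬ IsEffectiveKlein (stabHyperplane d) (isotropyFlag d) := by
  intro h
  -- `diag(2, 1, …, 1)` is the identity on vectors with `X_0 = 0` but is not scalar.
  let D : Matrix (HomogIndex d) (HomogIndex d) ℝ :=
    Matrix.diagonal fun i => if i = Sum.inl 0 then 2 else 1
  have hD : IsUnit D := by
    rw [Matrix.isUnit_iff_isUnit_det, Matrix.det_diagonal, isUnit_iff_ne_zero, Finset.prod_ne_zero_iff]
    intro i _; split_ifs <;> norm_num
  let g : GL (HomogIndex d) ℝ := hD.unit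
  have hg : ∀ i j, g i j = D i j := fun _ _ => rfl
  have hgm : Matrix.ProjGenLinGroup.mk g ∈ stabHyperplane d := by
    rw [mem_stabHyperplane_iff]
    intro j hj
    rw [hg]; exact Matrix.diagonal_apply_ne _ hj.symm
  have hfix : ∀ p ∈ hyperplane d, Matrix.ProjGenLinGroup.mk g • p = p := by
    intro p
    induction p using Projectivization.ind with
    | h v hv =>
      intro hp
      rw [mk_mem_hyperplane] at hp
      rw [Projectivization.PGL.mk_smul_mk, Projectivization.mk_eq_mk_iff']
      refine ⟨1, ?_⟩
      ext i
      have : (g • v) i = (D.mulVec v) i := by simp [Units.smul_def, g]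
      rw [this, Matrix.mulVec_diagonal, one_smul]
      split_ifs with hi
      · rw [hi, hp, mul_zero]
      · rw [one_mul]
  have hbase : basePoint d ∈ hyperplane d := by
    rw [basePoint, mk_mem_hyperplane]; simp
  have h1 : (⟨Matrix.ProjGenLinGroup.mk g, hgm⟩ : stabHyperplane d) = 1 := by
    apply h.eq_of_smul_eq_smul
    intro a
    induction a using QuotientGroup.induction_on with
    | H y =>
      -- Fixing the coset `yH̃` means that `y⁻¹g⁻¹y` fixes the base point `o`, that is, `g` fixes
      -- `y·o`. This holds because `y·o` lies in the hyperplane.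
      rw [one_smul, MulAction.Quotient.smul_mk, QuotientGroup.eq, Subgroup.mem_subgroupOf]
      rw [isotropyFlag, Subgroup.mem_inf]
      refine ⟨SetLike.coe_mem _, ?_⟩
      rw [isotropyPoint, MulAction.mem_stabilizer_iff]
      have h2 : (y : PGLn d) • basePoint d ∈ hyperplane d := by
        rw [← MulAction.mem_stabilizer_iff.1 y.2]
        exact Set.smul_mem_smul_set hbase
      have h3 : Matrix.ProjGenLinGroup.mk g • (y : PGLn d) • basePoint d =
        (y : PGLn d) • basePoint d := hfix _ h2
      simp only [smul_eq_mul, mul_inv_rev, Subgroup.coe_mul, Subgroup.coe_inv, mul_smul]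
      rw [inv_smul_eq_iff, inv_smul_eq_iff, h3]
  have h2 : Matrix.ProjGenLinGroup.mk g = Matrix.ProjGenLinGroup.mk 1 := congrArg Subtype.val h1
  obtain ⟨u, hu⟩ := Matrix.ProjGenLinGroup.mk_eq_mk_iff.1 h2.symm
  rw [one_mul] at hu
  have e1 : ∀ i, D i i = u := by
    intro i
    rw [← hg, ← hu]
    change Matrix.scalar _ (u : ℝ) i i = _
    simp
  have e2 := (e1 (Sum.inl 0)).trans (e1 (Sum.inr ())).symm
  simp [D] at e2

end MatrixGroups

/-! ### The linear model of `Q` -/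

section FlagModel

/-- The linear equations `z⁰ = 0`, `A⁰_μ = 0` on the coordinates `(z, (A, Υ))`. -/
def flagEquations (d : ℕ) : (Coord d × ProjFiber d) →ₗ[ℝ] ℝ × (Fin d → ℝ) where
  toFun z := (z.1 0, fun mu => z.2.1 (basisVec mu.succ) 0)
  map_add' _ _ := rfl
  map_smul' _ _ := rfl

variable {d : ℕ}

theorem preserves_iff {A : Coord d →L[ℝ] Coord d} :
    (∀ v : Coord d, v 0 = 0 → A v 0 = 0) ↔ ∀ mu : Fin d, A (basisVec mu.succ) 0 = 0 := by
  refine ⟨fun h mu => h _ (by simp [basisVec]), fun h v hv => ?_⟩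
  rw [clm_apply_eq_sum A v, Fin.sum_univ_succ, hv]
  simp [h]

theorem mem_ker_flagEquations {z : Coord d × ProjFiber d} :
    z ∈ (flagEquations d).ker ↔ z.1 0 = 0 ∧ ∀ v : Coord d, v 0 = 0 → z.2.1 v 0 = 0 := by
  rw [preserves_iff, LinearMap.mem_ker, Prod.ext_iff, funext_iff]
  rfl

theorem finrank_clm (F : Type*) [NormedAddCommGroup F] [NormedSpace ℝ F] [FiniteDimensional ℝ F] :
    Module.finrank ℝ (Coord d →L[ℝ] F) = (d + 1) * Module.finrank ℝ F := by
  rw [← (LinearMap.toContinuousLinearMap (𝕜 := ℝ) (E := Coord d) (F' := F)).finrank_eq,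
    Module.finrank_linearMap]
  simp

/-- Independence of the `n` equations, with `z⁰` and the row `A⁰_μ` prescribed freely; it determines
the dimension of `Q`. -/
theorem flagEquations_surjective : Function.Surjective (flagEquations d) := by
  rintro ⟨r, w⟩
  refine ⟨(r • basisVec 0, (linBlock d fun i j => Sum.elim (fun i' => if i' = 0 then
    Sum.elim (fun j' => (Fin.cons 0 w : Fin (d + 1) → ℝ) j') (fun _ => 0) j else 0) (fun _ => 0) i,
    0)), ?_⟩
  refine Prod.ext ?_ ?_
  · simp [flagEquations, basisVec]
  · funext mu
    change linBlock d _ (basisVec mu.succ) 0 = w mu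
    rw [linBlock_apply]
    simp [basisVec]

/-- With `n = d + 1`, the coordinates `(z, A, Υ)` number `n + n² + n` and the equations number `n`,
which leaves `n(n + 1)`. -/
theorem finrank_ker_flagEquations :
    Module.finrank ℝ (flagEquations d).ker = (d + 1) * (d + 2) := by
  have h := (flagEquations d).finrank_range_add_finrank_ker
  rw [LinearMap.range_eq_top.2 flagEquations_surjective, finrank_top] at h
  simp only [Module.finrank_prod, finrank_clm, Module.finrank_self, finrank_euclideanSpace,
    Fintype.card_fin, Module.finrank_fintype_fun_eq_card] at h
  linarith

/-- A linear parametrization of the space of `(z, (A, Υ))` with `z⁰ = 0`, `A⁰_μ = 0`. -/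
def flagEquiv (d : ℕ) : EuclideanSpace ℝ (Fin ((d + 1) * (d + 2))) ≃ₗ[ℝ] (flagEquations d).ker :=
  have : Module.Free ℝ (flagEquations d).ker := 
    @Module.Free.of_divisionRing ℝ (flagEquations d).ker _ (Submodule.addCommGroup _) _
  LinearEquiv.ofFinrankEq _ _ (by rw [finrank_ker_flagEquations]; simp)

/-- The inclusion of the model space of `Q` in the coordinate space of `P`. -/
def flagIncl (d : ℕ) : EuclideanSpace ℝ (Fin ((d + 1) * (d + 2))) →L[ℝ] Coord d × ProjFiber d :=
  LinearMap.toContinuousLinearMap ((flagEquations d).ker.subtype.comp (flagEquiv d).toLinearMap)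

theorem exists_flagProj (d : ℕ) : ∃ L : (Coord d × ProjFiber d) →ₗ[ℝ]
    EuclideanSpace ℝ (Fin ((d + 1) * (d + 2))), L.comp (flagIncl d).toLinearMap = LinearMap.id :=
  LinearMap.exists_leftInverse_of_injective _ (LinearMap.ker_eq_bot.2
    (Subtype.val_injective.comp (flagEquiv d).injective))

/-- A left inverse of `flagIncl`. -/
def flagProj (d : ℕ) : (Coord d × ProjFiber d) →L[ℝ] EuclideanSpace ℝ (Fin ((d + 1) * (d + 2))) :=
  LinearMap.toContinuousLinearMap (exists_flagProj d).choose

theorem flagProj_flagIncl (y : EuclideanSpace ℝ (Fin ((d + 1) * (d + 2)))) :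
    flagProj d (flagIncl d y) = y :=
  LinearMap.congr_fun (exists_flagProj d).choose_spec y

theorem flagIncl_mem (y : EuclideanSpace ℝ (Fin ((d + 1) * (d + 2)))) :
    (flagIncl d y).1 0 = 0 ∧ ∀ v : Coord d, v 0 = 0 → (flagIncl d y).2.1 v 0 = 0 :=
  mem_ker_flagEquations.1 (flagEquiv d y).2

/-- `flagProj` is an arbitrarily chosen left inverse on the whole coordinate space. It is a
two-sided inverse only on the solutions of the equations. -/
theorem flagIncl_flagProj {z : Coord d × ProjFiber d} (h0 : z.1 0 = 0)
    (h : ∀ v : Coord d, v 0 = 0 → z.2.1 v 0 = 0) : flagIncl d (flagProj d z) = z := by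
  obtain ⟨y, hy⟩ : ∃ y, flagIncl d y = z :=
    ⟨(flagEquiv d).symm ⟨z, mem_ker_flagEquations.2 ⟨h0, h⟩⟩, by
      change ((flagEquiv d ((flagEquiv d).symm _)) : Coord d × ProjFiber d) = z
      rw [LinearEquiv.apply_symm_apply]⟩
  rw [← hy, flagProj_flagIncl]

end FlagModel

/-- By the chain rule, a local differentiable left inverse makes the differential injective. It is
applied to the inclusion of `Q`. -/
theorem injective_mfderiv_of_leftInverse {E E' H H' N P : Type*} [NormedAddCommGroup E]
    [NormedSpace ℝ E] [NormedAddCommGroup E'] [NormedSpace ℝ E'] [TopologicalSpace H]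
    [TopologicalSpace H'] [TopologicalSpace N] [TopologicalSpace P] [ChartedSpace H N]
    [ChartedSpace H' P] {I : ModelWithCorners ℝ E H} {J : ModelWithCorners ℝ E' H'}
    {f : N → P} {g : P → N} {x : N} (hg : MDifferentiableAt J I g (f x))
    (hf : MDifferentiableAt I J f x) (h : g ∘ f =ᶠ[𝓝 x] id) :
    Function.Injective (mfderiv I J f x) := by
  have h5 : mfderiv I I (g ∘ f) x = (mfderiv J I g (f x)).comp (mfderiv I J f x) :=
    mfderiv_comp x hg hf
  have h6 : mfderiv I I (g ∘ f) x = mfderiv I I id x := h.mfderiv_eq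
  rw [h6, mfderiv_id] at h5
  intro v w hvw
  have hv := DFunLike.congr_fun h5 v
  have hw := DFunLike.congr_fun h5 w
  rw [ContinuousLinearMap.comp_apply] at hv hw
  rw [hvw] at hv
  exact hv.trans hw.symm

/-! ### `Q` as an embedded submanifold of `P` -/

section BoundaryReduction

variable {d : ℕ} {M : Type*} [TopologicalSpace M] [ChartedSpace (EuclideanHalfSpace (d + 1)) M]

/-- The derivative of a change of charts preserves the tangent space of the boundary. -/
theorem jacobian_preserves [IsManifold (𝓡∂ (d + 1)) 1 M]
    {e e' : OpenPartialHomeomorph M (EuclideanHalfSpace (d + 1))} {x : M}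
    (he : e ∈ atlas (EuclideanHalfSpace (d + 1)) M) (he' : e' ∈ atlas (EuclideanHalfSpace (d + 1)) M)
    (hx : x ∈ e.source) (hx' : x ∈ e'.source) (hb : x ∈ (𝓡∂ (d + 1)).boundary M)
    {v : Coord d} (hv : v 0 = 0) : jacobian e e' (e.extend (𝓡∂ (d + 1)) x) v 0 = 0 := by
  set z : Coord d := e.extend (𝓡∂ (d + 1)) x with hz
  have hz0 : z 0 = 0 := (mem_boundary_iff he hx).1 hb
  have hc0 : ∀ t : ℝ, (z + t • v) 0 = 0 := fun t => by simp [hz0, hv]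
  -- Since `v⁰ = 0`, the line `z + tv` stays in the boundary of the half-space. A change of charts
  -- maps boundary points to boundary points, so component `0` of its value is constantly zero along
  -- the line for small `t`.
  have hline : HasDerivAt (fun t : ℝ => z + t • v) v 0 := by
    simpa using ((hasDerivAt_id (0 : ℝ)).smul_const v).const_add z
  have hrange : ∀ t : ℝ, z + t • v ∈ range (𝓡∂ (d + 1)) := fun t => by
    rw [range_modelWithCornersEuclideanHalfSpace]
    exact (hc0 t).ge
  have htend : Tendsto (fun t : ℝ => z + t • v) (𝓝 0) (𝓝[range (𝓡∂ (d + 1))] z) := by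
    refine tendsto_nhdsWithin_iff.2 ⟨?_, Eventually.of_forall hrange⟩
    have := hline.continuousAt.tendsto
    simpa using this
  have hd : HasFDerivWithinAt (chartChange e e') (jacobian e e' z) (range (𝓡∂ (d + 1)))
      (z + (0 : ℝ) • v) := by
    rw [zero_smul, add_zero]
    exact ((chartChange_contDiffWithinAt (n := 1) he he' hx hx').differentiableWithinAt
      one_ne_zero).hasFDerivWithinAt
  have h1 : HasDerivAt (fun t : ℝ => chartChange e e' (z + t • v)) (jacobian e e' z v) 0 := by
    have := hd.comp_hasDerivWithinAt (s := univ) (0 : ℝ) hline.hasDerivWithinAt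
      fun t _ => hrange t
    rw [hasDerivWithinAt_univ] at this
    exact this
  have h2 : HasDerivAt (fun t : ℝ => chartChange e e' (z + t • v) 0) (jacobian e e' z v 0) 0 :=
    ((EuclideanSpace.proj 0 : Coord d →L[ℝ] ℝ).hasFDerivAt.comp_hasDerivAt (0 : ℝ) h1)
  have h3 : (fun t : ℝ => chartChange e e' (z + t • v) 0) =ᶠ[𝓝 0] fun _ => (0 : ℝ) := by
    filter_upwards [htend.eventually (eventually_chart e'.source
      (e'.open_source.mem_nhds hx') hx)] with t ⟨y, hy, hyz⟩
    have hyb : y ∈ (𝓡∂ (d + 1)).boundary M := by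
      rw [mem_boundary_iff he hy.2]
      change (e.extend (𝓡∂ (d + 1)) y) 0 = 0
      rw [← hyz]; exact hc0 t
    rw [hyz]
    simp only [chartChange, Function.comp_apply, e.extend_left_inv hy.2]
    exact (mem_boundary_iff he' hy.1).1 hyb
  exact (h2.congr_of_eventuallyEq h3.symm).unique (hasDerivAt_const 0 0)

/-- The values of the coordinates of `Q` induced by the chart `e`. -/
def flagTarget (e : atlas (EuclideanHalfSpace (d + 1)) M) :
    Set (EuclideanSpace ℝ (Fin ((d + 1) * (d + 2)))) :=
  {y | (𝓡∂ (d + 1)).symm (flagIncl d y).1 ∈ e.1.target ∧ IsUnit (flagIncl d y).2.1}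

theorem isOpen_flagTarget {e : atlas (EuclideanHalfSpace (d + 1)) M} : IsOpen (flagTarget e) := by
  refine IsOpen.inter ?_ ?_
  · exact e.1.open_target.preimage ((𝓡∂ (d + 1)).continuous_symm.comp
      (continuous_fst.comp (flagIncl d).continuous))
  · exact Units.isOpen.preimage (continuous_fst.comp (continuous_snd.comp (flagIncl d).continuous))

theorem flagIncl_mem_range (y : EuclideanSpace ℝ (Fin ((d + 1) * (d + 2)))) :
    (flagIncl d y).1 ∈ range (𝓡∂ (d + 1)) := by
  rw [range_modelWithCornersEuclideanHalfSpace]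
  exact (flagIncl_mem y).1.ge

theorem flagTarget_extend {e : atlas (EuclideanHalfSpace (d + 1)) M}
    {y : EuclideanSpace ℝ (Fin ((d + 1) * (d + 2)))} (hy : y ∈ flagTarget e) :
    (flagIncl d y).1 ∈ (e.1.extend (𝓡∂ (d + 1))).target := by
  rw [OpenPartialHomeomorph.extend_target]
  exact ⟨hy.1, flagIncl_mem_range y⟩

theorem flagTarget_source {e : atlas (EuclideanHalfSpace (d + 1)) M}
    {y : EuclideanSpace ℝ (Fin ((d + 1) * (d + 2)))} (hy : y ∈ flagTarget e) :
    (e.1.extend (𝓡∂ (d + 1))).symm (flagIncl d y).1 ∈ e.1.source :=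
  e.1.map_target hy.1

variable [IsManifold (𝓡∂ (d + 1)) ∞ M]

theorem coordsIn_achart (p : projBundle d M) :
    coordsIn (achart (EuclideanHalfSpace (d + 1)) (baseOf p)) p = p.1.2 :=
  (projCore d M).coordChange_self _ _ (mem_chart_source _ _) _

theorem preserves_coordsIn_change {e e' : atlas (EuclideanHalfSpace (d + 1)) M}
    {p : projBundle d M} (hp : baseOf p ∈ e.1.source) (hp' : baseOf p ∈ e'.1.source)
    (hb : baseOf p ∈ (𝓡∂ (d + 1)).boundary M)
    (h : ∀ v : Coord d, v 0 = 0 → (coordsIn e p).1 v 0 = 0) :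
    ∀ v : Coord d, v 0 = 0 → (coordsIn e' p).1 v 0 = 0 := by
  intro v hv
  rw [coordsIn_change hp hp', leftTranslate_apply]
  exact jacobian_preserves e.2 e'.2 hp hp' hb (h v hv)

/-- `Q` is defined through the preferred chart at each point. Since `jacobian_preserves` applies to
changes of chart in both directions, the defining condition may be read in any chart. -/
theorem mem_boundaryReduction_iff {e : atlas (EuclideanHalfSpace (d + 1)) M}
    {p : projBundle d M} (hp : baseOf p ∈ e.1.source) :
    p ∈ boundaryReduction d M ↔ baseOf p ∈ (𝓡∂ (d + 1)).boundary M ∧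
      ∀ v : Coord d, v 0 = 0 → (coordsIn e p).1 v 0 = 0 := by
  have hf : frameOf p = (coordsIn (achart (EuclideanHalfSpace (d + 1)) (baseOf p)) p).1 :=
    congrArg Prod.fst (coordsIn_achart p).symm
  have hs : baseOf p ∈ (achart (EuclideanHalfSpace (d + 1)) (baseOf p)).1.source :=
    mem_chart_source _ _
  constructor
  · rintro ⟨hb, h⟩
    exact ⟨hb, preserves_coordsIn_change hs hp hb (by rwa [← hf])⟩
  · rintro ⟨hb, h⟩
    refine ⟨hb, ?_⟩
    rw [hf]
    exact preserves_coordsIn_change hp hs hb h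

open Classical in
/-- The point of `Q` over `x` with coordinates `a` in the chart `e`; the value `q₀` is taken when
there is no such point. -/
def flagPointOf (e : atlas (EuclideanHalfSpace (d + 1)) M) (q₀ : boundaryReduction d M) (x : M)
    (a : ProjFiber d) : boundaryReduction d M :=
  if h : pointOf e q₀.1 x a ∈ boundaryReduction d M then ⟨_, h⟩ else q₀

variable {e : atlas (EuclideanHalfSpace (d + 1)) M} {q₀ : boundaryReduction d M}

theorem flagPointOf_val {x : M} {a : ProjFiber d} (hx : x ∈ e.1.source)
    (hb : x ∈ (𝓡∂ (d + 1)).boundary M) (ha : IsUnit a.1)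
    (h : ∀ v : Coord d, v 0 = 0 → a.1 v 0 = 0) :
    (flagPointOf e q₀ x a).1 = pointOf e q₀.1 x a := by
  have hm : pointOf e q₀.1 x a ∈ boundaryReduction d M := by
    rw [mem_boundaryReduction_iff (e := e) (by rwa [baseOf_pointOf hx ha]), baseOf_pointOf hx ha,
      coordsIn_pointOf hx ha]
    exact ⟨hb, h⟩
  rw [flagPointOf, dif_pos hm]

/-- The coordinates of `P` induced by the chart `e`, projected to the model space of `Q`. -/
def flagCoords (e : atlas (EuclideanHalfSpace (d + 1)) M) (p : projBundle d M) :
    EuclideanSpace ℝ (Fin ((d + 1) * (d + 2))) :=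
  flagProj d (e.1.extend (𝓡∂ (d + 1)) (baseOf p), coordsIn e p)

/-- On `Q` the coordinates satisfy the linear equations, so projecting them to the model space loses
nothing. -/
theorem flagIncl_flagCoords {q : projBundle d M} (hq : q ∈ boundaryReduction d M)
    (hs : baseOf q ∈ e.1.source) :
    flagIncl d (flagCoords e q) = (e.1.extend (𝓡∂ (d + 1)) (baseOf q), coordsIn e q) :=
  flagIncl_flagProj ((mem_boundary_iff e.2 hs).1 hq.1) ((mem_boundaryReduction_iff hs).1 hq).2

/-- The point of `P` with given coordinates in the model space of `Q`. -/
def flagPoint (e : atlas (EuclideanHalfSpace (d + 1)) M) (p₀ : projBundle d M)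
    (y : EuclideanSpace ℝ (Fin ((d + 1) * (d + 2)))) : projBundle d M :=
  pointOf e p₀ ((e.1.extend (𝓡∂ (d + 1))).symm (flagIncl d y).1) (flagIncl d y).2

theorem flagTarget_boundary {y : EuclideanSpace ℝ (Fin ((d + 1) * (d + 2)))}
    (hy : y ∈ flagTarget e) :
    (e.1.extend (𝓡∂ (d + 1))).symm (flagIncl d y).1 ∈ (𝓡∂ (d + 1)).boundary M := by
  rw [mem_boundary_iff e.2 (flagTarget_source hy)]
  have h := (e.1.extend (𝓡∂ (d + 1))).right_inv (flagTarget_extend hy)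
  change (e.1.extend (𝓡∂ (d + 1)) _) 0 = 0
  rw [h]
  exact (flagIncl_mem y).1

theorem baseOf_flagPoint {p₀ : projBundle d M} {y : EuclideanSpace ℝ (Fin ((d + 1) * (d + 2)))}
    (hy : y ∈ flagTarget e) :
    baseOf (flagPoint e p₀ y) = (e.1.extend (𝓡∂ (d + 1))).symm (flagIncl d y).1 :=
  baseOf_pointOf (flagTarget_source hy) hy.2

theorem coordsIn_flagPoint {p₀ : projBundle d M} {y : EuclideanSpace ℝ (Fin ((d + 1) * (d + 2)))}
    (hy : y ∈ flagTarget e) : coordsIn e (flagPoint e p₀ y) = (flagIncl d y).2 :=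
  coordsIn_pointOf (flagTarget_source hy) hy.2

theorem flagPoint_mem {p₀ : projBundle d M} {y : EuclideanSpace ℝ (Fin ((d + 1) * (d + 2)))}
    (hy : y ∈ flagTarget e) : flagPoint e p₀ y ∈ boundaryReduction d M := by
  rw [mem_boundaryReduction_iff (e := e) (by rw [baseOf_flagPoint hy]; exact flagTarget_source hy),
    baseOf_flagPoint hy, coordsIn_flagPoint hy]
  exact ⟨flagTarget_boundary hy, (flagIncl_mem y).2⟩

theorem flagCoords_flagPoint {p₀ : projBundle d M}
    {y : EuclideanSpace ℝ (Fin ((d + 1) * (d + 2)))} (hy : y ∈ flagTarget e) :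
    flagCoords e (flagPoint e p₀ y) = y := by
  rw [flagCoords, baseOf_flagPoint hy, coordsIn_flagPoint hy,
    (e.1.extend (𝓡∂ (d + 1))).right_inv (flagTarget_extend hy)]
  exact flagProj_flagIncl y

theorem flagCoords_mem {q : projBundle d M} (hq : q ∈ boundaryReduction d M)
    (hs : baseOf q ∈ e.1.source) : flagCoords e q ∈ flagTarget e := by
  change _ ∧ _
  rw [flagIncl_flagCoords hq hs]
  refine ⟨?_, isUnit_coordsIn hs⟩
  have : (𝓡∂ (d + 1)).symm (e.1.extend (𝓡∂ (d + 1)) (baseOf q)) = e.1 (baseOf q) :=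
    (𝓡∂ (d + 1)).left_inv _
  rw [this]
  exact e.1.map_source hs

theorem flagPoint_flagCoords {p₀ : projBundle d M} {q : projBundle d M}
    (hq : q ∈ boundaryReduction d M) (hs : baseOf q ∈ e.1.source) :
    flagPoint e p₀ (flagCoords e q) = q := by
  rw [flagPoint, flagIncl_flagCoords hq hs, e.1.extend_left_inv hs, pointOf_coordsIn hs]

section Smooth

variable {k : WithTop ℕ∞} [IsManifold (𝓡∂ (d + 1)) k M] [(projCore d M).IsContMDiff (𝓡∂ (d + 1)) k]

theorem contMDiffOn_flagPoint {p₀ : projBundle d M} :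
    ContMDiffOn (𝓡 ((d + 1) * (d + 2))) ((𝓡∂ (d + 1)).prod 𝓘(ℝ, ProjFiber d)) k
      (flagPoint e p₀) (flagTarget e) := by
  intro y hy
  refine contMDiffWithinAt_pointOf ?_ ?_ (flagTarget_source hy) hy.2
  -- The inverse of an extended chart is smooth only on the image of the chart in the closed
  -- half-space; `flagIncl` lands on its boundary.
  · refine (contMDiffOn_extend_symm (I := 𝓡∂ (d + 1)) (n := k)
      (IsManifold.subset_maximalAtlas e.2)).comp (t := (𝓡∂ (d + 1)) '' e.1.target)
      (s := flagTarget e) (f := fun y => (flagIncl d y).1)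
      (ContDiff.contMDiff (contDiff_fst.comp (flagIncl d).contDiff)).contMDiffOn ?_ y hy
    intro y hy
    exact ⟨_, hy.1, (𝓡∂ (d + 1)).right_inv (flagIncl_mem_range y)⟩
  · exact (ContDiff.contMDiff (contDiff_snd.comp (flagIncl d).contDiff)).contMDiffAt.contMDiffWithinAt

/-- Smoothness here is on an open part of `P`, not merely along `Q`. This ambient extension of the
charts of `Q` yields the smoothness of their transitions, the smoothness of maps into `Q`, and a
local retraction of `P` to `Q`. -/
theorem contMDiffAt_flagCoords {p : projBundle d M} (hp : baseOf p ∈ e.1.source) :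
    ContMDiffAt ((𝓡∂ (d + 1)).prod 𝓘(ℝ, ProjFiber d)) (𝓡 ((d + 1) * (d + 2))) k
      (flagCoords e) p := by
  have h1 : ContMDiffAt ((𝓡∂ (d + 1)).prod 𝓘(ℝ, ProjFiber d)) 𝓘(ℝ, Coord d) k
      (fun p : projBundle d M => e.1.extend (𝓡∂ (d + 1)) (baseOf p)) p :=
    (e.1.contMDiffAt_extend (IsManifold.subset_maximalAtlas e.2) hp).comp p
      contMDiff_baseOf.contMDiffAt
  have h2 := h1.prodMk_space (contMDiffAt_coordsIn (k := k) hp)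
  exact (flagProj d).contDiff.contMDiff.contMDiffAt.comp p h2

end Smooth

open Classical in
/-- The chart of `Q` induced by the chart `e` of `M` (the point `q₀` is only used outside the target
of the chart). -/
def flagChart (e : atlas (EuclideanHalfSpace (d + 1)) M) (q₀ : boundaryReduction d M) :
    OpenPartialHomeomorph (boundaryReduction d M) (EuclideanSpace ℝ (Fin ((d + 1) * (d + 2)))) where
  toFun q := flagCoords e q.1
  invFun y := if h : flagPoint e q₀.1 y ∈ boundaryReduction d M then ⟨_, h⟩ else q₀
  source := {q | baseOf q.1 ∈ e.1.source}
  target := flagTarget e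
  map_source' q hq := flagCoords_mem q.2 hq
  map_target' y hy := by
    rw [dif_pos (flagPoint_mem hy)]
    change baseOf (flagPoint e q₀.1 y) ∈ e.1.source
    rw [baseOf_flagPoint hy]
    exact flagTarget_source hy
  left_inv' q hq := by
    rw [dif_pos (flagPoint_mem (flagCoords_mem q.2 hq))]
    exact Subtype.ext (flagPoint_flagCoords q.2 hq)
  right_inv' y hy := by
    rw [dif_pos (flagPoint_mem hy)]
    exact flagCoords_flagPoint hy
  open_source := e.1.open_source.preimage (baseOf_continuous.comp continuous_subtype_val)
  open_target := isOpen_flagTarget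
  continuousOn_toFun q hq :=
    ((contMDiffAt_flagCoords (k := ∞) hq).continuousAt.comp
      continuous_subtype_val.continuousAt).continuousWithinAt
  continuousOn_invFun := by
    rw [Topology.IsInducing.subtypeVal.continuousOn_iff]
    refine (contMDiffOn_flagPoint (k := ∞) (e := e) (p₀ := q₀.1)).continuousOn.congr fun y hy => ?_
    simp only [Function.comp_apply, dif_pos (flagPoint_mem hy)]

open Classical in
theorem flagChart_symm_val {y : EuclideanSpace ℝ (Fin ((d + 1) * (d + 2)))} (hy : y ∈ flagTarget e) :
    ((flagChart e q₀).symm y).1 = flagPoint e q₀.1 y := by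
  change (dite _ _ _ : boundaryReduction d M).1 = _
  rw [dif_pos (flagPoint_mem hy)]

variable (d M) in
/-- The submanifold charts of `Q`. -/
instance flagChartedSpace :
    ChartedSpace (EuclideanSpace ℝ (Fin ((d + 1) * (d + 2)))) (boundaryReduction d M) where
  atlas := {φ | ∃ (e : atlas (EuclideanHalfSpace (d + 1)) M) (q₀ : _), φ = flagChart e q₀}
  chartAt q := flagChart (achart (EuclideanHalfSpace (d + 1)) (baseOf q.1)) q
  mem_chart_source q := mem_chart_source (EuclideanHalfSpace (d + 1)) (baseOf q.1)
  chart_mem_atlas q := ⟨_, q, rfl⟩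

/-- A transition map of `Q` is `flagCoords e' ∘ flagPoint e`: it factors through `P`, and both
factors are smooth. -/
theorem isManifold_boundaryReduction {k : WithTop ℕ∞} [IsManifold (𝓡∂ (d + 1)) k M]
    [(projCore d M).IsContMDiff (𝓡∂ (d + 1)) k] :
    IsManifold (𝓡 ((d + 1) * (d + 2))) k (boundaryReduction d M) := by
  apply isManifold_of_contDiffOn
  rintro _ _ ⟨e, q₀, rfl⟩ ⟨e', q₀', rfl⟩
  rw [← contMDiffOn_iff_contDiffOn]
  rintro y ⟨⟨hy1, hy2⟩, -⟩
  have hy1' : y ∈ flagTarget e := hy1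
  have hy2' : baseOf (flagPoint e q₀.1 y) ∈ e'.1.source := by
    rw [← flagChart_symm_val hy1']; exact hy2
  refine ((contMDiffAt_flagCoords (k := k) hy2').comp_contMDiffWithinAt (s := flagTarget e) y
    (contMDiffOn_flagPoint y hy1')).mono_of_mem_nhdsWithin
      (mem_nhdsWithin_of_mem_nhds (isOpen_flagTarget.mem_nhds hy1')) |>.congr_of_eventuallyEq ?_ ?_
  · filter_upwards [mem_nhdsWithin_of_mem_nhds (isOpen_flagTarget.mem_nhds hy1')] with z hz
    exact congrArg (flagCoords e') (flagChart_symm_val hz)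
  · exact congrArg (flagCoords e') (flagChart_symm_val hy1')

instance : IsManifold (𝓡 ((d + 1) * (d + 2))) ∞ (boundaryReduction d M) :=
  isManifold_boundaryReduction

section Maps

variable {k : WithTop ℕ∞} [IsManifold (𝓡∂ (d + 1)) k M] [(projCore d M).IsContMDiff (𝓡∂ (d + 1)) k]
  {EN : Type*} [NormedAddCommGroup EN] [NormedSpace ℝ EN] {HN : Type*} [TopologicalSpace HN]
  {I : ModelWithCorners ℝ EN HN} {N : Type*} [TopologicalSpace N] [ChartedSpace HN N]

theorem flagChart_mem_maximalAtlas (e : atlas (EuclideanHalfSpace (d + 1)) M)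
    (q₀ : boundaryReduction d M) :
    flagChart e q₀ ∈ IsManifold.maximalAtlas (𝓡 ((d + 1) * (d + 2))) k (boundaryReduction d M) :=
  have : IsManifold (𝓡 ((d + 1) * (d + 2))) k (boundaryReduction d M) :=
    isManifold_boundaryReduction
  IsManifold.subset_maximalAtlas ⟨e, q₀, rfl⟩

theorem contMDiff_boundaryReduction_val :
    ContMDiff (𝓡 ((d + 1) * (d + 2))) ((𝓡∂ (d + 1)).prod 𝓘(ℝ, ProjFiber d)) k
      (Subtype.val : boundaryReduction d M → projBundle d M) := by
  intro q
  let e := achart (EuclideanHalfSpace (d + 1)) (baseOf q.1)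
  have hq : q ∈ (flagChart e q).source := mem_chart_source (EuclideanHalfSpace (d + 1)) (baseOf q.1)
  have h1 := contMDiffAt_of_mem_maximalAtlas (flagChart_mem_maximalAtlas (k := k) e q) hq
  have hqt : flagChart e q q ∈ flagTarget e := (flagChart e q).map_source hq
  have h2 := ((contMDiffOn_flagPoint (k := k) (e := e) (p₀ := q.1)).contMDiffAt
    (isOpen_flagTarget.mem_nhds hqt)).comp q h1
  refine h2.congr_of_eventuallyEq ?_
  filter_upwards [(flagChart e q).open_source.mem_nhds hq] with z hz
  exact (flagPoint_flagCoords z.2 hz).symm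

/-- The universal property of an embedded submanifold: compose `f` with the ambient map `flagCoords`
and then with the inverse of the chart. -/
theorem contMDiffWithinAt_boundaryReduction {f : N → boundaryReduction d M} {s : Set N} {y : N}
    (hf : ContMDiffWithinAt I ((𝓡∂ (d + 1)).prod 𝓘(ℝ, ProjFiber d)) k (fun z => (f z).1) s y) :
    ContMDiffWithinAt I (𝓡 ((d + 1) * (d + 2))) k f s y := by
  let e := achart (EuclideanHalfSpace (d + 1)) (baseOf (f y).1)
  have hq : f y ∈ (flagChart e (f y)).source :=
    mem_chart_source (EuclideanHalfSpace (d + 1)) (baseOf (f y).1)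
  have hqt : flagChart e (f y) (f y) ∈ flagTarget e := (flagChart e (f y)).map_source hq
  have h1 := contMDiffAt_symm_of_mem_maximalAtlas (flagChart_mem_maximalAtlas (k := k) e (f y)) hqt
  have h2 := (contMDiffAt_flagCoords (k := k) (e := e) (p := (f y).1) hq).comp_contMDiffWithinAt y hf
  have h3 := ContMDiffAt.comp_contMDiffWithinAt y h1 h2
  refine h3.congr_of_eventuallyEq ?_ ((flagChart e (f y)).left_inv hq).symm
  have hb : ∀ᶠ z in 𝓝[s] y, baseOf (f z).1 ∈ e.1.source :=
    (baseOf_continuous.continuousAt.comp_continuousWithinAt hf.continuousWithinAt).eventually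
      (e.1.open_source.mem_nhds hq)
  filter_upwards [hb] with z hz
  exact ((flagChart e (f y)).left_inv hz).symm

/-- `flagCoords` followed by the inverse chart is a left inverse of the inclusion near `q`. As `Q`
carries the subspace topology, the immersion is an embedding. -/
theorem injective_mfderiv_boundaryReduction_val (q : boundaryReduction d M) :
    Function.Injective (mfderiv (𝓡 ((d + 1) * (d + 2))) ((𝓡∂ (d + 1)).prod 𝓘(ℝ, ProjFiber d))
      (Subtype.val : boundaryReduction d M → projBundle d M) q) := by
  let e := achart (EuclideanHalfSpace (d + 1)) (baseOf q.1)
  have hq : q ∈ (flagChart e q).source := mem_chart_source (EuclideanHalfSpace (d + 1)) (baseOf q.1)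
  have hqt : flagChart e q q ∈ flagTarget e := (flagChart e q).map_source hq
  have h1 := (contMDiffAt_symm_of_mem_maximalAtlas (flagChart_mem_maximalAtlas (k := ∞) e q)
    hqt).mdifferentiableAt (by simp)
  have h2 := (contMDiffAt_flagCoords (k := ∞) (e := e) (p := q.1) hq).mdifferentiableAt (by simp)
  have h3 := (contMDiff_boundaryReduction_val (k := ∞) (d := d) (M := M) q).mdifferentiableAt (by simp)
  refine injective_mfderiv_of_leftInverse (MDifferentiableAt.comp q.1 h1 h2) h3 ?_
  filter_upwards [(flagChart e q).open_source.mem_nhds hq] with z hz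
  exact (flagChart e q).left_inv hz

end Maps

end BoundaryReduction

/-! ### The group law of `H` on pairs `(A, Υ)` -/

section FiberGroup

variable {d : ℕ}

theorem fiberMul_assoc (a b c : ProjFiber d) :
    fiberMul (fiberMul a b) c = fiberMul a (fiberMul b c) := by
  refine Prod.ext rfl ?_
  ext v
  simp [fiberMul_eq, add_assoc]

theorem fiberMul_id (a : ProjFiber d) :
    fiberMul a (ContinuousLinearMap.id ℝ (Coord d), (0 : Coord d →L[ℝ] ℝ)) = a := by
  refine Prod.ext ?_ ?_ <;> ext v <;> simp [fiberMul_eq]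

theorem id_fiberMul (a : ProjFiber d) :
    fiberMul (ContinuousLinearMap.id ℝ (Coord d), (0 : Coord d →L[ℝ] ℝ)) a = a := by
  refine Prod.ext ?_ ?_ <;> ext v <;> simp [fiberMul_eq]

theorem contDiff_fiberMul {k : WithTop ℕ∞} :
    ContDiff ℝ k fun z : ProjFiber d × ProjFiber d => fiberMul z.1 z.2 :=
  (contDiff_leftTranslate.comp contDiff_fst).clm_apply contDiff_snd

theorem contDiff_fiberMatrix {k : WithTop ℕ∞} :
    ContDiff ℝ k fun (a : ProjFiber d) (i j : HomogIndex d) => fiberMatrix a i j := by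
  refine contDiff_pi.2 fun i => contDiff_pi.2 fun j => ?_
  rcases i with i | i <;> rcases j with j | j
  · exact (EuclideanSpace.proj i : Coord d →L[ℝ] ℝ).contDiff.comp
      (contDiff_fst.clm_apply contDiff_const)
  · exact contDiff_const
  · exact contDiff_snd.clm_apply contDiff_const
  · exact contDiff_const

/-- `A` acts on the line `ℝⁿ / {v⁰ = 0}` by a scalar, which is read off at `e_0`. -/
theorem apply_zero_of_preserves {A : Coord d →L[ℝ] Coord d}
    (h : ∀ v : Coord d, v 0 = 0 → A v 0 = 0) (v : Coord d) : A v 0 = v 0 * A (basisVec 0) 0 := by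
  have h1 := h (v - v 0 • basisVec 0) (by simp [basisVec])
  rw [map_sub, map_smul] at h1
  simpa [sub_eq_zero] using h1

/-- For invertible `A` the scalar induced on `ℝⁿ / {v⁰ = 0}` is nonzero, since otherwise `e_0` would
not be in the range. -/
theorem apply_zero_iff {A : Coord d →L[ℝ] Coord d} (hA : IsUnit A)
    (h : ∀ v : Coord d, v 0 = 0 → A v 0 = 0) {v : Coord d} : A v 0 = 0 ↔ v 0 = 0 := by
  refine ⟨fun hv => ?_, h v⟩
  obtain ⟨B, hB⟩ := hA.exists_right_inv
  have h0 : A (basisVec 0) 0 ≠ 0 := by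
    intro h0
    have h1 : A (B (basisVec 0)) = basisVec 0 := DFunLike.congr_fun hB (basisVec 0)
    have h2 := apply_zero_of_preserves h (B (basisVec 0))
    rw [h1, h0, mul_zero] at h2
    simp [basisVec] at h2
  rw [apply_zero_of_preserves h v] at hv
  exact (mul_eq_zero.1 hv).resolve_right h0

/-- Division in `H`, in terms of pairs `(A, Υ)`. -/
theorem exists_fiberMul_eq {a c : ProjFiber d} (ha : IsUnit a.1) :
    ∃ b : ProjFiber d, (IsUnit c.1 → IsUnit b.1) ∧ fiberMul a b = c := by
  obtain ⟨u, hu⟩ := ha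
  -- The solution is linear in `c` and needs no inverse of `c`. So the lemma also applies to tangent
  -- vectors `c` of the fibre, and invertibility of the solution is a separate implication.
  refine ⟨((↑u⁻¹ : Coord d →L[ℝ] Coord d) * c.1,
    c.2 - a.2.comp ((↑u⁻¹ : Coord d →L[ℝ] Coord d) * c.1)), fun hc => u⁻¹.isUnit.mul hc, ?_⟩
  refine Prod.ext ?_ ?_
  · change a.1 * ((↑u⁻¹ : Coord d →L[ℝ] Coord d) * c.1) = c.1
    rw [← hu, ← mul_assoc, Units.mul_inv, one_mul]
  · simp [fiberMul_eq]

/-- The element of `H` relating two points of a fibre of `Q` lies in `H̃`. The same argument serves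
infinitesimally, so nothing is required of `b` beyond the equation. -/
theorem fiberMul_preserves {a b c : ProjFiber d} (ha : IsUnit a.1) (h : fiberMul a b = c)
    (hpa : ∀ v : Coord d, v 0 = 0 → a.1 v 0 = 0) (hpc : ∀ v : Coord d, v 0 = 0 → c.1 v 0 = 0) :
    ∀ v : Coord d, v 0 = 0 → b.1 v 0 = 0 := by
  intro v hv
  have h1 : a.1 (b.1 v) = c.1 v := by rw [← h]; rfl
  exact (apply_zero_iff ha hpa).1 (by rw [h1]; exact hpc v hv)

theorem fiberMul_left_cancel {a b b' : ProjFiber d} (ha : IsUnit a.1)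
    (h : fiberMul a b = fiberMul a b') : b = b' := by
  have h1 : a.1 * b.1 = a.1 * b'.1 := congrArg Prod.fst h
  have h2 : b.1 = b'.1 := ha.mul_left_cancel h1
  have h3 : a.2.comp b.1 + b.2 = a.2.comp b'.1 + b'.2 := congrArg Prod.snd h
  rw [h2] at h3
  exact Prod.ext h2 (add_left_cancel h3)

end FiberGroup

/-! ### The right action in coordinates -/

section Action

variable {d : ℕ} {M : Type*} [TopologicalSpace M] [ChartedSpace (EuclideanHalfSpace (d + 1)) M]
  [IsManifold (𝓡∂ (d + 1)) ∞ M]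

theorem baseOf_projAct (p : projBundle d M) (h : isotropyPoint d) :
    baseOf (projAct p h) = baseOf p := rfl

/-- Changes of chart are left multiplications and commute with right multiplication. The action,
defined in the preferred chart, therefore has the same formula in every chart. -/
theorem coordsIn_projAct (e : atlas (EuclideanHalfSpace (d + 1)) M) (p : projBundle d M)
    (h : isotropyPoint d) : coordsIn e (projAct p h) =
      fiberMul (coordsIn e p) (linPart (liftGL h.1), covPart (liftGL h.1)) := by
  exact (fiberMul_assoc (_, _) (show ProjFiber d from p.1.2)
    (linPart (liftGL h.1), covPart (liftGL h.1))).symm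

theorem coordsIn_projAct_mk (e : atlas (EuclideanHalfSpace (d + 1)) M) (p : projBundle d M)
    (b : GL (HomogIndex d) ℝ) (hb : Matrix.ProjGenLinGroup.mk b ∈ isotropyPoint d) :
    coordsIn e (projAct p ⟨Matrix.ProjGenLinGroup.mk b, hb⟩) =
      fiberMul (coordsIn e p) (linPart b, covPart b) := by
  rw [coordsIn_projAct]
  have h := blocks_congr (mk_liftGL (Matrix.ProjGenLinGroup.mk b))
  simp only [h.1, h.2]

theorem projAct_one (p : projBundle d M) : projAct p 1 = p := by
  refine coordsIn_ext (e := achart (EuclideanHalfSpace (d + 1)) (baseOf p))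
    (by rw [baseOf_projAct]; exact mem_chart_source _ _) (by simp only [baseOf_projAct]) ?_
  have hm : Matrix.ProjGenLinGroup.mk 1 ∈ isotropyPoint d := by
    rw [map_one]; exact one_mem _
  have h1 : (1 : isotropyPoint d) = ⟨Matrix.ProjGenLinGroup.mk 1, hm⟩ :=
    Subtype.ext (map_one _).symm
  rw [h1, coordsIn_projAct_mk, blocks_one, fiberMul_id]

theorem projAct_mul (p : projBundle d M) (h h' : isotropyPoint d) :
    projAct p (h * h') = projAct (projAct p h) h' := by
  refine coordsIn_ext (e := achart (EuclideanHalfSpace (d + 1)) (baseOf p))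
    (by rw [baseOf_projAct]; exact mem_chart_source _ _) (by simp only [baseOf_projAct]) ?_
  obtain ⟨h, hh⟩ := h
  obtain ⟨h', hh'⟩ := h'
  obtain ⟨b, rfl⟩ := Matrix.ProjGenLinGroup.mk_surjective h
  obtain ⟨b', rfl⟩ := Matrix.ProjGenLinGroup.mk_surjective h'
  have hm : Matrix.ProjGenLinGroup.mk (b * b') ∈ isotropyPoint d := by
    rw [map_mul]; exact mul_mem hh hh'
  have h1 : (⟨Matrix.ProjGenLinGroup.mk b, hh⟩ * ⟨Matrix.ProjGenLinGroup.mk b', hh'⟩ :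
      isotropyPoint d) = ⟨Matrix.ProjGenLinGroup.mk (b * b'), hm⟩ :=
    Subtype.ext (map_mul _ _ _).symm
  rw [h1, coordsIn_projAct_mk, coordsIn_projAct_mk, coordsIn_projAct_mk, fiberMul_assoc,
    ← normalizedBlocks_mul hh hh']

section Smooth

variable {k : WithTop ℕ∞} [(projCore d M).IsContMDiff (𝓡∂ (d + 1)) k]

theorem contMDiff_of_fiberwise {f : projBundle d M → projBundle d M}
    (hb : ∀ p, baseOf (f p) = baseOf p) {phi : ProjFiber d → ProjFiber d} (hphi : ContDiff ℝ k phi)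
    (hf : ∀ (e : atlas (EuclideanHalfSpace (d + 1)) M) p, coordsIn e (f p) = phi (coordsIn e p)) :
    ContMDiff ((𝓡∂ (d + 1)).prod 𝓘(ℝ, ProjFiber d)) ((𝓡∂ (d + 1)).prod 𝓘(ℝ, ProjFiber d)) k f := by
  intro p
  have hs : baseOf p ∈ (achart (EuclideanHalfSpace (d + 1)) (baseOf p)).1.source :=
    mem_chart_source _ _
  refine (contMDiffAt_projBundle_iff (e := achart (EuclideanHalfSpace (d + 1)) (baseOf p))
    (by rwa [hb])).2 ⟨?_, ?_⟩
  · rw [funext hb]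
    exact contMDiff_baseOf.contMDiffAt
  · rw [funext (hf _)]
    exact hphi.contMDiff.contMDiffAt.comp p (contMDiffAt_coordsIn (k := k) hs)

theorem contMDiff_projAct (h : isotropyPoint d) :
    ContMDiff ((𝓡∂ (d + 1)).prod 𝓘(ℝ, ProjFiber d)) ((𝓡∂ (d + 1)).prod 𝓘(ℝ, ProjFiber d)) k
      (fun p : projBundle d M => projAct p h) :=
  contMDiff_of_fiberwise (fun p => baseOf_projAct p h)
    (contDiff_fiberMul.comp (contDiff_id.prodMk contDiff_const))
    (fun e p => coordsIn_projAct e p h)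

variable [IsManifold (𝓡∂ (d + 1)) k M]

theorem contMDiff_boundaryAct (h : isotropyFlag d) :
    ContMDiff (𝓡 ((d + 1) * (d + 2))) (𝓡 ((d + 1) * (d + 2))) k
      (fun q : boundaryReduction d M => boundaryAct q h) := fun _ =>
  contMDiffWithinAt_boundaryReduction
    ((contMDiff_projAct (k := k) _).comp contMDiff_boundaryReduction_val).contMDiffAt

end Smooth

end Action

/-! ### Smooth maps into and out of `∂M` -/

section BoundaryMaps

variable {d : ℕ} {M : Type*} [TopologicalSpace M] [ChartedSpace (EuclideanHalfSpace (d + 1)) M]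
  [IsManifold (𝓡∂ (d + 1)) 1 M] {k : WithTop ℕ∞} [IsManifold (𝓡∂ (d + 1)) k M]
  {EN : Type*} [NormedAddCommGroup EN] [NormedSpace ℝ EN] {HN : Type*} [TopologicalSpace HN]
  {I : ModelWithCorners ℝ EN HN} {N : Type*} [TopologicalSpace N] [ChartedSpace HN N]

/-- In the charts `y` of `∂M` and `(r, y)` of `M` the inclusion is the linear map `y ↦ (0, y)`. -/
theorem contMDiff_boundary_val :
    ContMDiff (𝓡 d) (𝓡∂ (d + 1)) k (Subtype.val : (𝓡∂ (d + 1)).boundary M → M) := by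
  intro x
  have hs : x.1 ∈ (chartAt (EuclideanHalfSpace (d + 1)) x.1).source := mem_chart_source _ _
  have he := chart_mem_atlas (EuclideanHalfSpace (d + 1)) x.1
  set e := chartAt (EuclideanHalfSpace (d + 1)) x.1
  have h1 : ContMDiffAt (𝓡 d) 𝓘(ℝ, EuclideanSpace ℝ (Fin d)) k (boundaryChart e he x) x :=
    contMDiffAt_of_mem_maximalAtlas (IsManifold.subset_maximalAtlas ⟨e, he, x, rfl⟩) hs
  have h2 : ContMDiffAt (𝓡 d) 𝓘(ℝ, Coord d) k (fun y => insertZero d (boundaryChart e he x y)) x :=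
    (insertZero d).contDiff.contMDiff.contMDiffAt.comp x h1
  have hz : ∀ y : (𝓡∂ (d + 1)).boundary M, y.1 ∈ e.source →
      insertZero d (boundaryChart e he x y) = e.extend (𝓡∂ (d + 1)) y.1 := fun y hy =>
    insertZero_dropZero ((mem_boundary_iff he hy).1 y.2)
  have hev : ∀ᶠ y : (𝓡∂ (d + 1)).boundary M in 𝓝 x, y.1 ∈ e.source :=
    continuous_subtype_val.continuousAt.eventually (e.open_source.mem_nhds hs)
  have h3 := contMDiffOn_extend_symm (I := 𝓡∂ (d + 1)) (n := k)
    (IsManifold.subset_maximalAtlas he)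
  have h4 : ContMDiffWithinAt (𝓡 d) (𝓡∂ (d + 1)) k
      ((e.extend (𝓡∂ (d + 1))).symm ∘ fun y => insertZero d (boundaryChart e he x y))
      {y : (𝓡∂ (d + 1)).boundary M | y.1 ∈ e.source} x := by
    refine ContMDiffWithinAt.comp x (h3 _ ?_) h2.contMDiffWithinAt ?_
    · rw [hz x hs]
      exact ⟨e x.1, e.map_source hs, rfl⟩
    · intro y hy
      change insertZero d (boundaryChart e he x y) ∈ _ '' _
      rw [hz y hy]
      exact ⟨e y.1, e.map_source hy, rfl⟩
  refine (h4.contMDiffAt hev).congr_of_eventuallyEq ?_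
  filter_upwards [hev] with y hy
  rw [Function.comp_apply, hz y hy, e.extend_left_inv hy]

theorem contMDiffWithinAt_boundary {f : N → (𝓡∂ (d + 1)).boundary M} {s : Set N} {y : N}
    (hf : ContMDiffWithinAt I (𝓡∂ (d + 1)) k (fun z => (f z).1) s y) :
    ContMDiffWithinAt I (𝓡 d) k f s y := by
  have hs : (f y).1 ∈ (chartAt (EuclideanHalfSpace (d + 1)) (f y).1).source := mem_chart_source _ _
  have he := chart_mem_atlas (EuclideanHalfSpace (d + 1)) (f y).1
  set e := chartAt (EuclideanHalfSpace (d + 1)) (f y).1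
  have h1 : ContMDiffWithinAt I 𝓘(ℝ, EuclideanSpace ℝ (Fin d)) k
      (fun z => dropZero d (e.extend (𝓡∂ (d + 1)) (f z).1)) s y :=
    (dropZero d).contDiff.contMDiff.contMDiffAt.comp_contMDiffWithinAt y
      ((e.contMDiffAt_extend (IsManifold.subset_maximalAtlas he) hs).comp_contMDiffWithinAt y hf)
  have ht : boundaryChart e he (f y) (f y) ∈ (boundaryChart e he (f y)).target :=
    (boundaryChart e he (f y)).map_source hs
  have h2 : ContMDiffAt 𝓘(ℝ, EuclideanSpace ℝ (Fin d)) (𝓡 d) k (boundaryChart e he (f y)).symm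
      (boundaryChart e he (f y) (f y)) :=
    contMDiffAt_symm_of_mem_maximalAtlas (IsManifold.subset_maximalAtlas ⟨e, he, f y, rfl⟩) ht
  refine (h2.comp_contMDiffWithinAt y h1).congr_of_eventuallyEq ?_
    ((boundaryChart e he (f y)).left_inv hs).symm
  filter_upwards [hf.continuousWithinAt.eventually (e.open_source.mem_nhds hs)] with z hz
  exact ((boundaryChart e he (f y)).left_inv hz).symm

end BoundaryMaps

/-! ### `Q` as a principal `H̃`-bundle -/

section Principal

variable {d : ℕ} {M : Type*} [TopologicalSpace M] [ChartedSpace (EuclideanHalfSpace (d + 1)) M]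
  [IsManifold (𝓡∂ (d + 1)) ∞ M]

/-- If the two points have coordinates `a` and `c` in one chart, the required element is `a⁻¹c`. It
lies in `H̃` because both factors preserve `{v⁰ = 0}`. -/
theorem boundaryAct_simply_transitive (p q : boundaryReduction d M)
    (hpq : boundaryProj p = boundaryProj q) : ∃! h, boundaryAct p h = q := by
  have hb : baseOf p.1 = baseOf q.1 := congrArg Subtype.val hpq
  let e := achart (EuclideanHalfSpace (d + 1)) (baseOf p.1)
  have hp : baseOf p.1 ∈ e.1.source := mem_chart_source _ _
  have hq : baseOf q.1 ∈ e.1.source := hb ▸ hp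
  have hup := isUnit_coordsIn hp
  obtain ⟨b, hbu, hbc⟩ := exists_fiberMul_eq (c := coordsIn e q.1) hup
  replace hbu := hbu (isUnit_coordsIn hq)
  have hbp := fiberMul_preserves hup hbc ((mem_boundaryReduction_iff hp).1 p.2).2
    ((mem_boundaryReduction_iff hq).1 q.2).2
  refine ⟨⟨Matrix.ProjGenLinGroup.mk (fiberGL b hbu), fiberGL_mem_isotropyFlag b hbu hbp⟩, ?_, ?_⟩
  · refine Subtype.ext (coordsIn_ext (e := e) hp hb ?_)
    refine (coordsIn_projAct_mk e p.1 (fiberGL b hbu) (fiberGL_mem_isotropyPoint b hbu)).trans ?_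
    rw [linPart_fiberGL, covPart_fiberGL]
    exact hbc
  · rintro ⟨h, hh⟩ hact
    obtain ⟨c, rfl⟩ := Matrix.ProjGenLinGroup.mk_surjective h
    have h1 : coordsIn e (projAct p.1 ⟨Matrix.ProjGenLinGroup.mk c, hh.2⟩) = coordsIn e q.1 :=
      congrArg (fun q : boundaryReduction d M => coordsIn e q.1) hact
    rw [coordsIn_projAct_mk, ← hbc] at h1
    have h2 := fiberMul_left_cancel hup h1
    apply Subtype.ext
    refine eq_of_blocks hh.2 (fiberGL_mem_isotropyPoint b hbu) ?_ ?_
    · rw [linPart_fiberGL]; exact congrArg Prod.fst h2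
    · rw [covPart_fiberGL]; exact congrArg Prod.snd h2

/-- Supplies the default value that `flagPointOf` takes outside its meaningful range. -/
theorem exists_boundaryReduction_over (x : (𝓡∂ (d + 1)).boundary M) :
    Nonempty (boundaryReduction d M) := by
  let e := achart (EuclideanHalfSpace (d + 1)) x.1
  have hx : x.1 ∈ e.1.source := mem_chart_source _ _
  have hu : IsUnit ((ContinuousLinearMap.id ℝ (Coord d), (0 : Coord d →L[ℝ] ℝ)) : ProjFiber d).1 :=
    isUnit_one
  let p : projBundle d M := ⟨totalPoint e x.1 (ContinuousLinearMap.id ℝ (Coord d), 0),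
    totalPoint_mem hx hu⟩
  have hp : p = pointOf e p x.1 (ContinuousLinearMap.id ℝ (Coord d), 0) := by
    rw [pointOf, dif_pos ⟨hx, hu⟩]
  refine ⟨⟨p, (mem_boundaryReduction_iff (e := e) (p := p) hx).2 ⟨x.2, fun v hv => ?_⟩⟩⟩
  rw [hp, coordsIn_pointOf hx hu]
  exact hv

theorem isPrincipalBundle_boundaryReduction {k : WithTop ℕ∞} [IsManifold (𝓡∂ (d + 1)) k M]
    [(projCore d M).IsContMDiff (𝓡∂ (d + 1)) k] :
    IsPrincipalBundle (𝓡 d) (𝓡 ((d + 1) * (d + 2))) k (isotropyFlag d)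
      (boundaryProj : boundaryReduction d M → _) boundaryAct where
  contMDiff_proj q := contMDiffWithinAt_boundary
    ((contMDiff_baseOf (k := k)).comp contMDiff_boundaryReduction_val).contMDiffAt
  act_one p := Subtype.ext (projAct_one p.1)
  act_mul p h h' := Subtype.ext (projAct_mul p.1 ⟨h.1, h.2.2⟩ ⟨h'.1, h'.2.2⟩)
  proj_act _ _ := rfl
  simply_transitive := boundaryAct_simply_transitive
  locally_trivial x₀ := by
    obtain ⟨q₀⟩ := exists_boundaryReduction_over x₀
    let e := achart (EuclideanHalfSpace (d + 1)) x₀.1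
    have hid : IsUnit (ContinuousLinearMap.id ℝ (Coord d)) := isUnit_one
    have hcov : ContMDiff (𝓡 d) (𝓡∂ (d + 1)) k
      (Subtype.val : (𝓡∂ (d + 1)).boundary M → M) := contMDiff_boundary_val
    -- The local section has coordinates `(1, 0)`, so that `s(x)·h` has as coordinates the pair of
    -- `h` itself.
    let s : (𝓡∂ (d + 1)).boundary M → boundaryReduction d M :=
      fun x => flagPointOf e q₀ x.1 (ContinuousLinearMap.id ℝ (Coord d), 0)
    have hs : ∀ x : (𝓡∂ (d + 1)).boundary M, x.1 ∈ e.1.source →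
        (s x).1 = pointOf e q₀.1 x.1 (ContinuousLinearMap.id ℝ (Coord d), 0) :=
      fun x hx => flagPointOf_val hx x.2 hid fun v hv => hv
    have hsb : ∀ x : (𝓡∂ (d + 1)).boundary M, x.1 ∈ e.1.source → baseOf (s x).1 = x.1 :=
      fun x hx => by rw [hs x hx, baseOf_pointOf hx hid]
    have hsc : ∀ x : (𝓡∂ (d + 1)).boundary M, x.1 ∈ e.1.source →
        coordsIn e (s x).1 = (ContinuousLinearMap.id ℝ (Coord d), 0) :=
      fun x hx => by rw [hs x hx, coordsIn_pointOf hx hid]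
    have hact : ∀ (x : (𝓡∂ (d + 1)).boundary M) (_ : x.1 ∈ e.1.source) (b : GL (HomogIndex d) ℝ)
        (hb : Matrix.ProjGenLinGroup.mk b ∈ isotropyFlag d),
        baseOf (boundaryAct (s x) ⟨Matrix.ProjGenLinGroup.mk b, hb⟩).1 = x.1 ∧
        coordsIn e (boundaryAct (s x) ⟨Matrix.ProjGenLinGroup.mk b, hb⟩).1 =
          (linPart b, covPart b) := by
      intro x hx b hb
      refine ⟨hsb x hx, ?_⟩
      refine (coordsIn_projAct_mk e (s x).1 b hb.2).trans ?_
      rw [hsc x hx, id_fiberMul]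
    refine ⟨{x | x.1 ∈ e.1.source}, e.1.open_source.preimage continuous_subtype_val,
      mem_chart_source _ _, s, ?_, fun x hx => Subtype.ext (hsb x hx), ⟨fun z =>
        flagPointOf e q₀ z.1.1 (normalizedBlocks z.2), ?_, ?_⟩, ?_⟩
    · intro x hx
      refine contMDiffWithinAt_boundaryReduction ?_
      exact (contMDiffWithinAt_pointOf (p₀ := q₀.1) hcov.contMDiffAt.contMDiffWithinAt
        contMDiffWithinAt_const hx hid).congr (fun y hy => hs y hy) (hs x hx)
    -- On the prescribed domain the array `z.2` represents an element of `H̃`. Hence its last entry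
    -- can be inverted, its normalized block is invertible, and `flagPointOf` does not take its
    -- default value.
    · have hval : ∀ z : (𝓡∂ (d + 1)).boundary M × (HomogIndex d → HomogIndex d → ℝ),
          (z.1.1 ∈ e.1.source ∧ ∃ b : GL (HomogIndex d) ℝ,
            Matrix.ProjGenLinGroup.mk b ∈ isotropyFlag d ∧ ∀ i j, b i j = z.2 i j) →
          IsUnit (normalizedBlocks z.2).1 ∧ z.2 (Sum.inr ()) (Sum.inr ()) ≠ 0 ∧
          (flagPointOf e q₀ z.1.1 (normalizedBlocks z.2)).1 =
            pointOf e q₀.1 z.1.1 (normalizedBlocks z.2) := by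
        rintro ⟨x, m⟩ ⟨hx, b, hb, hbm⟩
        obtain rfl : (fun i j => b i j) = m := funext fun i => funext fun j => hbm i j
        have hu : IsUnit (normalizedBlocks fun i j => b i j).1 := by
          rw [normalizedBlocks_fst]; exact isUnit_linPart hb.2
        refine ⟨hu, (isUnit_of_mem_isotropyPoint hb.2).1, flagPointOf_val hx x.2 hu fun v hv => ?_⟩
        rw [normalizedBlocks_fst]
        exact linPart_preserves hb.1 hv
      intro z hz
      refine contMDiffWithinAt_boundaryReduction ?_
      refine (contMDiffWithinAt_pointOf (p₀ := q₀.1) (f := fun z => z.1.1)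
        (a := fun z => normalizedBlocks z.2) ?_ ?_ hz.1 (hval z hz).1).congr
        (fun y hy => (hval y hy).2.2) (hval z hz).2.2
      · exact (hcov.comp contMDiff_fst).contMDiffAt.contMDiffWithinAt
      · exact ((contDiffAt_normalizedBlocks (hval z hz).2.1).contMDiffAt.comp z
          contMDiffAt_snd).contMDiffWithinAt
    · intro x hx b hb
      have hu : IsUnit (linPart b) := isUnit_linPart hb.2
      have hv : (flagPointOf e q₀ x.1 (linPart b, covPart b)).1 =
          pointOf e q₀.1 x.1 (linPart b, covPart b) :=
        flagPointOf_val hx x.2 hu fun v hv => linPart_preserves hb.1 hv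
      obtain ⟨h1, h2⟩ := hact x hx b hb
      apply Subtype.ext
      change (flagPointOf e q₀ x.1 (normalizedBlocks fun i j => b i j)).1 = _
      rw [normalizedBlocks_eq, hv]
      refine coordsIn_ext (e := e) ?_ ?_ ?_
      · rw [baseOf_pointOf hx hu]; exact hx
      · rw [baseOf_pointOf hx hu, h1]
      · rw [coordsIn_pointOf hx hu, h2]
    · intro p₀ hp₀
      -- The inverse trivialization uses the representative with last diagonal entry `1`.
      refine ⟨fun p i j => fiberMatrix (coordsIn e p.1) i j, ?_, ?_⟩
      · exact (contDiff_fiberMatrix.contMDiff.contMDiffAt.comp p₀.1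
          (contMDiffAt_coordsIn (k := k) hp₀)).comp p₀ contMDiff_boundaryReduction_val.contMDiffAt
      · have hev : ∀ᶠ p : boundaryReduction d M in 𝓝 p₀, baseOf p.1 ∈ e.1.source :=
          (baseOf_continuous.comp continuous_subtype_val).continuousAt.eventually
            (e.1.open_source.mem_nhds hp₀)
        filter_upwards [hev] with p hp
        have hu := isUnit_coordsIn hp
        have hflag := fiberGL_mem_isotropyFlag (coordsIn e p.1) hu
          ((mem_boundaryReduction_iff hp).1 p.2).2
        refine ⟨fiberGL (coordsIn e p.1) hu, hflag, fun i j => rfl, ?_⟩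
        obtain ⟨h1, h2⟩ := hact (boundaryProj p) hp _ hflag
        refine Subtype.ext (coordsIn_ext (e := e) hp h1.symm ?_)
        rw [h2, linPart_fiberGL, covPart_fiberGL]

end Principal

/-! ### One-parameter subgroups -/

section Exponential

variable {ι : Type*} [Fintype ι] [DecidableEq ι]

-- The statement is entrywise, so that the norm on matrices chosen for the exponential does not
-- leave the proof.
open scoped Matrix.Norms.Operator in
theorem hasDerivAt_exp_entries (X : Matrix ι ι ℝ) :
    HasDerivAt (fun (t : ℝ) (i j : ι) => expGL (t • X) i j) (fun i j => X i j) 0 := by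
  have h := hasDerivAt_exp_smul_const (𝕂 := ℝ) X (0 : ℝ)
  rw [zero_smul, NormedSpace.exp_zero, one_mul] at h
  refine hasDerivAt_pi.2 fun i => hasDerivAt_pi.2 fun j => ?_
  have hL := (LinearMap.toContinuousLinearMap (Matrix.entryLinearMap ℝ ℝ i j)).hasFDerivAt
    (x := NormedSpace.exp ((0 : ℝ) • X))
  exact hL.comp_hasDerivAt (0 : ℝ) h

open scoped Matrix.Norms.Operator in
theorem contDiff_exp_entries {k : WithTop ℕ∞} (X : Matrix ι ι ℝ) :
    ContDiff ℝ k fun (t : ℝ) (i j : ι) => expGL (t • X) i j := by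
  have h : ContDiff ℝ k fun t : ℝ => NormedSpace.exp (t • X) := by
    have h1 : ContDiff ℝ k (NormedSpace.exp : Matrix ι ι ℝ → Matrix ι ι ℝ) :=
      AnalyticOnNhd.contDiff fun x _ => NormedSpace.exp_analytic x
    exact h1.comp (contDiff_id.smul contDiff_const)
  refine contDiff_pi.2 fun i => contDiff_pi.2 fun j => ?_
  exact (LinearMap.toContinuousLinearMap (Matrix.entryLinearMap ℝ ℝ i j)).contDiff.comp h

theorem expGL_zero_smul (X : Matrix ι ι ℝ) : expGL ((0 : ℝ) • X) = 1 := by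
  apply Units.ext
  change NormedSpace.exp ((0 : ℝ) • X) = 1
  rw [zero_smul, NormedSpace.exp_zero]

end Exponential

/-! ### The Lie algebras of `G̃` and `H`, dimension and generators -/

section LieAlgebras

variable {d : ℕ}

/-- The vanishing of the entries `(0, j)`, `j ≠ 0`, of a matrix. -/
def IsFlagRow (Y : Matrix (HomogIndex d) (HomogIndex d) ℝ) : Prop :=
  ∀ j, j ≠ Sum.inl 0 → Y (Sum.inl 0) j = 0

/-- Gives closure under products and exponentials, which block triangular matrices enjoy. -/
theorem isFlagRow_iff_blockTriangular {Y : Matrix (HomogIndex d) (HomogIndex d) ℝ} :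
    IsFlagRow Y ↔ Y.BlockTriangular fun i => if i = Sum.inl 0 then 1 else 0 := by
  constructor
  · intro h i j hij
    dsimp only at hij
    split_ifs at hij with h1 h2 h2
    · exact absurd hij (lt_irrefl _)
    · simp at hij
    · rw [h2]; exact h j h1
    · exact absurd hij (lt_irrefl _)
  · intro h j hj
    exact h (by simp [hj])

theorem IsFlagRow.add {Y Z : Matrix (HomogIndex d) (HomogIndex d) ℝ} (hY : IsFlagRow Y)
    (hZ : IsFlagRow Z) : IsFlagRow (Y + Z) := fun j hj => by
  rw [Matrix.add_apply, hY j hj, hZ j hj, add_zero]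

theorem IsFlagRow.mul {Y Z : Matrix (HomogIndex d) (HomogIndex d) ℝ} (hY : IsFlagRow Y)
    (hZ : IsFlagRow Z) : IsFlagRow (Y * Z) :=
  isFlagRow_iff_blockTriangular.2
    ((isFlagRow_iff_blockTriangular.1 hY).mul (isFlagRow_iff_blockTriangular.1 hZ))

theorem isFlagRow_of_mem {b : GL (HomogIndex d) ℝ}
    (hb : Matrix.ProjGenLinGroup.mk b ∈ stabHyperplane d) :
    IsFlagRow (b : Matrix (HomogIndex d) (HomogIndex d) ℝ) := mem_stabHyperplane_iff.1 hb

theorem IsFlagRow.exp {Y : Matrix (HomogIndex d) (HomogIndex d) ℝ} (hY : IsFlagRow Y) :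
    IsFlagRow (NormedSpace.exp Y) :=
  isFlagRow_iff_blockTriangular.2 (isFlagRow_iff_blockTriangular.1 hY).exp

/-- One direction differentiates the vanishing entries of `exp(tY)` at `t = 0`; the other uses that
block triangular matrices are stable under `exp`. -/
theorem mem_projLieAlgebra_stabHyperplane {Y : Matrix (HomogIndex d) (HomogIndex d) ℝ} :
    Y ∈ projLieAlgebra (stabHyperplane d) ↔ Y.trace = 0 ∧ IsFlagRow Y := by
  refine and_congr_right fun _ => ⟨fun h j hj => ?_, fun h t => ?_⟩
  · have h1 := hasDerivAt_pi.1 (hasDerivAt_pi.1 (hasDerivAt_exp_entries Y) (Sum.inl 0)) j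
    have h2 : (fun t : ℝ => expGL (t • Y) (Sum.inl 0) j) = fun _ => 0 :=
      funext fun t => mem_stabHyperplane_iff.1 (h t) j hj
    rw [h2] at h1
    exact h1.unique (hasDerivAt_const 0 0)
  · rw [mem_stabHyperplane_iff]
    have h1 : IsFlagRow (t • Y) := fun j hj => by rw [Matrix.smul_apply, h j hj, smul_zero]
    exact h1.exp

theorem mem_projLieAlgebra_isotropyPoint {Y : Matrix (HomogIndex d) (HomogIndex d) ℝ}
    (ht : Y.trace = 0) (h : ∀ i, Y (Sum.inl i) (Sum.inr ()) = 0) :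
    Y ∈ projLieAlgebra (isotropyPoint d) := by
  refine ⟨ht, fun t => ?_⟩
  rw [mem_isotropyPoint_iff]
  intro i
  have h1 : (t • Y).BlockTriangular (Sum.elim (fun _ => (1 : ℕ)) fun _ => 0) := by
    rintro (i | i) (j | j) hij
    · simp at hij
    · simp [h i]
    · simp at hij
    · simp at hij
  exact h1.exp (by simp)

/-- The linear equations of the Lie algebra of `G̃`. -/
def lieEquations (d : ℕ) : Matrix (HomogIndex d) (HomogIndex d) ℝ →ₗ[ℝ]
    ℝ × ({j : HomogIndex d // j ≠ Sum.inl 0} → ℝ) :=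
  (Matrix.traceLinearMap (HomogIndex d) ℝ ℝ).prod
    { toFun := fun Y j => Y (Sum.inl 0) j
      map_add' := fun _ _ => rfl
      map_smul' := fun _ _ => rfl }

theorem mem_ker_lieEquations {Y : Matrix (HomogIndex d) (HomogIndex d) ℝ} :
    Y ∈ (lieEquations d).ker ↔ Y ∈ projLieAlgebra (stabHyperplane d) := by
  rw [mem_projLieAlgebra_stabHyperplane, LinearMap.mem_ker, Prod.ext_iff, funext_iff]
  exact and_congr Iff.rfl ⟨fun h j hj => h ⟨j, hj⟩, fun h j => h j.1 j.2⟩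

theorem lieEquations_surjective : Function.Surjective (lieEquations d) := by
  rintro ⟨r, w⟩
  -- Row `0` carries the prescribed entries off the diagonal, and the last diagonal entry alone
  -- carries the trace.
  refine ⟨Matrix.of fun i j => if i = Sum.inl 0 then (if h : j ≠ Sum.inl 0 then w ⟨j, h⟩ else 0) else
    if i = Sum.inr () ∧ j = Sum.inr () then r else 0, Prod.ext ?_ ?_⟩
  · change Matrix.trace (n := HomogIndex d) _ = r
    rw [Matrix.trace, Fintype.sum_sum_type, Finset.sum_eq_zero]
    · simp
    · intro i _
      by_cases hi : i = 0
      · subst hi; simp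
      · simp [hi]
  · funext j
    change (if (Sum.inl 0 : HomogIndex d) = Sum.inl 0 then
      (if h : j.1 ≠ Sum.inl 0 then w ⟨j.1, h⟩ else 0) else
      if (Sum.inl 0 : HomogIndex d) = Sum.inr () ∧ j.1 = Sum.inr () then r else 0) = w j
    rw [if_pos rfl, dif_pos j.2]

/-- The count is `(n+1)² - 1 - n = n(n+1)` with `n = d + 1`, which is the dimension of `Q`. -/
theorem finrank_ker_lieEquations : Module.finrank ℝ (lieEquations d).ker = (d + 1) * (d + 2) := by
  have h := (lieEquations d).finrank_range_add_finrank_ker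
  rw [LinearMap.range_eq_top.2 lieEquations_surjective, finrank_top, Module.finrank_prod,
    Module.finrank_self, Module.finrank_fintype_fun_eq_card, Module.finrank_matrix,
    Module.finrank_self] at h
  have h2 : Fintype.card {j : HomogIndex d // j ≠ Sum.inl 0} = d + 1 := by
    rw [Fintype.card_subtype_compl]
    simp
  rw [h2] at h
  simp only [Fintype.card_sum, Fintype.card_fin, Fintype.card_unit] at h
  linarith

/-- Every pair `(B, Υ)` is the derivative of the pairs of a one-parameter subgroup of `H`; if `B`
preserves the hyperplane, the generator lies in the Lie algebra of `G̃`. -/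
theorem exists_generator (b : ProjFiber d) : ∃ X : Matrix (HomogIndex d) (HomogIndex d) ℝ,
    X ∈ projLieAlgebra (isotropyPoint d) ∧
    ((∀ v : Coord d, v 0 = 0 → b.1 v 0 = 0) → IsFlagRow X) ∧
    HasDerivAt (fun t : ℝ => (linPart (expGL (t • X)), covPart (expGL (t • X)))) b 0 := by
  -- With `b = (B, Υ)`, the matrix `m` is `(B, 0; Υ, 0)` plus the identity, because `fiberMatrix`
  -- puts `1` in the last place. The generator is its trace-free part, in which the added identity
  -- cancels.
  let m := fiberMatrix (b.1 + ContinuousLinearMap.id ℝ (Coord d), b.2)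
  let c : ℝ := m.trace / ((d : ℝ) + 2)
  have hd : ((d : ℝ) + 2) ≠ 0 := by positivity
  have hoff : ∀ i j, i ≠ j → (m - c • (1 : Matrix (HomogIndex d) (HomogIndex d) ℝ)) i j = m i j := by
    intro i j hij
    simp [hij]
  refine ⟨m - c • 1, mem_projLieAlgebra_isotropyPoint ?_ fun i => ?_, fun h j hj => ?_, ?_⟩
  · rw [Matrix.trace_sub, Matrix.trace_smul, Matrix.trace_one]
    simp only [Fintype.card_sum, Fintype.card_fin, Fintype.card_unit, c, smul_eq_mul]
    push_cast
    field_simp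
    ring
  · rw [hoff _ _ (by simp)]
    rfl
  · rw [hoff _ _ hj.symm]
    rcases j with j | j
    · have hj' : (0 : Fin (d + 1)) ≠ j := fun h => hj (by rw [h])
      have h0 : (basisVec j : Coord d) 0 = 0 := by simp [basisVec, hj']
      change (b.1 (basisVec j) + basisVec j) 0 = 0
      rw [PiLp.add_apply, h _ h0, h0, add_zero]
    · rfl
  · simp only [← normalizedBlocks_eq]
    set X := m - c • (1 : Matrix (HomogIndex d) (HomogIndex d) ℝ) with hX
    have he := hasDerivAt_exp_entries X
    have h0 : (fun i j => expGL ((0 : ℝ) • X) i j) =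
        fun i j => (1 : Matrix (HomogIndex d) (HomogIndex d) ℝ) i j := by
      rw [expGL_zero_smul]; rfl
    have hn : expGL ((0 : ℝ) • X) (Sum.inr ()) (Sum.inr ()) = 1 := by
      rw [expGL_zero_smul]; simp
    have hnn := hasDerivAt_pi.1 (hasDerivAt_pi.1 he (Sum.inr ())) (Sum.inr ())
    have hB : HasDerivAt (fun t : ℝ => (linBlock d fun i j => expGL (t • X) i j,
        covBlock d fun i j => expGL (t • X) i j))
        (linBlock d fun i j => X i j, covBlock d fun i j => X i j) 0 :=
      ((linBlock d).prod (covBlock d)).hasFDerivAt.comp_hasDerivAt (0 : ℝ) he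
    -- At `t = 0` the quotient rule gives the blocks of `X` minus the last diagonal entry of `X`
    -- times `(1, 0)`. In the linear block this is `B + 1 - c - (1 - c) = B`.
    have key := (hnn.inv (by rw [hn]; exact one_ne_zero)).smul hB
    have hone : ((linBlock d fun i j => (1 : Matrix (HomogIndex d) (HomogIndex d) ℝ) i j),
        (covBlock d fun i j => (1 : Matrix (HomogIndex d) (HomogIndex d) ℝ) i j)) =
        (ContinuousLinearMap.id ℝ (Coord d), (0 : Coord d →L[ℝ] ℝ)) := by
      have h1 := normalizedBlocks_eq (1 : GL (HomogIndex d) ℝ)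
      rw [blocks_one, normalizedBlocks] at h1
      simpa using h1
    have hm : ((linBlock d fun i j => m i j), (covBlock d fun i j => m i j)) =
        (b.1 + ContinuousLinearMap.id ℝ (Coord d), b.2) := by
      have h1 := normalizedBlocks_fiberMatrix (b.1 + ContinuousLinearMap.id ℝ (Coord d), b.2)
      rw [normalizedBlocks] at h1
      simpa [fiberMatrix, m] using h1
    have hXm : ((linBlock d fun i j => X i j), (covBlock d fun i j => X i j)) =
        (b.1 + ContinuousLinearMap.id ℝ (Coord d), b.2) -
          c • (ContinuousLinearMap.id ℝ (Coord d), (0 : Coord d →L[ℝ] ℝ)) := by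
      rw [← hm, ← hone]
      have : (fun i j => X i j) = (fun i j => m i j) -
          c • fun i j => (1 : Matrix (HomogIndex d) (HomogIndex d) ℝ) i j := rfl
      rw [this, map_sub, map_sub, map_smul, map_smul]
      rfl
    have hXn : X (Sum.inr ()) (Sum.inr ()) = 1 - c := by
      simp [hX, m, fiberMatrix]
    refine key.congr_deriv ?_
    rw [hXm, hXn]
    have h00 : ((linBlock d fun i j => expGL ((0 : ℝ) • X) i j),
        (covBlock d fun i j => expGL ((0 : ℝ) • X) i j)) =
        (ContinuousLinearMap.id ℝ (Coord d), (0 : Coord d →L[ℝ] ℝ)) := by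
      rw [h0]; exact hone
    rw [h00, hn, Pi.inv_apply, hn, inv_one]
    refine Prod.ext ?_ ?_ <;> ext v <;> simp
    ring

end LieAlgebras

/-- Turns linear equations satisfied along a map, such as those defining `Q`, into equations on its
differential. -/
theorem clm_mfderiv_eq_zero {E H N F : Type*} [NormedAddCommGroup E] [NormedSpace ℝ E]
    [TopologicalSpace H] [TopologicalSpace N] [ChartedSpace H N] [NormedAddCommGroup F]
    [NormedSpace ℝ F] {I : ModelWithCorners ℝ E H} {f : N → F} {y : N}
    (hf : MDifferentiableAt I 𝓘(ℝ, F) f y) (l : F →L[ℝ] ℝ) (h : ∀ᶠ z in 𝓝 y, l (f z) = 0)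
    (w : TangentSpace I y) : l (mfderiv I 𝓘(ℝ, F) f y w : F) = 0 := by
  have h1 := (l.hasFDerivAt (x := f y)).hasMFDerivAt.comp y hf.hasMFDerivAt
  have h2 : HasMFDerivAt I 𝓘(ℝ, ℝ) (l ∘ f) y (0 : TangentSpace I y →L[ℝ] ℝ) :=
    (hasMFDerivAt_const (0 : ℝ) y).congr_of_eventuallyEq h
  exact DFunLike.congr_fun (hasMFDerivAt_unique h1 h2) w

/-! ### Tangent vectors of `P` in coordinates -/

section Derivatives

variable {d : ℕ} {M : Type*} [TopologicalSpace M] [ChartedSpace (EuclideanHalfSpace (d + 1)) M]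
  [IsManifold (𝓡∂ (d + 1)) ∞ M]

/-- The components of a tangent vector in the chart `e` are given by the derivative of `e`. -/
theorem mfderiv_extend (e : atlas (EuclideanHalfSpace (d + 1)) M) {x : M} (hx : x ∈ e.1.source)
    (v : TangentSpace (𝓡∂ (d + 1)) x) :
    (mfderiv (𝓡∂ (d + 1)) 𝓘(ℝ, Coord d) (e.1.extend (𝓡∂ (d + 1))) x v : Coord d) =
      chartComponents e x v := by
  have h : MDifferentiableAt (𝓡∂ (d + 1)) 𝓘(ℝ, Coord d) (e.1.extend (𝓡∂ (d + 1))) x :=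
    (e.1.contMDiffAt_extend (n := ∞) (IsManifold.subset_maximalAtlas e.2) hx).mdifferentiableAt
      (by simp)
  rw [h.mfderiv]
  rfl

/-- The derivative of the parametrization `(x, a) ↦ pointOf e p₀ x a` of `P`. -/
def pointDeriv (e : atlas (EuclideanHalfSpace (d + 1)) M) (p₀ : projBundle d M) (x : M)
    (a : ProjFiber d) : Coord d × ProjFiber d →L[ℝ] Coord d × ProjFiber d :=
  mfderiv ((𝓡∂ (d + 1)).prod 𝓘(ℝ, ProjFiber d)) ((𝓡∂ (d + 1)).prod 𝓘(ℝ, ProjFiber d))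
    (fun z : M × ProjFiber d => pointOf e p₀ z.1 z.2) (x, a)

variable {EN : Type*} [NormedAddCommGroup EN] [NormedSpace ℝ EN] {HN : Type*} [TopologicalSpace HN]
  {I : ModelWithCorners ℝ EN HN} {N : Type*} [TopologicalSpace N] [ChartedSpace HN N]

/-- Tangent vectors coming from sections, from vertical curves and from `Q` all become values of one
linear map at coordinate pairs, and can then be compared and added. Only the linearity of
`pointDeriv` matters later; it is never computed. -/
theorem mfderiv_eq_pointDeriv {e : atlas (EuclideanHalfSpace (d + 1)) M} (p₀ : projBundle d M)
    {f : N → projBundle d M} {y : N} (hs : baseOf (f y) ∈ e.1.source)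
    (hb : MDifferentiableAt I (𝓡∂ (d + 1)) (fun z => baseOf (f z)) y)
    (hc : MDifferentiableAt I 𝓘(ℝ, ProjFiber d) (fun z => coordsIn e (f z)) y)
    (w : TangentSpace I y) :
    (mfderiv I ((𝓡∂ (d + 1)).prod 𝓘(ℝ, ProjFiber d)) f y w : Coord d × ProjFiber d) =
      pointDeriv e p₀ (baseOf (f y)) (coordsIn e (f y))
        ((mfderiv I (𝓡∂ (d + 1)) (fun z => baseOf (f z)) y w : Coord d),
          (mfderiv I 𝓘(ℝ, ProjFiber d) (fun z => coordsIn e (f z)) y w : ProjFiber d)) := by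
  have hG : MDifferentiableAt ((𝓡∂ (d + 1)).prod 𝓘(ℝ, ProjFiber d))
      ((𝓡∂ (d + 1)).prod 𝓘(ℝ, ProjFiber d))
      (fun z : M × ProjFiber d => pointOf e p₀ z.1 z.2) (baseOf (f y), coordsIn e (f y)) :=
    ContMDiffAt.mdifferentiableAt (n := ∞) (contMDiffWithinAt_pointOf contMDiffAt_fst
      contMDiffAt_snd hs (isUnit_coordsIn hs)) (by simp)
  have h1 := hG.hasMFDerivAt.comp y (hb.hasMFDerivAt.prodMk hc.hasMFDerivAt)
  have h2 : f =ᶠ[𝓝 y] (fun z : M × ProjFiber d => pointOf e p₀ z.1 z.2) ∘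
      fun z => (baseOf (f z), coordsIn e (f z)) := by
    filter_upwards [hb.continuousAt.eventually (e.1.open_source.mem_nhds hs)] with z hz
    exact (pointOf_coordsIn hz).symm
  rw [h2.mfderiv_eq, h1.mfderiv]
  rfl

/-- All tangent spaces are the same model space by definition, so a vector can be carried along an
equality of base points without a cast. -/
theorem matrixForm_congr (omega : MatrixForm d M) {p p' : projBundle d M} (h : p = p')
    (v : Coord d × ProjFiber d) :
    omega p (show TangentSpace (projModel d) p from v) =
      omega p' (show TangentSpace (projModel d) p' from v) := by
  subst h; rfl

end Derivatives

/-! ### Canonical sections and the normal gauge at the boundary -/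

section CanonicalSection

variable {d : ℕ} {M : Type*} [TopologicalSpace M] [ChartedSpace (EuclideanHalfSpace (d + 1)) M]
  [IsManifold (𝓡∂ (d + 1)) ∞ M]

/-- The one-form `α^l_l / (n + 1)`. -/
def connTraceForm (nabla : AffineConnection d M) (e : atlas (EuclideanHalfSpace (d + 1)) M)
    (x : M) : Coord d →L[ℝ] ℝ :=
  ∑ j, connTrace nabla e x (basisVec j) • (EuclideanSpace.proj j : Coord d →L[ℝ] ℝ)

theorem connForm_eq (nabla : AffineConnection d M) (e : atlas (EuclideanHalfSpace (d + 1)) M)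
    (x : M) (w : Coord d) : ∃ L : Coord d →L[ℝ] Coord d, ∀ v, connForm nabla e x w v = L v :=
  ⟨(chartComponents e x).comp ((nabla (chartField e w) x).comp
    ((tangentBundleCore (𝓡∂ (d + 1)) M).coordChange e (achart (EuclideanHalfSpace (d + 1)) x) x)),
    fun _ => rfl⟩

theorem connTraceForm_apply (nabla : AffineConnection d M)
    (e : atlas (EuclideanHalfSpace (d + 1)) M) (x : M) (v : Coord d) :
    connTraceForm nabla e x v = connTrace nabla e x v := by
  choose L hL using connForm_eq nabla e x
  have h : ∀ v, connTrace nabla e x v = ((1 / ((d : ℝ) + 2)) • ∑ l,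
      (EuclideanSpace.proj l : Coord d →L[ℝ] ℝ).comp (L (basisVec l))) v := by
    intro v
    simp [connTrace, connEntry, hL]
  rw [connTraceForm, sum_apply, h v, clm_apply_eq_sum]
  exact Finset.sum_congr rfl fun j _ => by rw [← h]; exact mul_comm _ _

theorem contMDiffAt_connTraceForm {k : WithTop ℕ∞} {nabla : AffineConnection d M}
    (hn : IsRegularTorsionFree k nabla) (e : atlas (EuclideanHalfSpace (d + 1)) M) {x : M}
    (hx : x ∈ e.1.source) :
    ContMDiffAt (𝓡∂ (d + 1)) 𝓘(ℝ, Coord d →L[ℝ] ℝ) k (connTraceForm nabla e) x := by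
  have h1 : ∀ w v, ContMDiffAt (𝓡∂ (d + 1)) 𝓘(ℝ, Coord d) k (fun y => connForm nabla e y w v) x :=
    fun w v => (hn.contMDiffOn e w v).contMDiffAt (e.1.open_source.mem_nhds hx)
  have h2 : ∀ w v i, ContMDiffAt (𝓡∂ (d + 1)) 𝓘(ℝ, ℝ) k (fun y => connForm nabla e y w v i) x :=
    fun w v i => ((EuclideanSpace.proj i : Coord d →L[ℝ] ℝ).contDiff.contMDiff.contMDiffAt.comp x
      (h1 w v))
  have h3 : ContDiff ℝ k fun c : Fin (d + 1) → Fin (d + 1) → ℝ => ∑ j,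
      ((1 / ((d : ℝ) + 2)) * ∑ l, c j l) • (EuclideanSpace.proj j : Coord d →L[ℝ] ℝ) := by
    fun_prop
  have h4 : ContMDiffAt (𝓡∂ (d + 1)) 𝓘(ℝ, Fin (d + 1) → Fin (d + 1) → ℝ) k
      (fun y j l => connForm nabla e y (basisVec l) (basisVec j) l) x :=
    contMDiffAt_pi_space.2 fun j => contMDiffAt_pi_space.2 fun l => h2 _ _ _
  exact h3.contMDiff.contMDiffAt.comp x h4

/-- For `A = 1` the choice `Υ = α^l_l / (n+1)` cancels the trace terms by which the Thomas symbols
differ from the Christoffel symbols. This exhibits a section to which the gauge condition on `ω`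
applies. -/
theorem isCanonicalSection_pointOf (nabla : AffineConnection d M)
    (e : atlas (EuclideanHalfSpace (d + 1)) M) (p₀ : projBundle d M) :
    IsCanonicalSection nabla e fun x =>
      pointOf e p₀ x (ContinuousLinearMap.id ℝ (Coord d), connTraceForm nabla e x) := by
  intro x hx
  have hid : IsUnit (ContinuousLinearMap.id ℝ (Coord d)) := isUnit_one
  have hb := baseOf_pointOf (p₀ := p₀)
    (a := (ContinuousLinearMap.id ℝ (Coord d), connTraceForm nabla e x)) hx hid
  have hc := coordsIn_pointOf (p₀ := p₀)
    (a := (ContinuousLinearMap.id ℝ (Coord d), connTraceForm nabla e x)) hx hid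
  refine ⟨hb, congrArg Prod.fst hc, fun w v => ?_⟩
  rw [secondOrderPart, hb, hc]
  simp only [ContinuousLinearMap.id_apply, thomas, connTraceForm_apply]
  module

/-- Canonical sections take values in `Q` at the boundary. -/
theorem canonicalSection_mem_boundaryReduction {nabla : AffineConnection d M}
    {e : atlas (EuclideanHalfSpace (d + 1)) M} {sigma : M → projBundle d M}
    (h : IsCanonicalSection nabla e sigma) {x : M} (hx : x ∈ e.1.source)
    (hb : x ∈ (𝓡∂ (d + 1)).boundary M) : sigma x ∈ boundaryReduction d M := by
  obtain ⟨h1, h2, -⟩ := h x hx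
  rw [mem_boundaryReduction_iff (e := e) (by rwa [h1]), h1, h2]
  exact ⟨hb, fun v hv => hv⟩

/-- Here the span condition is used: `α⁰_μ(v)` is a multiple of `dr(v) = 0`. The trace correction
sits on the diagonal, and the entry in the last column is `dx⁰(v) = 0`. -/
theorem isFlagRow_normalGauge {nabla : AffineConnection d M}
    {e : atlas (EuclideanHalfSpace (d + 1)) M} {x : M} (h : SpanCondition nabla e x) {v : Coord d}
    (hv : v 0 = 0) : IsFlagRow (normalGauge nabla e x v) := by
  rintro (j | j) hj
  · have hj0 : j ≠ 0 := fun h => hj (by rw [h])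
    obtain ⟨mu, rfl⟩ := Fin.exists_succ_eq.2 hj0
    obtain ⟨c, hc⟩ := Submodule.mem_span_singleton.1 (h mu)
    change connEntry nabla e x 0 mu.succ v - (if 0 = mu.succ then connTrace nabla e x v else 0) = 0
    rw [← hc, if_neg hj0.symm]
    simp [hv]
  · exact hv

end CanonicalSection

/-! ### The normal Cartan connection on vectors tangent to `Q` -/

section Connection

variable {d : ℕ} {M : Type*} [TopologicalSpace M] [ChartedSpace (EuclideanHalfSpace (d + 1)) M]
  [IsManifold (𝓡∂ (d + 1)) ∞ M]

theorem coordsIn_projAct_expGL (e : atlas (EuclideanHalfSpace (d + 1)) M) (p : projBundle d M)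
    {X : Matrix (HomogIndex d) (HomogIndex d) ℝ} (hX : X ∈ projLieAlgebra (isotropyPoint d)) (t : ℝ) :
    coordsIn e (projAct p ⟨Matrix.ProjGenLinGroup.mk (expGL (t • X)), hX.2 t⟩) =
      fiberMul (coordsIn e p) (linPart (expGL (t • X)), covPart (expGL (t • X))) :=
  coordsIn_projAct_mk e p _ _

theorem projAct_expGL_zero (p : projBundle d M)
    {X : Matrix (HomogIndex d) (HomogIndex d) ℝ} (hX : X ∈ projLieAlgebra (isotropyPoint d)) :
    projAct p ⟨Matrix.ProjGenLinGroup.mk (expGL ((0 : ℝ) • X)), hX.2 0⟩ = p := by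
  have h : (⟨Matrix.ProjGenLinGroup.mk (expGL ((0 : ℝ) • X)), hX.2 0⟩ : isotropyPoint d) = 1 := by
    apply Subtype.ext
    change Matrix.ProjGenLinGroup.mk (expGL ((0 : ℝ) • X)) = 1
    rw [expGL_zero_smul, map_one]
  rw [h, projAct_one]

theorem contMDiffAt_projAct_expGL {k : WithTop ℕ∞} [(projCore d M).IsContMDiff (𝓡∂ (d + 1)) k]
    (p : projBundle d M) {X : Matrix (HomogIndex d) (HomogIndex d) ℝ}
    (hX : X ∈ projLieAlgebra (isotropyPoint d)) (t : ℝ) :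
    ContMDiffAt 𝓘(ℝ, ℝ) ((𝓡∂ (d + 1)).prod 𝓘(ℝ, ProjFiber d)) k
      (fun t : ℝ => projAct p ⟨Matrix.ProjGenLinGroup.mk (expGL (t • X)), hX.2 t⟩) t := by
  refine (contMDiffAt_projBundle_iff (e := achart (EuclideanHalfSpace (d + 1)) (baseOf p))
    (by rw [baseOf_projAct]; exact mem_chart_source _ _)).2 ⟨?_, ?_⟩
  · exact contMDiffAt_const (c := baseOf p)
  · rw [funext (coordsIn_projAct_expGL _ p hX)]
    simp only [← normalizedBlocks_eq]
    have h1 : ContDiffAt ℝ k (fun t : ℝ => normalizedBlocks fun i j => expGL (t • X) i j) t :=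
      (contDiffAt_normalizedBlocks (isUnit_of_mem_isotropyPoint (hX.2 t)).1).comp t
        (contDiff_exp_entries X).contDiffAt
    exact (contDiff_fiberMul.contDiffAt.comp t (contDiffAt_const.prodMk h1)).contMDiffAt

/-- The vertical tangent vectors of `P`, in terms of fundamental vector fields. -/
theorem matrixForm_vertical {omega : MatrixForm d M} {k : WithTop ℕ∞}
    (homega : IsCartanConnection (projModel d) k ⊤ (isotropyPoint d) projAct omega)
    {e : atlas (EuclideanHalfSpace (d + 1)) M} (p : projBundle d M) (hs : baseOf p ∈ e.1.source)
    {X : Matrix (HomogIndex d) (HomogIndex d) ℝ} (hX : X ∈ projLieAlgebra (isotropyPoint d))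
    {b : ProjFiber d}
    (hb : HasDerivAt (fun t : ℝ => (linPart (expGL (t • X)), covPart (expGL (t • X)))) b 0) :
    omega p (show TangentSpace (projModel d) p from
      pointDeriv e p (baseOf p) (coordsIn e p) (0, fiberMul (coordsIn e p) b)) = X := by
  set c : ℝ → projBundle d M :=
    fun t : ℝ => projAct p ⟨Matrix.ProjGenLinGroup.mk (expGL (t • X)), hX.2 t⟩
  have hc0 : c 0 = p := projAct_expGL_zero p hX
  have hbase : (fun t => baseOf (c t)) = fun _ => baseOf p := rfl
  have h1 : HasMFDerivAt 𝓘(ℝ, ℝ) (𝓡∂ (d + 1)) (fun t => baseOf (c t)) 0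
      (0 : TangentSpace 𝓘(ℝ, ℝ) (0 : ℝ) →L[ℝ] TangentSpace (𝓡∂ (d + 1)) (baseOf p)) := by
    rw [hbase]
    exact hasMFDerivAt_const _ _
  -- Left multiplication is linear in the second pair, so the velocity of `a·exp(tX)` in coordinates
  -- is `fiberMul a b`.
  have h2 : HasDerivAt (fun t => coordsIn e (c t)) (fiberMul (coordsIn e p) b) 0 := by
    have h3 : (fun t => coordsIn e (c t)) = fun t =>
        leftTranslate (coordsIn e p).1 (coordsIn e p).2
          (linPart (expGL (t • X)), covPart (expGL (t • X))) :=
      funext fun t => coordsIn_projAct_expGL e p hX t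
    rw [h3]
    exact (leftTranslate (coordsIn e p).1 (coordsIn e p).2).hasFDerivAt.comp_hasDerivAt (0 : ℝ) hb
  have h4 := h2.hasFDerivAt.hasMFDerivAt
  have h5 := mfderiv_eq_pointDeriv (I := 𝓘(ℝ, ℝ)) p (f := c) (y := 0)
    (by rw [hc0]; exact hs) h1.mdifferentiableAt h4.mdifferentiableAt (1 : ℝ)
  rw [h1.mfderiv, h4.mfderiv, hc0] at h5
  have h6 := homega.fundamental X hX p
  refine Eq.trans ?_ h6
  -- The property `fundamental` is stated at `p·exp(0·X)`, which equals `p` but not by definition;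
  -- hence the transport.
  refine (matrixForm_congr omega hc0.symm _).trans (congrArg (omega (c 0)) ?_)
  refine Eq.trans ?_ h5.symm
  refine congrArg (pointDeriv e p (baseOf p) (coordsIn e p)) (Prod.ext rfl ?_)
  change _ = (1 : ℝ) • fiberMul (coordsIn e p) b
  rw [one_smul]

/-- The linear functional `(A, Υ) ↦ (A u)⁰`. -/
def rowFunctional (u : Coord d) : ProjFiber d →L[ℝ] ℝ :=
  ((EuclideanSpace.proj 0 : Coord d →L[ℝ] ℝ).comp
    (ContinuousLinearMap.apply ℝ (Coord d) u)).comp (ContinuousLinearMap.fst ℝ _ _)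

/-- The normal Cartan connection on the tangent vectors of translates, by elements of `H̃`, of
canonical sections. -/
theorem exists_isFlagRow_horizontal {k : WithTop ℕ∞} (hk : k ≠ 0) {S : ProjectiveStructure d k M}
    {omega : MatrixForm d M} (homega : IsNormalCartanConnection S omega)
    {nabla : AffineConnection d M} (hn : nabla ∈ S.connections)
    {e : atlas (EuclideanHalfSpace (d + 1)) M} {p : projBundle d M}
    (hs : baseOf p ∈ e.1.source) (hpres : ∀ u : Coord d, u 0 = 0 → (coordsIn e p).1 u 0 = 0)
    (hspan : SpanCondition nabla e (baseOf p)) (v : TangentSpace (𝓡∂ (d + 1)) (baseOf p))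
    (hv0 : (chartComponents e (baseOf p) v) 0 = 0) :
    ∃ S' : ProjFiber d, (∀ u : Coord d, u 0 = 0 → S'.1 u 0 = 0) ∧
      IsFlagRow (omega p (show TangentSpace (projModel d) p from
        pointDeriv e p (baseOf p) (coordsIn e p) ((show Coord d from v), S'))) := by
  have hu := isUnit_coordsIn hs
  have hid : IsUnit (ContinuousLinearMap.id ℝ (Coord d)) := isUnit_one
  let ct := connTraceForm nabla e
  have hct : MDifferentiableAt (𝓡∂ (d + 1)) 𝓘(ℝ, Coord d →L[ℝ] ℝ) ct (baseOf p) :=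
    (contMDiffAt_connTraceForm (S.regular nabla hn) e hs).mdifferentiableAt hk
  -- Solves `(1, τ)·b = (A, Υ)`, where `(1, τ)` is the canonical section at `baseOf p` and `(A, Υ)`
  -- are the coordinates of `p`.
  let b := fiberGL ((coordsIn e p).1, (coordsIn e p).2 - (ct (baseOf p)).comp (coordsIn e p).1) hu
  have hbf : Matrix.ProjGenLinGroup.mk b ∈ isotropyFlag d := fiberGL_mem_isotropyFlag _ _ hpres
  have hb1 : linPart b = (coordsIn e p).1 := linPart_fiberGL _ _
  have hb2 : covPart b = (coordsIn e p).2 - (ct (baseOf p)).comp (coordsIn e p).1 :=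
    covPart_fiberGL _ _
  let sigma : M → projBundle d M := fun y => pointOf e p y (ContinuousLinearMap.id ℝ (Coord d), ct y)
  have hsigma : IsCanonicalSection nabla e sigma := isCanonicalSection_pointOf nabla e p
  have hsc : ∀ y ∈ e.1.source, coordsIn e (sigma y) = (ContinuousLinearMap.id ℝ (Coord d), ct y) :=
    fun y hy => coordsIn_pointOf hy hid
  have hsb : ∀ y ∈ e.1.source, baseOf (sigma y) = y := fun y hy => (hsigma y hy).1
  have hsrc : ∀ᶠ y in 𝓝 (baseOf p), y ∈ e.1.source := e.1.open_source.mem_nhds hs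
  let R : projBundle d M → projBundle d M := fun p => projAct p ⟨Matrix.ProjGenLinGroup.mk b, hbf.2⟩
  have hR : ∀ p, MDifferentiableAt (projModel d) (projModel d) R p := fun p =>
    (contMDiff_projAct (k := ∞) _ p).mdifferentiableAt (by simp)
  have hsigma_diff : MDifferentiableAt (𝓡∂ (d + 1)) (projModel d) sigma (baseOf p) := by
    have h1 : MDifferentiableAt ((𝓡∂ (d + 1)).prod 𝓘(ℝ, ProjFiber d)) (projModel d)
        (fun z : M × ProjFiber d => pointOf e p z.1 z.2)
        (baseOf p, (ContinuousLinearMap.id ℝ (Coord d), ct (baseOf p))) :=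
      ContMDiffAt.mdifferentiableAt (n := ∞) (contMDiffWithinAt_pointOf contMDiffAt_fst
        contMDiffAt_snd hs hid) (by simp)
    exact h1.comp (baseOf p) (mdifferentiableAt_id.prodMk (mdifferentiableAt_const.prodMk_space hct))
  have hSp : R (sigma (baseOf p)) = p := by
    refine coordsIn_ext (e := e) ?_ ?_ ?_
    · rw [baseOf_projAct, hsb (baseOf p) hs]; exact hs
    · rw [baseOf_projAct, hsb (baseOf p) hs]
    · rw [coordsIn_projAct_mk, hsc (baseOf p) hs, hb1, hb2, fiberMul_eq]
      refine Prod.ext rfl ?_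
      change (ct (baseOf p)).comp (coordsIn e p).1 +
        ((coordsIn e p).2 - (ct (baseOf p)).comp (coordsIn e p).1) = (coordsIn e p).2
      abel
  let Sg : M → projBundle d M := fun y => R (sigma y)
  have hSg : MDifferentiableAt (𝓡∂ (d + 1)) (projModel d) Sg (baseOf p) :=
    (hR _).comp (baseOf p) hsigma_diff
  have hSs : baseOf (Sg (baseOf p)) ∈ e.1.source := by
    change baseOf (R (sigma (baseOf p))) ∈ _
    rw [hSp]; exact hs
  have hSb : (fun y => baseOf (Sg y)) =ᶠ[𝓝 (baseOf p)] id := hsrc.mono hsb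
  have hSbd : MDifferentiableAt (𝓡∂ (d + 1)) (𝓡∂ (d + 1)) (fun y => baseOf (Sg y)) (baseOf p) :=
    mdifferentiableAt_id.congr_of_eventuallyEq hSb
  have hSc : MDifferentiableAt (𝓡∂ (d + 1)) 𝓘(ℝ, ProjFiber d) (fun y => coordsIn e (Sg y))
      (baseOf p) :=
    ((contMDiffAt_coordsIn (k := ∞) hSs).mdifferentiableAt (by simp)).comp (baseOf p) hSg
  let S' : ProjFiber d := mfderiv (𝓡∂ (d + 1)) 𝓘(ℝ, ProjFiber d) (fun y => coordsIn e (Sg y))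
    (baseOf p) v
  have E2 : (mfderiv (𝓡∂ (d + 1)) (projModel d) Sg (baseOf p) v : Coord d × ProjFiber d) =
      pointDeriv e p (baseOf p) (coordsIn e p) (v, S') := by
    refine (mfderiv_eq_pointDeriv p hSs hSbd hSc v).trans ?_
    have h1 : Sg (baseOf p) = p := hSp
    rw [h1, hSb.mfderiv_eq, mfderiv_id]
    rfl
  refine ⟨S', fun u hu0 => ?_, ?_⟩
  -- The translated section has the constant frame `linPart b` throughout the chart. So `A⁰_μ = 0`
  -- along it also away from the boundary, and the equation can be differentiated in `M`.
  · exact clm_mfderiv_eq_zero hSc (rowFunctional u) (hsrc.mono fun y hy => by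
      change (coordsIn e (projAct (sigma y) ⟨Matrix.ProjGenLinGroup.mk b, hbf.2⟩)).1 u 0 = 0
      rw [coordsIn_projAct_mk, hsc y hy, hb1]
      exact hpres u hu0) v
  · have h1 : omega p (show TangentSpace (projModel d) p from
          pointDeriv e p (baseOf p) (coordsIn e p) (v, S')) =
        omega (Sg (baseOf p)) (mfderiv (𝓡∂ (d + 1)) (projModel d) Sg (baseOf p) v) := by
      rw [← E2]
      exact matrixForm_congr omega hSp.symm _
    have h2 : mfderiv (𝓡∂ (d + 1)) (projModel d) Sg (baseOf p) v =
        mfderiv (projModel d) (projModel d) R (sigma (baseOf p))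
          (mfderiv (𝓡∂ (d + 1)) (projModel d) sigma (baseOf p) v) :=
      mfderiv_comp_apply (baseOf p) (hR _) hsigma_diff v
    have h3 := homega.connection.equivariant b hbf.2 (sigma (baseOf p))
      (mfderiv (𝓡∂ (d + 1)) (projModel d) sigma (baseOf p) v)
    rw [homega.gauge nabla hn e sigma hsigma (baseOf p) hs v] at h3
    have hbinv : IsFlagRow ((b⁻¹ : GL (HomogIndex d) ℝ) : Matrix (HomogIndex d) (HomogIndex d) ℝ) :=
      isFlagRow_of_mem (by rw [map_inv]; exact inv_mem hbf.1)
    -- The value is `b⁻¹` times the normal gauge times `b`, and all three factors have a flag row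
    -- since `b ∈ G̃`.
    refine Eq.mpr (congrArg IsFlagRow (h1.trans ((congrArg (omega (Sg (baseOf p))) h2).trans h3))) ?_
    exact (hbinv.mul (isFlagRow_normalGauge hspan hv0)).mul (isFlagRow_of_mem hbf.1)

/-- Subtracting the vector of `exists_isFlagRow_horizontal` over the same `v` leaves a vertical
vector `a·β`. Both fibre parts preserve `{v⁰ = 0}`, hence so does `β`, and its generator has a flag
row. -/
theorem isFlagRow_pointDeriv {k : WithTop ℕ∞} (hk : k ≠ 0) {S : ProjectiveStructure d k M}
    {omega : MatrixForm d M} (homega : IsNormalCartanConnection S omega)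
    {nabla : AffineConnection d M} (hn : nabla ∈ S.connections)
    {e : atlas (EuclideanHalfSpace (d + 1)) M} {p : projBundle d M}
    (hs : baseOf p ∈ e.1.source) (hpres : ∀ u : Coord d, u 0 = 0 → (coordsIn e p).1 u 0 = 0)
    (hspan : SpanCondition nabla e (baseOf p)) (v : TangentSpace (𝓡∂ (d + 1)) (baseOf p))
    (hv0 : (chartComponents e (baseOf p) v) 0 = 0) (A' : ProjFiber d)
    (hA' : ∀ u : Coord d, u 0 = 0 → A'.1 u 0 = 0) :
    IsFlagRow (omega p (show TangentSpace (projModel d) p from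
      pointDeriv e p (baseOf p) (coordsIn e p) ((show Coord d from v), A'))) := by
  have hu := isUnit_coordsIn hs
  obtain ⟨S', hS', hhor⟩ := exists_isFlagRow_horizontal hk homega hn hs hpres hspan v hv0
  obtain ⟨beta, -, hbeta⟩ := exists_fiberMul_eq (c := A' - S') hu
  obtain ⟨X, hX, hXrow, hXder⟩ := exists_generator beta
  have hvert := matrixForm_vertical homega.connection p hs hX hXder
  have hXr : IsFlagRow X := by
    refine hXrow fun u hu0 => (apply_zero_iff hu hpres).1 ?_
    have h1 : (coordsIn e p).1 (beta.1 u) = A'.1 u - S'.1 u :=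
      congrArg (fun c : ProjFiber d => c.1 u) hbeta
    rw [h1, PiLp.sub_apply, hA' u hu0, hS' u hu0, sub_zero]
  have hsplit : ((show Coord d from v), A') =
      ((show Coord d from v), S') + ((0 : Coord d), fiberMul (coordsIn e p) beta) := by
    rw [hbeta]
    refine Prod.ext ?_ ?_
    · exact (add_zero _).symm
    · exact (add_sub_cancel S' A').symm
  have htotal : omega p (show TangentSpace (projModel d) p from
        pointDeriv e p (baseOf p) (coordsIn e p) ((show Coord d from v), A')) =
      omega p (show TangentSpace (projModel d) p from
        pointDeriv e p (baseOf p) (coordsIn e p) ((show Coord d from v), S')) + X := by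
    rw [← hvert]
    refine Eq.trans (congrArg (omega p) ?_) (map_add (omega p) _ _)
    refine Eq.trans ?_ (map_add (pointDeriv e p (baseOf p) (coordsIn e p)) _ _)
    exact congrArg (pointDeriv e p (baseOf p) (coordsIn e p)) hsplit
  exact Eq.mpr (congrArg IsFlagRow htotal) (hhor.add hXr)

/-- The pullback of the normal Cartan connection to `Q` takes values in matrices with vanishing
entries `(0, j)`, `j ≠ 0`. -/
theorem isFlagRow_pullback {k : WithTop ℕ∞} (hk : k ≠ 0) {S : ProjectiveStructure d k M}
    {omega : MatrixForm d M} (homega : IsNormalCartanConnection S omega)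
    {nabla : AffineConnection d M} (hn : nabla ∈ S.connections)
    {e : atlas (EuclideanHalfSpace (d + 1)) M} {q : boundaryReduction d M}
    (hs : baseOf q.1 ∈ e.1.source) (hspan : SpanCondition nabla e (baseOf q.1))
    (w : TangentSpace (𝓡 ((d + 1) * (d + 2))) q) :
    IsFlagRow (omega q.1 (mfderiv (𝓡 ((d + 1) * (d + 2))) (projModel d)
      (Subtype.val : boundaryReduction d M → projBundle d M) q w)) := by
  obtain ⟨p, hp⟩ := q
  change baseOf p ∈ e.1.source at hs
  change SpanCondition nabla e (baseOf p) at hspan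
  have hpres := ((mem_boundaryReduction_iff hs).1 hp).2
  have hsrc : ∀ᶠ y in 𝓝 (baseOf p), y ∈ e.1.source := e.1.open_source.mem_nhds hs
  have hval : MDifferentiableAt (𝓡 ((d + 1) * (d + 2))) (projModel d)
      (Subtype.val : boundaryReduction d M → projBundle d M) ⟨p, hp⟩ :=
    (contMDiff_boundaryReduction_val (k := ∞) _).mdifferentiableAt (by simp)
  have hqb : MDifferentiableAt (𝓡 ((d + 1) * (d + 2))) (𝓡∂ (d + 1))
      (fun z : boundaryReduction d M => baseOf z.1) ⟨p, hp⟩ :=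
    MDifferentiableAt.comp (g := baseOf) (f := Subtype.val) (⟨p, hp⟩ : boundaryReduction d M)
      ((contMDiff_baseOf (k := ∞) p).mdifferentiableAt (by simp)) hval
  have hqc : MDifferentiableAt (𝓡 ((d + 1) * (d + 2))) 𝓘(ℝ, ProjFiber d)
      (fun z : boundaryReduction d M => coordsIn e z.1) ⟨p, hp⟩ :=
    MDifferentiableAt.comp (g := coordsIn e) (f := Subtype.val) (⟨p, hp⟩ : boundaryReduction d M)
      ((contMDiffAt_coordsIn (k := ∞) hs).mdifferentiableAt (by simp)) hval
  have hqsrc : ∀ᶠ z : boundaryReduction d M in 𝓝 ⟨p, hp⟩, baseOf z.1 ∈ e.1.source :=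
    hqb.continuousAt.eventually hsrc
  let v : TangentSpace (𝓡∂ (d + 1)) (baseOf p) := mfderiv (𝓡 ((d + 1) * (d + 2))) (𝓡∂ (d + 1))
    (fun z : boundaryReduction d M => baseOf z.1) ⟨p, hp⟩ w
  let A' : ProjFiber d := mfderiv (𝓡 ((d + 1) * (d + 2))) 𝓘(ℝ, ProjFiber d)
    (fun z : boundaryReduction d M => coordsIn e z.1) ⟨p, hp⟩ w
  have E1 := mfderiv_eq_pointDeriv p hs hqb hqc w
  -- The equations `x⁰ = 0` and, in `hA'`, `A⁰_μ = 0` hold identically on `Q` near the point and are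
  -- differentiated along `w`.
  have hv0 : (chartComponents e (baseOf p) v) 0 = 0 := by
    rw [← mfderiv_extend e hs v]
    have hed : MDifferentiableAt (𝓡∂ (d + 1)) 𝓘(ℝ, Coord d) (e.1.extend (𝓡∂ (d + 1))) (baseOf p) :=
      (e.1.contMDiffAt_extend (n := ∞) (IsManifold.subset_maximalAtlas e.2) hs).mdifferentiableAt
        (by simp)
    have h1 := clm_mfderiv_eq_zero (f := e.1.extend (𝓡∂ (d + 1)) ∘
      fun z : boundaryReduction d M => baseOf z.1) (hed.comp (⟨p, hp⟩ : boundaryReduction d M) hqb)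
      (EuclideanSpace.proj 0 : Coord d →L[ℝ] ℝ)
      (hqsrc.mono fun z hz => (mem_boundary_iff e.2 hz).1 z.2.1) w
    have h2 := mfderiv_comp_apply (g := e.1.extend (𝓡∂ (d + 1)))
      (f := fun z : boundaryReduction d M => baseOf z.1) (⟨p, hp⟩ : boundaryReduction d M) hed hqb w
    exact (congrArg (EuclideanSpace.proj 0 : Coord d →L[ℝ] ℝ) h2.symm).trans h1
  have hA' : ∀ u : Coord d, u 0 = 0 → A'.1 u 0 = 0 := fun u hu0 =>
    clm_mfderiv_eq_zero hqc (rowFunctional u) (hqsrc.mono fun z hz =>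
      ((mem_boundaryReduction_iff hz).1 z.2).2 u hu0) w
  exact Eq.mpr (congrArg IsFlagRow (congrArg (omega p) E1))
    (isFlagRow_pointDeriv hk homega hn hs hpres hspan v hv0 A' hA')

end Connection

/-! ### The Cartan connection on `Q` -/

section Main

variable {d : ℕ} {M : Type*} [TopologicalSpace M] [ChartedSpace (EuclideanHalfSpace (d + 1)) M]
  [IsManifold (𝓡∂ (d + 1)) ∞ M]

/-- The restriction of a matrix-valued form on `P` to `Q`. -/
def restrictForm (omega : MatrixForm d M) (q : boundaryReduction d M) :
    TangentSpace (𝓡 ((d + 1) * (d + 2))) q →ₗ[ℝ] Matrix (HomogIndex d) (HomogIndex d) ℝ :=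
  (omega q.1).comp (mfderiv (𝓡 ((d + 1) * (d + 2))) (projModel d)
    (Subtype.val : boundaryReduction d M → projBundle d M) q).toLinearMap

theorem mdifferentiableAt_boundaryReduction_val (q : boundaryReduction d M) :
    MDifferentiableAt (𝓡 ((d + 1) * (d + 2))) (projModel d)
      (Subtype.val : boundaryReduction d M → projBundle d M) q :=
  (contMDiff_boundaryReduction_val (k := ∞) q).mdifferentiableAt (by simp)

/-- The restricted form is `ω` composed with the tangent map of the inclusion, which costs one
derivative; hence `k + 1 ≤ k`. -/
theorem contMDiff_restrictForm {k : WithTop ℕ∞} [IsManifold (𝓡∂ (d + 1)) k M]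
    [(projCore d M).IsContMDiff (𝓡∂ (d + 1)) k] (hk : k + 1 ≤ k) {omega : MatrixForm d M}
    (h : ∀ i j, ContMDiff (projModel d).tangent 𝓘(ℝ, ℝ) k
      (fun v : TangentBundle (projModel d) (projBundle d M) => omega v.1 v.2 i j))
    (i j : HomogIndex d) :
    ContMDiff (𝓡 ((d + 1) * (d + 2))).tangent 𝓘(ℝ, ℝ) k
      (fun v : TangentBundle (𝓡 ((d + 1) * (d + 2))) (boundaryReduction d M) =>
        restrictForm omega v.1 v.2 i j) :=
  (h i j).comp (contMDiff_boundaryReduction_val.contMDiff_tangentMap hk)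

/-- The inclusion of `Q` intertwines the two actions, so the identity on `P` descends by the chain
rule. -/
theorem restrictForm_equivariant {omega : MatrixForm d M} {k : WithTop ℕ∞}
    (homega : IsCartanConnection (projModel d) k ⊤ (isotropyPoint d) projAct omega)
    (b : GL (HomogIndex d) ℝ) (hb : Matrix.ProjGenLinGroup.mk b ∈ isotropyFlag d)
    (q : boundaryReduction d M) (v : TangentSpace (𝓡 ((d + 1) * (d + 2))) q) :
    restrictForm omega (boundaryAct q ⟨Matrix.ProjGenLinGroup.mk b, hb⟩)
        (mfderiv (𝓡 ((d + 1) * (d + 2))) (𝓡 ((d + 1) * (d + 2)))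
          (fun q => boundaryAct q ⟨Matrix.ProjGenLinGroup.mk b, hb⟩) q v) =
      ((b⁻¹ : GL (HomogIndex d) ℝ) : Matrix (HomogIndex d) (HomogIndex d) ℝ) *
        restrictForm omega q v * (b : Matrix (HomogIndex d) (HomogIndex d) ℝ) := by
  have hact : MDifferentiableAt (𝓡 ((d + 1) * (d + 2))) (𝓡 ((d + 1) * (d + 2)))
      (fun q : boundaryReduction d M => boundaryAct q ⟨Matrix.ProjGenLinGroup.mk b, hb⟩) q :=
    (contMDiff_boundaryAct (k := ∞) _ q).mdifferentiableAt (by simp)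
  have hactP : MDifferentiableAt (projModel d) (projModel d)
      (fun p : projBundle d M => projAct p ⟨Matrix.ProjGenLinGroup.mk b, hb.2⟩) q.1 :=
    (contMDiff_projAct (k := ∞) _ q.1).mdifferentiableAt (by simp)
  have h1 := mfderiv_comp_apply (g := (Subtype.val : boundaryReduction d M → projBundle d M))
    (f := fun q : boundaryReduction d M => boundaryAct q ⟨Matrix.ProjGenLinGroup.mk b, hb⟩) q
    (mdifferentiableAt_boundaryReduction_val _) hact v
  have h2 := mfderiv_comp_apply (f := (Subtype.val : boundaryReduction d M → projBundle d M))
    (g := fun p : projBundle d M => projAct p ⟨Matrix.ProjGenLinGroup.mk b, hb.2⟩) q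
    hactP (mdifferentiableAt_boundaryReduction_val _) v
  have h3 := homega.equivariant b hb.2 q.1 (mfderiv (𝓡 ((d + 1) * (d + 2))) (projModel d)
    (Subtype.val : boundaryReduction d M → projBundle d M) q v)
  exact (congrArg (omega (projAct q.1 ⟨Matrix.ProjGenLinGroup.mk b, hb.2⟩))
    (h1.symm.trans h2)).trans h3

theorem restrictForm_fundamental {omega : MatrixForm d M} {k : WithTop ℕ∞}
    (homega : IsCartanConnection (projModel d) k ⊤ (isotropyPoint d) projAct omega)
    (X : Matrix (HomogIndex d) (HomogIndex d) ℝ) (hX : X ∈ projLieAlgebra (isotropyFlag d))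
    (q : boundaryReduction d M) :
    restrictForm omega
      (boundaryAct q ⟨Matrix.ProjGenLinGroup.mk (expGL ((0 : ℝ) • X)), hX.2 0⟩)
      (mfderiv 𝓘(ℝ, ℝ) (𝓡 ((d + 1) * (d + 2)))
        (fun t : ℝ => boundaryAct q ⟨Matrix.ProjGenLinGroup.mk (expGL (t • X)), hX.2 t⟩) 0
        (1 : ℝ)) = X := by
  have hX' : X ∈ projLieAlgebra (isotropyPoint d) := ⟨hX.1, fun t => (hX.2 t).2⟩
  have hcurve : MDifferentiableAt 𝓘(ℝ, ℝ) (𝓡 ((d + 1) * (d + 2)))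
      (fun t : ℝ => boundaryAct q ⟨Matrix.ProjGenLinGroup.mk (expGL (t • X)), hX.2 t⟩) 0 :=
    ContMDiffAt.mdifferentiableAt (n := ∞)
      (contMDiffWithinAt_boundaryReduction (contMDiffAt_projAct_expGL q.1 hX' 0)) (by simp)
  have h1 := mfderiv_comp_apply (g := (Subtype.val : boundaryReduction d M → projBundle d M))
    (f := fun t : ℝ => boundaryAct q ⟨Matrix.ProjGenLinGroup.mk (expGL (t • X)), hX.2 t⟩) 0
    (mdifferentiableAt_boundaryReduction_val _) hcurve (1 : ℝ)
  exact (congrArg (omega (projAct q.1 ⟨Matrix.ProjGenLinGroup.mk (expGL ((0 : ℝ) • X)), hX'.2 0⟩))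
    h1.symm).trans (homega.fundamental X hX' q.1)

/-- Values lie in `g̃` by `isFlagRow_pullback`. Injectivity comes from that of `ω` on `T_pP` and of
the differential of the inclusion. Surjectivity follows because both dimensions are `n(n+1)`. -/
theorem restrictForm_bijOn {k : WithTop ℕ∞} (hk : k ≠ 0) {S : ProjectiveStructure d k M}
    {omega : MatrixForm d M} (homega : IsNormalCartanConnection S omega)
    (hspan : ∀ x ∈ (𝓡∂ (d + 1)).boundary M, ∃ nabla ∈ S.connections,
      ∃ e : atlas (EuclideanHalfSpace (d + 1)) M, x ∈ e.1.source ∧ SpanCondition nabla e x)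
    (q : boundaryReduction d M) :
    Set.BijOn (restrictForm omega q) Set.univ (projLieAlgebra (stabHyperplane d)) := by
  obtain ⟨nabla, hn, e, hs, hsp⟩ := hspan (baseOf q.1) q.2.1
  have hmaps : ∀ v, restrictForm omega q v ∈ projLieAlgebra (stabHyperplane d) := fun v =>
    mem_projLieAlgebra_stabHyperplane.2
      ⟨((homega.connection.bijOn q.1).mapsTo (mem_univ _)).1,
        isFlagRow_pullback hk homega hn hs hsp v⟩
  have hinj : Function.Injective (restrictForm omega q) := fun v w h =>
    injective_mfderiv_boundaryReduction_val q
      ((homega.connection.bijOn q.1).injOn (mem_univ _) (mem_univ _) h)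
  refine ⟨fun v _ => hmaps v, hinj.injOn, fun Y hY => ?_⟩
  let eta := (restrictForm omega q).codRestrict (LinearMap.ker (lieEquations d))
    fun v => mem_ker_lieEquations.2 (hmaps v)
  have hdim : Module.finrank ℝ (TangentSpace (𝓡 ((d + 1) * (d + 2))) q) =
      Module.finrank ℝ (LinearMap.ker (lieEquations d)) := by
    rw [finrank_ker_lieEquations]
    exact finrank_euclideanSpace_fin
  have : FiniteDimensional ℝ (TangentSpace (𝓡 ((d + 1) * (d + 2))) q) :=
    inferInstanceAs (FiniteDimensional ℝ (EuclideanSpace ℝ (Fin ((d + 1) * (d + 2)))))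
  have heta : Function.Injective eta := fun v w h => hinj (congrArg Subtype.val h)
  obtain ⟨v, hv⟩ := (LinearMap.injective_iff_surjective_of_finrank_eq_finrank hdim).1 heta
    ⟨Y, mem_ker_lieEquations.2 hY⟩
  exact ⟨v, mem_univ _, congrArg Subtype.val hv⟩

theorem isCartanConnection_restrictForm {k : WithTop ℕ∞} [IsManifold (𝓡∂ (d + 1)) k M]
    [(projCore d M).IsContMDiff (𝓡∂ (d + 1)) k] (hk0 : k ≠ 0) (hk : k + 1 ≤ k)
    {S : ProjectiveStructure d k M}
    {omega : MatrixForm d M} (homega : IsNormalCartanConnection S omega)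
    (hspan : ∀ x ∈ (𝓡∂ (d + 1)).boundary M, ∃ nabla ∈ S.connections,
      ∃ e : atlas (EuclideanHalfSpace (d + 1)) M, x ∈ e.1.source ∧ SpanCondition nabla e x) :
    IsCartanConnection (𝓡 ((d + 1) * (d + 2))) k (stabHyperplane d) (isotropyFlag d)
      boundaryAct (restrictForm omega) where
  contMDiff := contMDiff_restrictForm hk homega.connection.contMDiff
  equivariant := restrictForm_equivariant homega.connection
  fundamental := restrictForm_fundamental homega.connection
  bijOn := restrictForm_bijOn hk0 homega hspan

end Main

end ProjBoundary

end

theorem mainTheorem7 (d : ℕ) (hd : 1 ≤ d) (k : WithTop ℕ∞) (hk : k = ∞ ∨ k = ω)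
    (M : Type*) [TopologicalSpace M] [ChartedSpace (EuclideanHalfSpace (d + 1)) M]
    [IsManifold (𝓡∂ (d + 1)) ∞ M] [IsManifold (𝓡∂ (d + 1)) k M]
    (S : ProjectiveStructure d k M) (omega : MatrixForm d M)
    (homega : IsNormalCartanConnection S omega)
    (hspan : ∀ x ∈ (𝓡∂ (d + 1)).boundary M, ∃ nabla ∈ S.connections,
      ∃ e : atlas (EuclideanHalfSpace (d + 1)) M, x ∈ e.1.source ∧ SpanCondition nabla e x) :
    (∀ nabla ∈ S.connections, ∀ (e : atlas (EuclideanHalfSpace (d + 1)) M)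
      (sigma : M → projBundle d M), IsCanonicalSection nabla e sigma →
      ∀ x ∈ e.1.source, x ∈ (𝓡∂ (d + 1)).boundary M → sigma x ∈ boundaryReduction d M) ∧
    (∃ (_ : ChartedSpace (EuclideanSpace ℝ (Fin ((d + 1) * (d + 2)))) (boundaryReduction d M))
      (_ : IsManifold (𝓡 ((d + 1) * (d + 2))) ∞ (boundaryReduction d M)),
      IsManifold (𝓡 ((d + 1) * (d + 2))) k (boundaryReduction d M) ∧
      ContMDiff (𝓡 ((d + 1) * (d + 2))) (projModel d) k
        (Subtype.val : boundaryReduction d M → projBundle d M) ∧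
      (∀ q, Function.Injective (mfderiv (𝓡 ((d + 1) * (d + 2))) (projModel d)
        (Subtype.val : boundaryReduction d M → projBundle d M) q)) ∧
      IsCartanGeometry (𝓡 d) (𝓡 ((d + 1) * (d + 2))) k (stabHyperplane d) (isotropyFlag d)
        boundaryProj boundaryAct
        (fun q => (omega q.1).comp (mfderiv (𝓡 ((d + 1) * (d + 2))) (projModel d)
          (Subtype.val : boundaryReduction d M → projBundle d M) q).toLinearMap)) ∧
    ¬ IsEffectiveKlein (stabHyperplane d) (isotropyFlag d) := by

  have hk0 : k ≠ 0 := by rcases hk with rfl | rfl <;> simp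
  -- Both `∞` and `ω` absorb finitely many derivatives.
  have hk1 : k + 1 ≤ k := by rcases hk with rfl | rfl <;> exact le_rfl
  have hk2 : k + 1 + 1 ≤ k := by rcases hk with rfl | rfl <;> exact le_rfl
  have := projCore_isContMDiff_of_le (d := d) (M := M) hk2
  exact ⟨fun nabla hn e sigma hsigma x hx hb =>
      canonicalSection_mem_boundaryReduction hsigma hx hb,
    ⟨flagChartedSpace d M, inferInstance, isManifold_boundaryReduction,
      contMDiff_boundaryReduction_val, injective_mfderiv_boundaryReduction_val,
      ⟨isotropyFlag_le_stabHyperplane, isPrincipalBundle_boundaryReduction,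
        isCartanConnection_restrictForm hk0 hk1 homega hspan⟩⟩,
    not_isEffectiveKlein d⟩
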